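/- **Conditional diagrams.** Let $\mathcal V$ be a set of variables. A *conditional diagram* with input set $A$ and output set $B$ is a finite undirected multigraph (loops and parallel edges allowed) with boundary vertices $A+B$, each of degree one, and interior vertices of the following types: $Z(\alpha,U)$ and $X(\alpha,U)$, of any degree, with $\alpha\in\mathbb R/2\pi\mathbb Z$ and $U\subseteq\mathcal V$ (where $U=\emptyset$ if $\alpha=0$; the labels $0$ and $\emptyset$ are omitted), and $H$, of degree two. A vertex is *conditional* if $U\neq\emptyset$; a diagram is *unconditional* if it has no conditional vertex. Diagrams are identified if they are isomorphic as labelled graphs by an isomorphism that fixes the boundary. **Rewriting.** $D$ *rewrites* to $D'$ if $D'$ is obtained from $D$ by finitely many replacements of a subdiagram by means of the following rules (which hold up to scalar factors), used in either direction, and also with the colours $Z$ and $X$ exchanged: - (spider) $Z(\alpha,U)$ and $Z(\beta,U)$ joined by an edge become one vertex $Z(\alpha+\beta,U)$ with all the remaining legs (a vertex with angle $0$ counts as labelled by any $U$); - (anti-loop) a self-loop at a $Z$ vertex is removed; - ($\alpha$-commute) two $Z$ vertices joined by an edge exchange their labels; - (identity) a $Z$ vertex of degree two with angle $0$ on an edge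 is replaced by the bare edge; - (copying) an $X$ vertex of degree one with angle $0$ attached to a $Z$ vertex with $n$ other legs: both are replaced by an $X$ vertex of degree one with angle $0$ on each of the $n$ legs; - ($\pi$-commute) if $U=\emptyset$ or $U=W$ or $-\beta=\beta$, then a vertex $X(\pi,U)$ of degree two on one leg of a vertex $Z(\beta,W)$ is removed, a vertex $X(\pi,U)$ of degree two is put on each of the other legs, and $Z(\beta,W)$ becomes $Z(-\beta,W)$; - (bialgebra) two $Z$ and two $X$ vertices with angle $0$, each with one external leg, with an edge between each $Z$ and each $X$, are replaced by one $X$ vertex with angle $0$ that carries the two external legs of the former $Z$ vertices, one $Z$ vertex with angle $0$ that carries the two external legs of the former $X$ vertices, and one edge between them; - (Hopf) a $Z$ and an $X$ vertex with angle $0$, each with one external leg, joined by two edges: both edges are removed; - ($H$-commute) a $Z(\alpha,U)$ vertex becomes $X(\alpha,U)$ with an $H$ vertex inserted on each leg; - ($H$-cancel) two consecutive $H$ vertices on an edge are replaced by the bare edge. **Circuit-like diagrams.** A diagram is *circuit-like* if (C1) all its vertices can be covered by a set $\mathcal P$ of disjoint directed paths, each of which ends in an output; (C2) every oriented cycle that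 contains edges from at least two different paths of $\mathcal P$ traverses at least one path edge in the direction opposite to that of its path; (C3) it is a simple graph, and adjacent interior vertices have different colours among $Z,X,H$. **Patterns.** A *pattern* with finite qubit set $V$ is a finite sequence of commands $N_i$ (initialise), $E_{ij}$ (entangle), $M_i^\alpha$ (measure), and corrections $X_i,Z_i$ (unconditional) or $X_i^s,Z_i^s$ (controlled by the signal of qubit $s$), such that: $N_i$ is the first command acting on $i$; $M_i^\alpha$ is the last command acting on $i$; a command controlled by $s$ comes after the measurement of $s$; all $N$ commands come first, then all $E$ commands, then measurements and corrections (standard form, with conditional measurements expanded into corrections followed by a measurement); every $E_{ij}$ has $i\ne j$, and each pair of qubits is entangled by at most one command. The inputs $I$ are the qubits that are not initialised, the outputs $O$ those that are not measured. The *geometry* of $P$ is the open graph on $V$ with inputs $I$ and outputs $O$ in which $u\sim v$ iff $E_{uv}$ or $E_{vu}$ occurs in $P$. The diagram $D(P)$, over the variables $V$, with inputs $I$ and outputs $O$, is the composite of the following pieces in the order of the commands: $N_i$ is a $Z$ vertex of degree one with angle $0$; $E_{ij}$ is a $Z$ vertex with angle $0$ on each of the wires $i$ and $j$, the two joined through an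 $H$ vertex; $M_i^\alpha$ is a vertex $Z(\pi,\{i\})$ of degree two followed by a vertex $Z(-\alpha)$ of degree one; $X_i^s$ and $Z_i^s$ are vertices $X(\pi,\{s\})$ and $Z(\pi,\{s\})$ of degree two on the wire $i$ (with $\emptyset$ in place of $\{s\}$ for the unconditional corrections). A *flow* on an open graph $(G,I,O)$ is a pair $(f,\prec)$ of a map $f:V\setminus O\to V\setminus I$ and a strict partial order $\prec$ on $V$ such that for all $u\in V\setminus O$ and $v \in V$: $f(u)\sim u$; $u\prec f(u)$; and if $f(u)\sim v$ and $u\neq v$, then $u\prec v$. **Theorem.** Let $P$ be a pattern whose geometry has a flow $(f,\prec)$. Suppose that the corrections of $P$ that are controlled by signals are precisely the following, each occurring once: for every measured qubit $i$, the corrector $X^i_{f(i)}$ and the correctors $Z^i_j$ for all $j\neq i$ adjacent to $f(i)$. Then $D(P)$ rewrites to an unconditional circuit-like diagram. -/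

import Mathlib

namespace ZX

/-! ### Labels and vertices -/

/-- The two observables. -/
inductive Colour where
  | Z
  | X

/-- Exchange of the two colours. -/
def Colour.swap : Colour → Colour
  | .Z => .X
  | .X => .Z

/-- The label of a `Z` or `X` vertex: an angle modulo `2π` and a set of variables; a vertex whose
angle is zero carries no variables. -/
structure Phase (𝒱 : Type) where
  angle : Real.Angle
  cond : Set 𝒱
  cond_eq_empty : angle = 0 → cond = ∅

/-- The label `α, U` (with `U` forgotten if `α = 0`). -/
def Phase.on {𝒱 : Type} (α : Real.Angle) (U : Set 𝒱) : Phase 𝒱 where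
  angle := α
  cond := {s | s ∈ U ∧ α ≠ 0}
  cond_eq_empty h := by simp [h]

/-- The types of interior vertices of conditional diagrams. -/
inductive Kind (𝒱 : Type) where
  | spider (c : Colour) (φ : Phase 𝒱)
  | hadamard

/-- Two vertex types have the same colour (out of `Z`, `X`, `H`). -/
def Kind.SameColour {𝒱 : Type} : Kind 𝒱 → Kind 𝒱 → Prop
  | .spider c _, .spider c' _ => c = c'
  | .hadamard, .hadamard => True
  | _, _ => False

/-! ### Conditional diagrams -/

/-- Conditional diagrams over the variables `𝒱` with boundary vertices indexed by `Δ`.  The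
underlying undirected multigraph is given by its half-edges: `Port` is the set of half-edges at
interior vertices, every boundary vertex has exactly one half-edge (it has degree one), and `link`
matches each half-edge with the other half of its edge. -/
structure Diagram (𝒱 Δ : Type) where
  Node : Type
  Port : Type
  finite_node : Finite Node
  finite_port : Finite Port
  kind : Node → Kind 𝒱
  node : Port → Node
  link : Port ⊕ Δ → Port ⊕ Δ
  link_link : ∀ x, link (link x) = x
  link_ne : ∀ x, link x ≠ x
  hadamard_degree : ∀ n, kind n = .hadamard →
    ∃ p q, p ≠ q ∧ ∀ r, node r = n ↔ r = p ∨ r = q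

namespace Diagram

variable {𝒱 Δ : Type}

/-- Isomorphism of labelled graphs that fixes the boundary. -/
structure Iso (D D' : Diagram 𝒱 Δ) where
  nodeEquiv : D.Node ≃ D'.Node
  portEquiv : D.Port ≃ D'.Port
  kind_eq : ∀ n, D'.kind (nodeEquiv n) = D.kind n
  node_eq : ∀ p, D'.node (portEquiv p) = nodeEquiv (D.node p)
  link_eq : ∀ x, D'.link (Sum.map portEquiv id x) = Sum.map portEquiv id (D.link x)

/-- Renaming the boundary vertices. -/
def relabel {Δ' : Type} (D : Diagram 𝒱 Δ) (e : Δ ≃ Δ') : Diagram 𝒱 Δ' where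
  Node := D.Node
  Port := D.Port
  finite_node := D.finite_node
  finite_port := D.finite_port
  kind := D.kind
  node := D.node
  link x := Sum.map id e (D.link (Sum.map id e.symm x))
  link_link x := by
    have h : ∀ y : D.Port ⊕ Δ, Sum.map id e.symm (Sum.map id e y) = y := by
      rintro (y | y) <;> simp
    rw [h, D.link_link]
    rcases x with x | x <;> simp
  link_ne x h := by
    apply D.link_ne (Sum.map id e.symm x)
    have := congrArg (Sum.map id e.symm) h
    simpa using this
  hadamard_degree := D.hadamard_degree

open Classical in
/-- Cutting the edge of the half-edge `x` open: it is replaced by two edges, which end in the two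
new boundary vertices `false` (on the side of `x`) and `true` (on the other side). -/
noncomputable def cutLink {T : Type} (link : T → T) (x : T) : T ⊕ Bool → T ⊕ Bool
  | .inl y => if y = x then .inr false else if y = link x then .inr true else .inl (link y)
  | .inr false => .inl x
  | .inr true => .inl (link x)

theorem cutLink_cutLink {T : Type} {link : T → T} (h : ∀ x, link (link x) = x)
    (hne : ∀ x, link x ≠ x) (x : T) (y : T ⊕ Bool) :
    cutLink link x (cutLink link x y) = y := by
  rcases y with y | y | y
  · by_cases h1 : y = x
    · simp [cutLink, h1]
    · by_cases h2 : y = link x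
      · simp [cutLink, h2, hne]
      · have h3 : link y ≠ x := fun h' => h2 (by rw [← h', h])
        have h4 : link y ≠ link x := fun h' => h1 (by rw [← h y, h', h])
        simp [cutLink, h1, h2, h3, h4, h]
  · simp [cutLink]
  · simp [cutLink, hne]

theorem cutLink_ne {T : Type} {link : T → T} (hne : ∀ x, link x ≠ x) (x : T) (y : T ⊕ Bool) :
    cutLink link x y ≠ y := by
  rcases y with y | y | y
  · by_cases h1 : y = x
    · simp [cutLink, h1]
    · by_cases h2 : y = link x
      · simp [cutLink, h2, hne]
      · simp [cutLink, h1, h2, hne]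
  · simp [cutLink]
  · simp [cutLink]

/-- The diagram with the edge of `x` cut open. -/
noncomputable def cut (D : Diagram 𝒱 Δ) (x : D.Port ⊕ Δ) : Diagram 𝒱 (Δ ⊕ Bool) where
  Node := D.Node
  Port := D.Port
  finite_node := D.finite_node
  finite_port := D.finite_port
  kind := D.kind
  node := D.node
  link y := Equiv.sumAssoc _ _ _ (cutLink D.link x ((Equiv.sumAssoc _ _ _).symm y))
  link_link y := by simp [cutLink_cutLink D.link_link D.link_ne]
  link_ne y h := cutLink_ne D.link_ne x ((Equiv.sumAssoc _ _ _).symm y)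
    ((Equiv.sumAssoc _ _ _).injective (by simpa using h))
  hadamard_degree := D.hadamard_degree

end Diagram

/-! ### Subdiagrams and their replacement -/

/-- A diagram with boundary `K` none of whose edges joins two boundary vertices: `leg k` is the
interior vertex at which the `k`-th external wire ends, and the edge `e` joins the vertices
`ends e false` and `ends e true`. -/
structure Fragment (𝒱 K : Type) where
  Node : Type
  Edge : Type
  finite_node : Finite Node
  finite_edge : Finite Edge
  kind : Node → Kind 𝒱
  leg : K → Node
  ends : Edge → Bool → Node
  hadamard_degree : ∀ n, kind n = .hadamard →
    ∃ p q : K ⊕ Edge × Bool, p ≠ q ∧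
      ∀ r, Sum.elim leg (fun e => ends e.1 e.2) r = n ↔ r = p ∨ r = q

/-- The half-edges of `C` with a fragment plugged in, sorted into those matched by the context
and those matched inside the fragment. -/
def plugEquiv (P Δ K Q : Type) : (P ⊕ (K ⊕ Q)) ⊕ Δ ≃ (P ⊕ (Δ ⊕ K)) ⊕ Q where
  toFun
    | .inl (.inl p) => .inl (.inl p)
    | .inl (.inr (.inl k)) => .inl (.inr (.inr k))
    | .inl (.inr (.inr q)) => .inr q
    | .inr b => .inl (.inr (.inl b))
  invFun
    | .inl (.inl p) => .inl (.inl p)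
    | .inl (.inr (.inr k)) => .inl (.inr (.inl k))
    | .inr q => .inl (.inr (.inr q))
    | .inl (.inr (.inl b)) => .inr b
  left_inv x := by rcases x with (x | x | x) | x <;> rfl
  right_inv x := by rcases x with (x | x | x) | x <;> rfl

/-- `C[L]`: the boundary vertices `K` of the context `C` are erased and their wires are attached
to the corresponding vertices of `L`. -/
def Diagram.plug {𝒱 Δ K : Type} [Finite K] (C : Diagram 𝒱 (Δ ⊕ K)) (L : Fragment 𝒱 K) :
    Diagram 𝒱 Δ where
  Node := C.Node ⊕ L.Node
  Port := C.Port ⊕ (K ⊕ L.Edge × Bool)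
  finite_node := by
    have := C.finite_node
    have := L.finite_node
    infer_instance
  finite_port := by
    have := C.finite_port
    have := L.finite_edge
    infer_instance
  kind := Sum.elim C.kind L.kind
  node := Sum.map C.node (Sum.elim L.leg fun e => L.ends e.1 e.2)
  link x := (plugEquiv _ _ _ _).symm
    (Sum.map C.link (fun e : L.Edge × Bool => (e.1, !e.2)) (plugEquiv _ _ _ _ x))
  link_link x := by
    rw [Equiv.apply_symm_apply, Equiv.symm_apply_eq]
    rcases plugEquiv C.Port Δ K (L.Edge × Bool) x with y | y <;> simp [C.link_link]
  link_ne x h := by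
    rw [Equiv.symm_apply_eq] at h
    rcases h' : plugEquiv C.Port Δ K (L.Edge × Bool) x with y | y
    · rw [h'] at h
      exact C.link_ne y (by simpa using h)
    · rw [h'] at h
      have := congrArg (Sum.map id Prod.snd) h
      simp at this
  hadamard_degree n hn := by
    rcases n with n | n
    · obtain ⟨p, q, hpq, h⟩ := C.hadamard_degree n hn
      refine ⟨.inl p, .inl q, by simpa using hpq, ?_⟩
      rintro (r | r)
      · simpa using h r
      · simp
    · obtain ⟨p, q, hpq, h⟩ := L.hadamard_degree n hn
      refine ⟨.inr p, .inr q, by simpa using hpq, ?_⟩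
      rintro (r | r)
      · simp
      · simpa using h r

namespace Fragment

variable {𝒱 : Type}

/-- One spider with legs `K` and a self-loop for each element of `E`. -/
def one (c : Colour) (φ : Phase 𝒱) (E K : Type) [Finite E] : Fragment 𝒱 K where
  Node := Unit
  Edge := E
  finite_node := inferInstance
  finite_edge := inferInstance
  kind _ := .spider c φ
  leg _ := ()
  ends _ _ := ()
  hadamard_degree _ h := by simp at h

/-- Two spiders, the first with legs `K₁`, the second with legs `K₂`, joined by an edge for each
element of `E`. -/
def two (c₁ : Colour) (φ₁ : Phase 𝒱) (c₂ : Colour) (φ₂ : Phase 𝒱) (E K₁ K₂ : Type) [Finite E] :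
    Fragment 𝒱 (K₁ ⊕ K₂) where
  Node := Bool
  Edge := E
  finite_node := inferInstance
  finite_edge := inferInstance
  kind
    | false => .spider c₁ φ₁
    | true => .spider c₂ φ₂
  leg := Sum.elim (fun _ => false) (fun _ => true)
  ends _ b := b
  hadamard_degree n h := by cases n <;> simp at h

/-- A separate spider of degree one on each wire. -/
def points (c : Colour) (φ : Phase 𝒱) (K : Type) [Finite K] : Fragment 𝒱 K where
  Node := K
  Edge := Empty
  finite_node := inferInstance
  finite_edge := inferInstance
  kind _ := .spider c φ
  leg := id
  ends e := e.elim
  hadamard_degree _ h := by simp at h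

/-- A spider with legs `K ⊕ K'`, with a vertex of type `ray` of degree two inserted on each of the
legs in `K`. -/
def star (c : Colour) (φ : Phase 𝒱) (ray : Kind 𝒱) (K K' : Type) [Finite K] :
    Fragment 𝒱 (K ⊕ K') where
  Node := K ⊕ Unit
  Edge := K
  finite_node := inferInstance
  finite_edge := inferInstance
  kind
    | .inl _ => ray
    | .inr _ => .spider c φ
  leg := Sum.map id (fun _ => ())
  ends
    | _, false => .inr ()
    | k, true => .inl k
  hadamard_degree n h := by
    rcases n with k | n
    · refine ⟨.inl (.inl k), .inr (k, true), by simp, ?_⟩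
      rintro ((r | r) | ⟨r, _ | _⟩) <;> simp
    · simp at h

/-- Two spiders `c` and two spiders of the other colour, each of degree three, all without angle,
with an edge between any two spiders of different colours. -/
noncomputable def square (c : Colour) : Fragment 𝒱 (Bool ⊕ Bool) where
  Node := Bool ⊕ Bool
  Edge := Bool × Bool
  finite_node := inferInstance
  finite_edge := inferInstance
  kind
    | .inl _ => .spider c (.on 0 ∅)
    | .inr _ => .spider c.swap (.on 0 ∅)
  leg := id
  ends
    | e, false => .inl e.1
    | e, true => .inr e.2
  hadamard_degree n h := by rcases n with n | n <;> simp at h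

/-- Two consecutive Hadamard vertices. -/
def hh : Fragment 𝒱 Bool where
  Node := Bool
  Edge := Unit
  finite_node := inferInstance
  finite_edge := inferInstance
  kind _ := .hadamard
  leg := id
  ends _ b := b
  hadamard_degree n _ := by
    refine ⟨.inl n, .inr ((), n), by simp, ?_⟩
    rintro (r | ⟨_, r⟩) <;> simp

end Fragment

/-! ### The rewrite rules -/

/-- The rules of the conditional calculus both sides of which have a vertex at every external
wire, for both colours.  As usual, scalar factors are ignored. -/
inductive Rule {𝒱 : Type} : {K : Type} → Fragment 𝒱 K → Fragment 𝒱 K → Prop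
  | spider (c : Colour) (α β : Real.Angle) (U : Set 𝒱) (K₁ K₂ : Type) :
      Rule (.two c (.on α U) c (.on β U) Unit K₁ K₂) (.one c (.on (α + β) U) Empty (K₁ ⊕ K₂))
  | antiLoop (c : Colour) (φ : Phase 𝒱) (K : Type) :
      Rule (.one c φ Unit K) (.one c φ Empty K)
  | alphaCommute (c : Colour) (φ ψ : Phase 𝒱) (K₁ K₂ : Type) :
      Rule (.two c φ c ψ Unit K₁ K₂) (.two c ψ c φ Unit K₁ K₂)
  | copying (c : Colour) (φ : Phase 𝒱) (K : Type) [Finite K] :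
      Rule (.two c φ c.swap (.on 0 ∅) Unit K Empty) (.points c.swap (.on 0 ∅) (K ⊕ Empty))
  /- The side condition says that the rule is true for every valuation of the variables: the angle
  `β` changes its sign whenever the vertex `π, U` is active. -/
  | piCommute (c : Colour) (β : Real.Angle) (U W : Set 𝒱) (K : Type) [Finite K]
      (h : U = ∅ ∨ U = W ∨ -β = β) :
      Rule (.two c (.on β W) c.swap (.on Real.pi U) Unit K Unit)
        (.star c (.on (-β) W) (.spider c.swap (.on Real.pi U)) K Unit)
  | bialgebra (c : Colour) :
      Rule (.square c) (.two c.swap (.on 0 ∅) c (.on 0 ∅) Unit Bool Bool)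
  | hopf (c : Colour) :
      Rule (.two c (.on 0 ∅) c.swap (.on 0 ∅) Bool Unit Unit)
        (.two c (.on 0 ∅) c.swap (.on 0 ∅) Empty Unit Unit)
  | hCommute (c : Colour) (φ : Phase 𝒱) (K : Type) [Finite K] :
      Rule (.one c φ Empty (K ⊕ Empty)) (.star c.swap φ .hadamard K Empty)

/-- One application of a rule inside a diagram (diagrams are taken up to isomorphism).  The two
rules whose right-hand side is a bare wire are stated by inserting their left-hand side into an
arbitrary edge. -/
inductive Step {𝒱 Δ : Type} : Diagram 𝒱 Δ → Diagram 𝒱 Δ → Prop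
  | iso {D D' : Diagram 𝒱 Δ} (e : D.Iso D') : Step D D'
  | rule {K : Type} [Finite K] {L R : Fragment 𝒱 K} (h : Rule L R) (C : Diagram 𝒱 (Δ ⊕ K)) :
      Step (C.plug L) (C.plug R)
  | identity (D : Diagram 𝒱 Δ) (x : D.Port ⊕ Δ) (c : Colour) :
      Step ((D.cut x).plug (.one c (.on 0 ∅) Empty Bool)) D
  | hCancel (D : Diagram 𝒱 Δ) (x : D.Port ⊕ Δ) : Step ((D.cut x).plug .hh) D

/-- `D` rewrites to `D'`: the rules are equations, so they may be used in both directions. -/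
def Rewrites {𝒱 Δ : Type} (D D' : Diagram 𝒱 Δ) : Prop :=
  Relation.EqvGen Step D D'

/-! ### Circuit-like diagrams -/

namespace Diagram

variable {𝒱 Δ : Type}

/-- A diagram without conditional vertices. -/
def Unconditional (D : Diagram 𝒱 Δ) : Prop :=
  ∀ n c φ, D.kind n = .spider c φ → φ.cond = ∅

/-- All vertices, interior ones and boundary ones. -/
abbrev Vertex (D : Diagram 𝒱 Δ) : Type := D.Node ⊕ Δ

/-- The vertex at a half-edge. -/
def vertex (D : Diagram 𝒱 Δ) : D.Port ⊕ Δ → D.Vertex := Sum.map D.node id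

/-- The multigraph has neither self-loops nor parallel edges. -/
def IsSimple (D : Diagram 𝒱 Δ) : Prop :=
  (∀ x, D.vertex (D.link x) ≠ D.vertex x) ∧
    ∀ x y, D.vertex x = D.vertex y → D.vertex (D.link x) = D.vertex (D.link y) → x = y

/-- Adjacent interior vertices have different colours among `Z`, `X`, `H`. -/
def IsThreeColoured (D : Diagram 𝒱 Δ) : Prop :=
  ∀ p q, D.link (.inl p) = .inl q → ¬ (D.kind (D.node p)).SameColour (D.kind (D.node q))

/-- The adjacency relation of the diagram. -/
def graph (D : Diagram 𝒱 Δ) : SimpleGraph D.Vertex where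
  Adj u v := u ≠ v ∧ ∃ x, D.vertex x = u ∧ D.vertex (D.link x) = v
  symm := ⟨by
    rintro u v ⟨h, x, hx, hy⟩
    exact ⟨h.symm, D.link x, hy, by rw [D.link_link, hx]⟩⟩
  loopless := ⟨fun u h => h.1 rfl⟩

variable {A B : Type}

/-- A set of disjoint directed paths, each of which ends in an output, that cover all vertices. -/
structure IsPathCover (D : Diagram 𝒱 (A ⊕ B)) (Ps : Set (List D.Vertex)) : Prop where
  chain : ∀ p ∈ Ps, p.IsChain D.graph.Adj
  nodup : ∀ p ∈ Ps, p.Nodup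
  ends_in_output : ∀ p ∈ Ps, ∃ b : B, p.getLast? = some (.inr (.inr b))
  disjoint : ∀ p ∈ Ps, ∀ q ∈ Ps, p ≠ q → p.Disjoint q
  cover : ∀ v, ∃ p ∈ Ps, v ∈ p

/-- The directed path `p` runs from `u` to `v` in one step. -/
def PathEdge {T : Type} (p : List T) (u v : T) : Prop := [u, v] <:+: p

/-- Every oriented cycle that contains edges from two different paths traverses at least one path
edge against the direction of its path. -/
def IsCausal (D : Diagram 𝒱 (A ⊕ B)) (Ps : Set (List D.Vertex)) : Prop :=
  ∀ (v : D.Vertex) (γ : D.graph.Walk v v), γ.IsCycle →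
    (∃ p ∈ Ps, ∃ q ∈ Ps, p ≠ q ∧
      (∃ d ∈ γ.darts, PathEdge p d.fst d.snd ∨ PathEdge p d.snd d.fst) ∧
      ∃ d ∈ γ.darts, PathEdge q d.fst d.snd ∨ PathEdge q d.snd d.fst) →
    ∃ p ∈ Ps, ∃ d ∈ γ.darts, PathEdge p d.snd d.fst

/-- Circuit-like diagrams with inputs `A` and outputs `B`. -/
def CircuitLike (D : Diagram 𝒱 (A ⊕ B)) : Prop :=
  (∃ Ps, D.IsPathCover Ps ∧ D.IsCausal Ps) ∧ D.IsSimple ∧ D.IsThreeColoured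

end Diagram

/-! ### Open graphs and flow -/

/-- Open graphs. -/
structure OpenGraph (V : Type) where
  graph : SimpleGraph V
  inputs : Set V
  outputs : Set V

/-- A flow `(f, ≺)` on an open graph. -/
structure OpenGraph.Flow {V : Type} (G : OpenGraph V) where
  f : {v // v ∉ G.outputs} → {v // v ∉ G.inputs}
  lt : V → V → Prop
  lt_strict : IsStrictOrder V lt
  adj : ∀ u : {v // v ∉ G.outputs}, G.graph.Adj (f u).1 u.1
  lt_f : ∀ u : {v // v ∉ G.outputs}, lt u.1 (f u).1
  lt_of_adj : ∀ (u : {v // v ∉ G.outputs}) (v : V), G.graph.Adj (f u).1 v → u.1 ≠ v → lt u.1 v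

/-! ### Patterns of the measurement calculus -/

/-- The commands: initialisation, entangling, measurement, and the corrections, which are
either unconditional (`none`) or controlled by the signal of a qubit. -/
inductive Command (V : Type) where
  | N (i : V)
  | E (i j : V)
  | M (i : V) (α : Real.Angle)
  | X (i : V) (s : Option V)
  | Z (i : V) (s : Option V)

namespace Command

variable {V : Type}

/-- The command acts on the qubit `q`. -/
def ActsOn : Command V → V → Prop
  | N i, q => q = i
  | E i j, q => q = i ∨ q = j
  | M i _, q => q = i
  | X i _, q => q = i
  | Z i _, q => q = i

/-- The command is controlled by the signal `s`. -/
def DependsOn : Command V → V → Prop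
  | X _ t, s => t = some s
  | Z _ t, s => t = some s
  | _, _ => False

def IsInit : Command V → Prop
  | N _ => True
  | _ => False

def IsEntangle : Command V → Prop
  | E _ _ => True
  | _ => False

end Command

/-- Patterns with qubits `V`, in standard form with conditional measurements written as corrections
followed by an unconditional measurement.  The commands are listed in the order of execution. -/
structure Pattern (V : Type) where
  cmds : List (Command V)
  init_first : ∀ l₁ l₂ q, cmds = l₁ ++ .N q :: l₂ → ∀ c ∈ l₁, ¬ c.ActsOn q
  measure_last : ∀ l₁ l₂ q α, cmds = l₁ ++ .M q α :: l₂ → ∀ c ∈ l₂, ¬ c.ActsOn q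
  causal : ∀ l₁ l₂ c s, cmds = l₁ ++ c :: l₂ → c.DependsOn s → ∃ α, .M s α ∈ l₁
  standard : ∃ l₁ l₂ l₃, cmds = l₁ ++ l₂ ++ l₃ ∧ (∀ c ∈ l₁, c.IsInit) ∧
    (∀ c ∈ l₂, c.IsEntangle) ∧ ∀ c ∈ l₃, ¬ c.IsInit ∧ ¬ c.IsEntangle
  entangle_ne : ∀ i, .E i i ∉ cmds
  entangle_once : ∀ l₁ l₂ i j, cmds = l₁ ++ .E i j :: l₂ → .E i j ∉ l₂ ∧ .E j i ∉ l₂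

namespace Pattern

variable {V : Type} (P : Pattern V)

/-- The qubit is measured. -/
def Measured (q : V) : Prop := ∃ α, .M q α ∈ P.cmds

/-- The input qubits are those that are not initialised. -/
def inputs : Set V := {q | .N q ∉ P.cmds}

/-- The output qubits are those that are not measured. -/
def outputs : Set V := {q | ¬ P.Measured q}

/-- The angle at which a measured qubit is measured. -/
noncomputable def angle (q : {q // P.Measured q}) : Real.Angle := q.2.choose

/-- The geometry of a pattern. -/
def geometry : OpenGraph V where
  graph :=
    { Adj := fun u v => u ≠ v ∧ (.E u v ∈ P.cmds ∨ .E v u ∈ P.cmds)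
      symm := ⟨fun _ _ h => ⟨h.1.symm, h.2.symm⟩⟩
      loopless := ⟨fun _ h => h.1 rfl⟩ }
  inputs := P.inputs
  outputs := P.outputs

/-- The corrections controlled by signals are `X` at `f i` and `Z` at the other neighbours of
`f i`, both controlled by `i`, for every measured qubit `i`, each of them once. -/
structure HasFlowCorrectors (F : P.geometry.Flow) : Prop where
  mem_X : ∀ i : {q : V // q ∉ P.geometry.outputs}, .X (F.f i).1 (some i.1) ∈ P.cmds
  mem_Z : ∀ (i : {q : V // q ∉ P.geometry.outputs}) (j : V), j ≠ i.1 →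
    P.geometry.graph.Adj (F.f i).1 j → .Z j (some i.1) ∈ P.cmds
  only_X : ∀ i j : V, .X j (some i) ∈ P.cmds →
    ∃ h : i ∉ P.geometry.outputs, j = (F.f ⟨i, h⟩).1
  only_Z : ∀ i j : V, .Z j (some i) ∈ P.cmds →
    ∃ h : i ∉ P.geometry.outputs, j ≠ i ∧ P.geometry.graph.Adj (F.f ⟨i, h⟩).1 j
  once_X : ∀ i j : V, ¬ List.Duplicate (.X j (some i)) P.cmds
  once_Z : ∀ i j : V, ¬ List.Duplicate (.Z j (some i)) P.cmds

end Pattern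

/-! ### The diagram of a pattern -/

/-- The initialisations: a bare wire for each input, and a `Z` vertex of degree one without angle
for each other qubit. -/
noncomputable def initDiagram {V : Type} [Finite V] (I : Set V) : Diagram V (I ⊕ V) where
  Node := {q // q ∉ I}
  Port := {q // q ∉ I}
  finite_node := inferInstance
  finite_port := inferInstance
  kind _ := .spider .Z (.on 0 ∅)
  node := id
  link
    | .inl q => .inr (.inr q.1)
    | .inr (.inl q) => .inr (.inr q.1)
    | .inr (.inr q) => open Classical in
        if h : q ∈ I then .inr (.inl ⟨q, h⟩) else .inl ⟨q, h⟩
  link_link x := by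
    rcases x with x | x | x
    · simp [x.2]
    · simp
    · by_cases h : x ∈ I <;> simp [h]
  link_ne x := by
    rcases x with x | x | x
    · simp
    · simp
    · by_cases h : x ∈ I <;> simp [h]
  hadamard_degree _ h := by simp at h

/-- The controlled `Z` gate: two `Z` vertices of degree three joined through a Hadamard vertex. -/
noncomputable def czFragment {V : Type} : Fragment V (Bool ⊕ Bool) where
  Node := Bool ⊕ Unit
  Edge := Bool
  finite_node := inferInstance
  finite_edge := inferInstance
  kind
    | .inl _ => .spider .Z (.on 0 ∅)
    | .inr _ => .hadamard
  leg := Sum.elim (fun _ => .inl false) (fun _ => .inl true)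
  ends
    | b, false => .inl b
    | _, true => .inr ()
  hadamard_degree n h := by
    rcases n with n | n
    · simp at h
    · refine ⟨.inr (false, true), .inr (true, true), by simp, ?_⟩
      rintro ((r | r) | ⟨_ | _, _ | _⟩) <;> simp

/-- The measurements of the qubits in `K`, at the angles `α`: a vertex `Z(π, {q})` of degree two
followed by a vertex `Z(-α)` of degree one. -/
noncomputable def measFragment {V : Type} [Finite V] {K : V → Prop}
    (α : {q // K q} → Real.Angle) : Fragment V {q // K q} where
  Node := {q // K q} × Bool
  Edge := {q // K q}
  finite_node := inferInstance
  finite_edge := inferInstance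
  kind
    | (q, false) => .spider .Z (.on Real.pi {q.1})
    | (q, true) => .spider .Z (.on (-α q) ∅)
  leg q := (q, false)
  ends q b := (q, b)
  hadamard_degree n h := by rcases n with ⟨n, _ | _⟩ <;> simp at h

/-- The set of variables that belongs to an optional signal. -/
def signalSet {V : Type} (s : Option V) : Set V := {t | s = some t}

/-- Composing an entangling command or a correction with the output wires.  Initialisations and
measurements are composed with the diagram at its beginning and its end. -/
noncomputable def applyCommand {V A : Type} (D : Diagram V (A ⊕ V)) :
    Command V → Diagram V (A ⊕ V)
  | .N _ => D
  | .M _ _ => D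
  | .E i j => (((D.cut (.inr (.inr i))).cut (.inr (.inl (.inr j)))).relabel
      (Equiv.sumAssoc _ _ _)).plug czFragment
  | .X i s => (D.cut (.inr (.inr i))).plug (.one .X (.on Real.pi (signalSet s)) Empty Bool)
  | .Z i s => (D.cut (.inr (.inr i))).plug (.one .Z (.on Real.pi (signalSet s)) Empty Bool)

open Classical in
/-- Splitting the qubits into outputs and measured qubits. -/
noncomputable def Pattern.splitEquiv {V : Type} (P : Pattern V) :
    P.inputs ⊕ V ≃ (P.inputs ⊕ P.outputs) ⊕ {q // P.Measured q} :=
  ((Equiv.refl _).sumCongr ((Equiv.sumCompl P.Measured).symm.trans (Equiv.sumComm _ _))).trans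
    (Equiv.sumAssoc _ _ _).symm

/-- The diagram `D(P)`, whose variables are the signals of the qubits.  An initialisation is the
first command and a measurement is the last command that acts on its qubit, so the composite of
the commands consists of all initialisations, then the other commands in their order, then all
measurements. -/
noncomputable def Pattern.diagram {V : Type} [Finite V] (P : Pattern V) :
    Diagram V (P.inputs ⊕ P.outputs) :=
  ((P.cmds.foldl applyCommand (initDiagram P.inputs)).relabel P.splitEquiv).plug
    (measFragment P.angle)

end ZX

/-! The signal-controlled corrections express a symmetry of the graph state. For a measured qubit
$i$, let $X^i_{f(i)}$ stand before all entangling commands. Moving it past them leaves $X^i_{f(i)}$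
and $Z^i_j$ for every neighbour $j$ of $f(i)$ (`entanglers_Xs`). These are exactly the correctors of
the pattern together with one more, $Z^i_i$. Since $f(i)$ is not an input, it starts as a `Z` vertex
of degree one with angle zero, which absorbs an `X` vertex of angle $\pi$ (`initDiagram_absorbs`).
The early $X^i_{f(i)}$ may therefore be inserted for free. Corrections commute and square to the
identity up to scalars, so only parities of multiplicities matter (`WordEq.of_even`), and all
correctors cancel except one $Z^i_i$ on each measured qubit. That one cancels with the vertex
$Z(\pi,\{i\})$ of the measurement (`reduces_measured`). What remains is the graph state with
unconditional phases (`Pattern.exists_rewrites_measuredTerm`).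

To turn it into a circuit, extend $\prec$ to a linear order and treat the qubits one after the other
(`Schedule`). The wire of $f(u)$ begins when $u$ is treated. By the flow conditions, every earlier
neighbour of $f(u)$ is treated at that time or later. The spider of a qubit is split accordingly: a
chain of `Z` vertices takes the edges from earlier neighbours, and a last part sends out the edges
to later ones. The Hadamard vertices on the outgoing edges are absorbed by recolouring that last
part as an `X` vertex behind a single Hadamard vertex. `X` vertices of angle zero between the links
of the chain make the colours alternate. The paths go from each measured $u$ to $f(u)$, which is
possible because $f$ is injective. A causal level increases along path edges, except on edges of the
star around a branching vertex, where it is constant. A cycle that never opposes a path would lie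
within one level, hence within one star, which contains no cycle (`not_isCycle_of_level`).

Graph manipulations are carried out on terms: multisets of vertices, each with the multiset of names
of its wires, where every name occurs twice or not at all. A term determines its diagram up to
isomorphism (`Diagram.Described.iso`), so every rule becomes a replacement inside a multiset
(`Reduces`), and sums over qubits can be rewritten summand by summand. -/

/-! ### Multisets of values of finite families -/

open Classical in
/-- The multiset of the values of a finite family. -/
noncomputable def ZX.fam {ι α : Type} [Finite ι] (f : ι → α) : Multiset α :=
  letI := Fintype.ofFinite ι
  ∑ i, {f i}

open Classical in
/-- The multiset of the labels of the half-edges at a node. -/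
noncomputable def ZX.fib {P N W : Type} [Finite P] (node : P → N) (lab : P → W) (n : N) :
    Multiset W :=
  letI := Fintype.ofFinite P
  ∑ p, if node p = n then {lab p} else 0

/-- The elements of a multiset, counted with multiplicity. -/
noncomputable def ZX.occ {α : Type} (m : Multiset α) (i : Fin m.toList.length) : α :=
  m.toList.get i

namespace ZX

section Families

variable {ι κ α β P Q N W : Type}

theorem fam_eq_sum [Fintype ι] (f : ι → α) : fam f = ∑ i, {f i} := by
  unfold fam
  congr!

theorem fam_eq_map [Fintype ι] (f : ι → α) : fam f = Finset.univ.val.map f := by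
  rw [fam_eq_sum, Finset.sum_eq_multiset_sum]
  exact (congrArg Multiset.sum (Multiset.map_map (fun a => ({a} : Multiset α)) f _)).symm.trans
    (Multiset.sum_map_singleton _)

open Classical in
theorem fib_eq_sum [Fintype P] (node : P → N) (lab : P → W) (n : N) :
    fib node lab n = ∑ p, if node p = n then {lab p} else 0 := by
  unfold fib
  congr!

theorem fam_equiv [Finite ι] [Finite κ] (e : ι ≃ κ) (f : κ → α) : fam (fun i => f (e i)) = fam f := by
  cases nonempty_fintype ι
  cases nonempty_fintype κ
  rw [fam_eq_sum, fam_eq_sum]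
  exact Equiv.sum_comp e (fun k => ({f k} : Multiset α))

@[simp] theorem fam_sum [Finite ι] [Finite κ] (f : ι ⊕ κ → α) :
    fam f = fam (fun i => f (.inl i)) + fam (fun k => f (.inr k)) := by
  cases nonempty_fintype ι
  cases nonempty_fintype κ
  rw [fam_eq_sum, fam_eq_sum, fam_eq_sum, Fintype.sum_sum_type]

@[simp] theorem fam_of_isEmpty [IsEmpty ι] (f : ι → α) : fam f = 0 := by
  have := Fintype.ofIsEmpty (α := ι)
  rw [fam_eq_sum, Finset.univ_eq_empty, Finset.sum_empty]

@[simp] theorem fam_unit (f : Unit → α) : fam f = {f ()} := by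
  simp [fam_eq_sum]

@[simp] theorem fam_bool (f : Bool → α) : fam f = {f true} + {f false} := by
  simp [fam_eq_sum]

@[simp] theorem fam_prod_bool [Finite ι] (f : ι × Bool → α) :
    fam f = fam (fun i => f (i, true)) + fam (fun i => f (i, false)) := by
  cases nonempty_fintype ι
  rw [fam_eq_sum, fam_eq_sum, fam_eq_sum, Fintype.sum_prod_type, ← Finset.sum_add_distrib]
  simp only [Fintype.sum_bool]

theorem fam_sigma [Finite ι] {κ : ι → Type} [∀ i, Finite (κ i)] (f : (Σ i, κ i) → α) :
    fam f = (fam fun i => fam fun k => f ⟨i, k⟩).sum := by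
  cases nonempty_fintype ι
  have := fun i => Fintype.ofFinite (κ i)
  simp only [fam_eq_sum, Fintype.sum_sigma]
  rw [← Multiset.coe_sumAddMonoidHom, map_sum]
  simp

theorem map_fam [Finite ι] (g : α → β) (f : ι → α) : (fam f).map g = fam fun i => g (f i) := by
  cases nonempty_fintype ι
  rw [fam_eq_sum, fam_eq_sum, ← Multiset.coe_mapAddMonoidHom, map_sum]
  simp

@[simp] theorem mem_fam [Finite ι] (f : ι → α) (a : α) : a ∈ fam f ↔ ∃ i, f i = a := by
  cases nonempty_fintype ι
  simp [fam_eq_sum, Multiset.mem_sum, eq_comm]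

theorem count_fam [Finite ι] [DecidableEq α] (f : ι → α) (a : α) :
    (fam f).count a = Nat.card {i // f i = a} := by
  cases nonempty_fintype ι
  classical
  rw [fam_eq_sum, Multiset.count_sum', Nat.card_eq_fintype_card, Fintype.card_subtype,
    Finset.card_filter]
  refine Finset.sum_congr rfl fun i _ => ?_
  simp [Multiset.count_singleton, eq_comm]

theorem fam_occ (m : Multiset α) : fam (occ m) = m := by
  rw [fam_eq_map, Fin.univ_val_map]
  exact (congrArg _ (List.ofFn_get m.toList)).trans m.coe_toList

/-- Over each value the two fibres have the same number of elements; bijections between the fibres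
are glued. Both the vertices and the half-edges of isomorphic diagrams are matched in this way. -/
theorem exists_equiv_of_fam_eq [Finite ι] [Finite κ] {f : ι → α} {g : κ → α} (h : fam f = fam g) :
    ∃ e : ι ≃ κ, ∀ i, g (e i) = f i := by
  classical
  have hc : ∀ a, Nonempty ({i // f i = a} ≃ {k // g k = a}) := fun a => by
    rw [← Finite.card_eq, ← count_fam, ← count_fam, h]
  have e := fun a => (hc a).some
  refine ⟨(Equiv.sigmaFiberEquiv f).symm.trans
    ((Equiv.sigmaCongrRight e).trans (Equiv.sigmaFiberEquiv g)), fun i => ?_⟩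
  exact (e (f i) ⟨i, rfl⟩).2

/-- Each half-edge lies at exactly one node, so it is counted once. -/
theorem fam_fib [Finite ι] [Finite N] (node : ι → N) (lab : ι → W) :
    (fam fun n => fib node lab n).sum = fam lab := by
  cases nonempty_fintype ι
  cases nonempty_fintype N
  classical
  simp only [fam_eq_sum, fib_eq_sum]
  rw [← Multiset.coe_sumAddMonoidHom, map_sum]
  simp only [Multiset.coe_sumAddMonoidHom, Multiset.sum_singleton]
  rw [Finset.sum_comm]
  simp

theorem fib_eq_fam [Finite P] (node : P → N) (lab : P → W) (n : N) :
    fib node lab n = fam fun p : {p // node p = n} => lab p := by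
  cases nonempty_fintype P
  classical
  rw [fib_eq_sum, fam_eq_sum, ← Finset.sum_filter]
  exact (Finset.sum_subtype _ (by simp) fun p => ({lab p} : Multiset W))

@[simp] theorem fib_sum [Finite P] [Finite Q] (node : P ⊕ Q → N) (lab : P ⊕ Q → W) (n : N) :
    fib node lab n = fib (fun p => node (.inl p)) (fun p => lab (.inl p)) n +
      fib (fun p => node (.inr p)) (fun p => lab (.inr p)) n := by
  cases nonempty_fintype P
  cases nonempty_fintype Q
  rw [fib_eq_sum, fib_eq_sum, fib_eq_sum, Fintype.sum_sum_type]

@[simp] theorem fib_prod_bool [Finite P] (node : P × Bool → N) (lab : P × Bool → W) (n : N) :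
    fib node lab n = fib (fun p => node (p, true)) (fun p => lab (p, true)) n +
      fib (fun p => node (p, false)) (fun p => lab (p, false)) n := by
  cases nonempty_fintype P
  simp [fib_eq_sum, Fintype.sum_prod_type, Finset.sum_add_distrib]

@[simp] theorem fib_bool (node : Bool → N) (lab : Bool → W) (n : N) [DecidableEq N] :
    fib node lab n = (if node true = n then {lab true} else 0) +
      (if node false = n then {lab false} else 0) := by
  simp only [fib_eq_sum, Fintype.sum_bool]
  congr!

open Classical in
@[simp] theorem fib_unit (node : Unit → N) (lab : Unit → W) (n : N) [DecidableEq N] :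
    fib node lab n = if node () = n then {lab ()} else 0 := by
  simp only [fib_eq_sum, Finset.univ_unique, Finset.sum_singleton]
  congr!

theorem fib_of_forall_eq [Finite P] {node : P → N} {n : N} (h : ∀ p, node p = n) (lab : P → W) :
    fib node lab n = fam lab := by
  cases nonempty_fintype P
  simp [fib_eq_sum, fam_eq_sum, h]

theorem fib_of_forall_ne [Finite P] {node : P → N} {n : N} (h : ∀ p, node p ≠ n) (lab : P → W) :
    fib node lab n = 0 := by
  cases nonempty_fintype P
  simp [fib_eq_sum, h]

theorem fib_of_unique [Finite P] {node : P → N} {p : P} {n : N} (h : ∀ q, node q = n ↔ q = p)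
    (lab : P → W) : fib node lab n = {lab p} := by
  cases nonempty_fintype P
  classical
  simp [fib_eq_sum, h]

theorem map_fib [Finite P] (g : W → β) (node : P → N) (lab : P → W) (n : N) :
    (fib node lab n).map g = fib node (fun p => g (lab p)) n := by
  rw [fib_eq_fam, fib_eq_fam, map_fam]

theorem fib_sigma_fst [Finite ι] {κ : ι → Type} [∀ i, Finite (κ i)] (lab : (Σ i, κ i) → W)
    (i : ι) : fib Sigma.fst lab i = fam fun k => lab ⟨i, k⟩ := by
  rw [fib_eq_fam, ← fam_equiv (Equiv.sigmaSubtype i).symm]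
  rfl

end Families

end ZX

/-! ### Terms and the diagrams they describe -/

namespace ZX

attribute [instance] Diagram.finite_node Diagram.finite_port Fragment.finite_node
  Fragment.finite_edge

section Terms

variable {𝒱 Δ W W' ι : Type}

/-- All wire names that occur at the vertices of a term, a multiset of vertices given by their types
and the names of the wires that end in them. -/
def wires (T : Multiset (Kind 𝒱 × Multiset W)) : Multiset W := (T.map Prod.snd).sum

@[simp] theorem wires_zero : wires (0 : Multiset (Kind 𝒱 × Multiset W)) = 0 := rfl

@[simp] theorem wires_add (S T : Multiset (Kind 𝒱 × Multiset W)) :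
    wires (S + T) = wires S + wires T := by
  simp [wires]

@[simp] theorem wires_singleton (x : Kind 𝒱 × Multiset W) : wires {x} = x.2 := by
  simp [wires]

@[simp] theorem wires_cons (x : Kind 𝒱 × Multiset W) (T : Multiset (Kind 𝒱 × Multiset W)) :
    wires (x ::ₘ T) = x.2 + wires T := by
  simp [wires]

@[simp] theorem wires_sum (s : Finset ι) (T : ι → Multiset (Kind 𝒱 × Multiset W)) :
    wires (∑ i ∈ s, T i) = ∑ i ∈ s, wires (T i) := by
  classical
  induction s using Finset.induction_on with
  | empty => simp
  | insert i s hi ih => simp [Finset.sum_insert hi, ih]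

theorem wires_fam [Finite ι] (f : ι → Kind 𝒱 × Multiset W) :
    wires (fam f) = (fam fun i => (f i).2).sum := by
  rw [wires, map_fam]

/-- Renaming of wires. -/
def rename (g : W → W') (T : Multiset (Kind 𝒱 × Multiset W)) : Multiset (Kind 𝒱 × Multiset W') :=
  T.map fun x => (x.1, x.2.map g)

@[simp] theorem rename_zero (g : W → W') : rename g (0 : Multiset (Kind 𝒱 × Multiset W)) = 0 := rfl

@[simp] theorem rename_add (g : W → W') (S T : Multiset (Kind 𝒱 × Multiset W)) :
    rename g (S + T) = rename g S + rename g T := by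
  simp [rename]

@[simp] theorem rename_singleton (g : W → W') (x : Kind 𝒱 × Multiset W) :
    rename g {x} = {(x.1, x.2.map g)} := by
  simp [rename]

theorem rename_congr {g h : W → W'} {T : Multiset (Kind 𝒱 × Multiset W)}
    (H : ∀ w ∈ wires T, g w = h w) : rename g T = rename h T := by
  refine Multiset.map_congr rfl fun x hx => ?_
  have : x.2.map g = x.2.map h := Multiset.map_congr rfl fun w hw =>
    H w (by
      obtain ⟨T', rfl⟩ := Multiset.exists_cons_of_mem hx
      simp [hw])
  rw [this]

@[simp] theorem rename_id (T : Multiset (Kind 𝒱 × Multiset W)) : rename (fun w => w) T = T := by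
  simp [rename]

theorem rename_rename {W'' : Type} (g : W → W') (h : W' → W'')
    (T : Multiset (Kind 𝒱 × Multiset W)) :
    rename h (rename g T) = rename (fun w => h (g w)) T := by
  simp [rename]

@[simp] theorem wires_rename (g : W → W') (T : Multiset (Kind 𝒱 × Multiset W)) :
    wires (rename g T) = (wires T).map g := by
  induction T using Multiset.induction_on with
  | empty => simp
  | cons x T ih => rw [← Multiset.singleton_add, rename_add]; simp [ih]

open Classical in
/-- The term, with boundary wires `bd`, is the description of a diagram. -/
structure Proper [Finite Δ] (T : Multiset (Kind 𝒱 × Multiset W)) (bd : Δ → W) : Prop where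
  count_eq : ∀ w, (wires T + fam bd).count w = 0 ∨ (wires T + fam bd).count w = 2
  card_hadamard : ∀ x ∈ T, x.1 = .hadamard → Multiset.card x.2 = 2

/-- The wires of `D` can be named so that the vertices and the names of the wires that end in them
form the term `T` and the names of the boundary wires are given by `bd`. -/
def Diagram.Described (D : Diagram 𝒱 Δ) (T : Multiset (Kind 𝒱 × Multiset W)) (bd : Δ → W) : Prop :=
  ∃ lab : D.Port → W, (∀ x y, Sum.elim lab bd x = Sum.elim lab bd y ↔ y = x ∨ y = D.link x) ∧
    fam (fun n => (D.kind n, fib D.node lab n)) = T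

theorem card_fib {P N : Type} [Finite P] (node : P → N) (lab : P → W) (n : N) :
    Multiset.card (fib node lab n) = Nat.card {p // node p = n} := by
  cases nonempty_fintype P
  classical
  rw [fib_eq_fam, fam_eq_map, Multiset.card_map]
  simp

theorem card_eq_two_iff_ports {P N : Type} (node : P → N) (n : N) :
    Nat.card {p // node p = n} = 2 ↔ ∃ p q, p ≠ q ∧ ∀ r, node r = n ↔ r = p ∨ r = q := by
  rw [Nat.card_eq_two_iff]
  constructor
  · rintro ⟨p, q, hpq, h⟩
    refine ⟨p, q, fun h' => hpq (Subtype.ext h'), fun r => ⟨fun hr => ?_, ?_⟩⟩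
    · have : (⟨r, hr⟩ : {p // node p = n}) ∈ ({p, q} : Set _) := h ▸ Set.mem_univ _
      simpa [Subtype.ext_iff] using this
    · rintro (rfl | rfl)
      · exact p.2
      · exact q.2
  · rintro ⟨p, q, hpq, h⟩
    refine ⟨⟨p, (h p).2 (.inl rfl)⟩, ⟨q, (h q).2 (.inr rfl)⟩, by simpa using hpq, ?_⟩
    ext r
    simpa [Subtype.ext_iff] using (h r).1 r.2

/-- The mate is the other element of a fibre with two elements. It provides the fixed-point-free
involution of a diagram out of a labelling. -/
theorem exists_mate {H : Type} [Finite H] {l : H → W}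
    (h : ∀ w, Nat.card {x // l x = w} = 0 ∨ Nat.card {x // l x = w} = 2) (x : H) :
    ∃ y, y ≠ x ∧ ∀ z, l z = l x ↔ z = x ∨ z = y := by
  have h2 : Nat.card {z // l z = l x} = 2 := by
    refine (h (l x)).resolve_left fun h0 => ?_
    have : IsEmpty {z // l z = l x} := by
      rcases Nat.card_eq_zero.1 h0 with h | h
      · exact h
      · exact absurd h (not_infinite_iff_finite.2 inferInstance)
    exact this.false ⟨x, rfl⟩
  obtain ⟨p, q, hpq, h'⟩ := (card_eq_two_iff_ports l (l x)).1 h2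
  rcases (h' x).1 rfl with rfl | rfl
  · exact ⟨q, hpq.symm, h'⟩
  · exact ⟨p, hpq, fun z => (h' z).trans or_comm⟩

/-- The diagram in which the half-edges with equal labels are matched. -/
noncomputable def Diagram.ofLabels {N P : Type} [Finite N] [Finite P] [Finite Δ] (k : N → Kind 𝒱)
    (node : P → N) (lab : P → W) (bd : Δ → W)
    (h : ∀ w, Nat.card {x // Sum.elim lab bd x = w} = 0 ∨ Nat.card {x // Sum.elim lab bd x = w} = 2)
    (had : ∀ n, k n = .hadamard → ∃ p q, p ≠ q ∧ ∀ r, node r = n ↔ r = p ∨ r = q) :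
    Diagram 𝒱 Δ where
  Node := N
  Port := P
  finite_node := inferInstance
  finite_port := inferInstance
  kind := k
  node := node
  link x := (exists_mate h x).choose
  link_link x := by
    have h1 := (exists_mate h x).choose_spec
    have h2 := (exists_mate h (exists_mate h x).choose).choose_spec
    have h3 : Sum.elim lab bd (exists_mate h x).choose = Sum.elim lab bd x := (h1.2 _).2 (.inr rfl)
    rcases (h2.2 x).1 h3.symm with h4 | h4
    · exact absurd h4.symm h1.1
    · exact h4.symm
  link_ne x := (exists_mate h x).choose_spec.1
  hadamard_degree := had

theorem Diagram.ofLabels_labelling {N P : Type} [Finite N] [Finite P] [Finite Δ] (k : N → Kind 𝒱)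
    (node : P → N) (lab : P → W) (bd : Δ → W)
    (h : ∀ w, Nat.card {x // Sum.elim lab bd x = w} = 0 ∨ Nat.card {x // Sum.elim lab bd x = w} = 2)
    (had : ∀ n, k n = .hadamard → ∃ p q, p ≠ q ∧ ∀ r, node r = n ↔ r = p ∨ r = q) (x y : P ⊕ Δ) :
    Sum.elim lab bd x = Sum.elim lab bd y ↔
      y = x ∨ y = (Diagram.ofLabels k node lab bd h had).link x := by
  rw [eq_comm]
  exact (exists_mate h x).choose_spec.2 y

theorem count_wires_add_fam [Finite Δ] [DecidableEq W] {N P : Type} [Finite N] [Finite P]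
    (k : N → Kind 𝒱) (node : P → N) (lab : P → W) (bd : Δ → W) (w : W) :
    (wires (fam fun n => (k n, fib node lab n)) + fam bd).count w =
      Nat.card {x // Sum.elim lab bd x = w} := by
  rw [← count_fam, fam_sum, wires_fam, fam_fib]
  rfl

/-- A name that occurs is carried by a half-edge `x` and by its partner `D.link x`, and by nothing
else. -/
theorem Diagram.Described.proper [Finite Δ] {D : Diagram 𝒱 Δ} {T : Multiset (Kind 𝒱 × Multiset W)}
    {bd : Δ → W} (h : D.Described T bd) : Proper T bd := by
  obtain ⟨lab, hl, rfl⟩ := h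
  refine ⟨fun w => ?_, fun x hx hk => ?_⟩
  · classical
    rw [count_wires_add_fam]
    by_cases hw : ∃ x, Sum.elim lab bd x = w
    · obtain ⟨x, rfl⟩ := hw
      refine .inr ((card_eq_two_iff_ports _ _).2 ⟨x, D.link x, (D.link_ne x).symm, fun r => ?_⟩)
      rw [← hl, eq_comm]
    · have : IsEmpty {x // Sum.elim lab bd x = w} := ⟨fun x => hw ⟨x.1, x.2⟩⟩
      exact .inl Nat.card_of_isEmpty
  · obtain ⟨n, rfl⟩ := (mem_fam _ _).1 hx
    rw [card_fib, card_eq_two_iff_ports]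
    exact D.hadamard_degree n hk

/-- The diagram with vertices `N` that a term describes. -/
noncomputable def Diagram.ofTerm {N : Type} [Finite N] [Finite Δ] (k : N → Kind 𝒱)
    (ws : N → Multiset W) (bd : Δ → W) (h : Proper (fam fun n => (k n, ws n)) bd) :
    Diagram 𝒱 Δ :=
  Diagram.ofLabels k (Sigma.fst : (Σ n, Fin (ws n).toList.length) → N)
    (fun p => occ (ws p.1) p.2) bd
    (fun w => by
      classical
      rw [← count_wires_add_fam k Sigma.fst]
      simpa only [fib_sigma_fst, fam_occ] using h.count_eq w)
    (fun n hn => by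
      rw [← card_eq_two_iff_ports, ← card_fib _ (fun p => occ (ws p.1) p.2), fib_sigma_fst,
        fam_occ]
      exact h.card_hadamard _ ((mem_fam _ _).2 ⟨n, rfl⟩) hn)

theorem Diagram.ofTerm_labelling {N : Type} [Finite N] [Finite Δ] (k : N → Kind 𝒱)
    (ws : N → Multiset W) (bd : Δ → W) (h : Proper (fam fun n => (k n, ws n)) bd)
    (x y : (Σ n, Fin (ws n).toList.length) ⊕ Δ) :
    Sum.elim (fun p => occ (ws p.1) p.2) bd x = Sum.elim (fun p => occ (ws p.1) p.2) bd y ↔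
      y = x ∨ y = (Diagram.ofTerm k ws bd h).link x :=
  Diagram.ofLabels_labelling k _ _ bd _ _ x y

theorem Diagram.ofTerm_described {N : Type} [Finite N] [Finite Δ] (k : N → Kind 𝒱)
    (ws : N → Multiset W) (bd : Δ → W) (h : Proper (fam fun n => (k n, ws n)) bd) :
    (Diagram.ofTerm k ws bd h).Described (fam fun n => (k n, ws n)) bd := by
  refine ⟨fun p : (Σ n, Fin (ws n).toList.length) => occ (ws p.1) p.2,
    Diagram.ofTerm_labelling k ws bd h, ?_⟩
  congr 1
  funext n
  exact Prod.ext rfl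
    ((fib_sigma_fst (fun p : (Σ n, Fin (ws n).toList.length) => occ (ws p.1) p.2) n).trans
      (fam_occ _))

theorem Proper.exists_described [Finite Δ] {T : Multiset (Kind 𝒱 × Multiset W)} {bd : Δ → W}
    (h : Proper T bd) : ∃ D : Diagram 𝒱 Δ, D.Described T bd := by
  have hT : (fam fun i => ((occ T i).1, (occ T i).2)) = T := fam_occ T
  rw [← hT] at h
  have := Diagram.ofTerm_described _ _ _ h
  rw [hT] at this
  exact ⟨_, this⟩

/-- Equality of the terms gives a bijection of vertices that respects types and wire names, then one
of half-edges at corresponding vertices. Links need no separate argument: partners are exactly the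
distinct half-edges with the same name. -/
theorem Diagram.Described.iso {D D' : Diagram 𝒱 Δ} {T : Multiset (Kind 𝒱 × Multiset W)}
    {bd : Δ → W} (h : D.Described T bd) (h' : D'.Described T bd) : Nonempty (D.Iso D') := by
  obtain ⟨lab, hl, rfl⟩ := h
  obtain ⟨lab', hl', hT⟩ := h'
  obtain ⟨e, he⟩ := exists_equiv_of_fam_eq hT.symm
  have hp : ∀ n, ∃ g : {p // D.node p = n} ≃ {p // D'.node p = e n}, ∀ p, lab' (g p) = lab p := by
    intro n
    have := (Prod.ext_iff.1 (he n)).2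
    simp only [fib_eq_fam] at this
    exact exists_equiv_of_fam_eq this.symm
  choose g hg using hp
  let pe : D.Port ≃ D'.Port := (Equiv.sigmaFiberEquiv D.node).symm.trans
    ((Equiv.sigmaCongr e g).trans (Equiv.sigmaFiberEquiv D'.node))
  have hlab : ∀ p, lab' (pe p) = lab p := fun p => hg _ ⟨p, rfl⟩
  have hl2 : ∀ x, Sum.elim lab' bd (Sum.map pe id x) = Sum.elim lab bd x := by
    rintro (x | x)
    · exact hlab x
    · rfl
  have hinj : Function.Injective (Sum.map pe (id : Δ → Δ)) :=
    Sum.map_injective.2 ⟨pe.injective, Function.injective_id⟩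
  refine ⟨⟨e, pe, fun n => (Prod.ext_iff.1 (he n)).1, fun p => (g _ ⟨p, rfl⟩).2, fun x => ?_⟩⟩
  have : Sum.elim lab' bd (Sum.map pe id x) = Sum.elim lab' bd (Sum.map pe id (D.link x)) := by
    rw [hl2, hl2]
    exact (hl _ _).2 (.inr rfl)
  rcases (hl' _ _).1 this with h | h
  · exact absurd (hinj h) (D.link_ne x)
  · exact h.symm

theorem Diagram.Described.of_iso {D D' : Diagram 𝒱 Δ} {T : Multiset (Kind 𝒱 × Multiset W)}
    {bd : Δ → W} (h : D.Described T bd) (e : D.Iso D') : D'.Described T bd := by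
  obtain ⟨lab, hl, rfl⟩ := h
  have hs : ∀ x, Sum.elim (fun p => lab (e.portEquiv.symm p)) bd (Sum.map e.portEquiv id x) =
      Sum.elim lab bd x := by
    rintro (x | x) <;> simp
  have hsur : Function.Surjective (Sum.map e.portEquiv (id : Δ → Δ)) :=
    Sum.map_surjective.2 ⟨e.portEquiv.surjective, Function.surjective_id⟩
  have hinj : Function.Injective (Sum.map e.portEquiv (id : Δ → Δ)) :=
    Sum.map_injective.2 ⟨e.portEquiv.injective, Function.injective_id⟩
  refine ⟨fun p => lab (e.portEquiv.symm p), fun x y => ?_, ?_⟩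
  · obtain ⟨x, rfl⟩ := hsur x
    obtain ⟨y, rfl⟩ := hsur y
    rw [hs, hs, hl, e.link_eq, hinj.eq_iff, hinj.eq_iff]
  · rw [← fam_equiv e.nodeEquiv]
    congr 1
    funext n
    have hn : ∀ p, D.node p = n ↔ D'.node (e.portEquiv p) = e.nodeEquiv n := fun p => by
      rw [e.node_eq, e.nodeEquiv.injective.eq_iff]
    rw [e.kind_eq, fib_eq_fam, fib_eq_fam, ← fam_equiv (e.portEquiv.subtypeEquiv hn)]
    simp

theorem Diagram.Described.rename {D : Diagram 𝒱 Δ} {T : Multiset (Kind 𝒱 × Multiset W)}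
    {bd : Δ → W} (h : D.Described T bd) {g : W → W'} (hg : Function.Injective g) :
    D.Described (rename g T) fun b => g (bd b) := by
  obtain ⟨lab, hl, rfl⟩ := h
  refine ⟨fun p => g (lab p), fun x y => ?_, ?_⟩
  · have : ∀ x, Sum.elim (fun p => g (lab p)) (fun b => g (bd b)) x = g (Sum.elim lab bd x) := by
      rintro (x | x) <;> rfl
    rw [this, this, hg.eq_iff, hl]
  · simp [ZX.rename, map_fam, map_fib]

/-- Every diagram is described by some term. -/
theorem Diagram.exists_described (D : Diagram 𝒱 Δ) :
    ∃ (T : Multiset (Kind 𝒱 × Multiset (Sym2 (D.Port ⊕ Δ)))) (bd : Δ → Sym2 (D.Port ⊕ Δ)),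
      D.Described T bd := by
  -- A wire is named by the unordered pair of its two half-edges.
  refine ⟨_, fun b => s(.inr b, D.link (.inr b)), fun p => s(.inl p, D.link (.inl p)),
    fun x y => ?_, rfl⟩
  have : ∀ x, Sum.elim (fun p => s(.inl p, D.link (.inl p)))
      (fun b => s(.inr b, D.link (.inr b))) x = s(x, D.link x) := by
    rintro (x | x) <;> rfl
  rw [this, this, Sym2.eq_iff]
  constructor
  · rintro (⟨h, -⟩ | ⟨-, h⟩)
    · exact .inl h.symm
    · exact .inr h.symm
  · rintro (rfl | rfl)
    · exact .inl ⟨rfl, rfl⟩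
    · exact .inr ⟨(D.link_link x).symm, rfl⟩

end Terms

end ZX

/-! ### Replacement of subterms -/

namespace ZX

section Replacement

variable {𝒱 Δ W K : Type}

/-- Two terms, with their boundary wires, describe diagrams that rewrite to each other. -/
structure Equates [Finite Δ] (T : Multiset (Kind 𝒱 × Multiset W)) (bd : Δ → W)
    (T' : Multiset (Kind 𝒱 × Multiset W)) (bd' : Δ → W) : Prop where
  left : Proper T bd
  right : Proper T' bd'
  rewrites : ∀ D D' : Diagram 𝒱 Δ, D.Described T bd → D'.Described T' bd' → Rewrites D D'

theorem Rewrites.refl (D : Diagram 𝒱 Δ) : Rewrites D D :=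
  Relation.EqvGen.refl D

theorem Rewrites.symm {D D' : Diagram 𝒱 Δ} (h : Rewrites D D') : Rewrites D' D :=
  Relation.EqvGen.symm _ _ h

theorem Rewrites.trans {D D' D'' : Diagram 𝒱 Δ} (h : Rewrites D D') (h' : Rewrites D' D'') :
    Rewrites D D'' :=
  Relation.EqvGen.trans _ _ _ h h'

theorem Diagram.Described.rewrites {D D' : Diagram 𝒱 Δ} {T : Multiset (Kind 𝒱 × Multiset W)}
    {bd : Δ → W} (h : D.Described T bd) (h' : D'.Described T bd) : Rewrites D D' :=
  (h.iso h').elim fun e => .rel _ _ (.iso e)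

/-- One pair of diagrams suffices, because all diagrams with a given description are isomorphic. -/
theorem Equates.of_rewrites [Finite Δ] {D D' : Diagram 𝒱 Δ}
    {T T' : Multiset (Kind 𝒱 × Multiset W)} {bd bd' : Δ → W} (h : D.Described T bd)
    (h' : D'.Described T' bd') (hD : Rewrites D D') : Equates T bd T' bd' :=
  ⟨h.proper, h'.proper, fun _ _ hE hE' =>
    ((hE.rewrites h).trans hD).trans (h'.rewrites hE')⟩

theorem Equates.refl [Finite Δ] {T : Multiset (Kind 𝒱 × Multiset W)} {bd : Δ → W}
    (h : Proper T bd) : Equates T bd T bd :=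
  ⟨h, h, fun _ _ hE hE' => hE.rewrites hE'⟩

theorem Equates.symm [Finite Δ] {T T' : Multiset (Kind 𝒱 × Multiset W)} {bd bd' : Δ → W}
    (h : Equates T bd T' bd') : Equates T' bd' T bd :=
  ⟨h.right, h.left, fun _ _ hE hE' => (h.rewrites _ _ hE' hE).symm⟩

/-- Properness of the middle term is what provides a diagram to pass through. -/
theorem Equates.trans [Finite Δ] {T T' T'' : Multiset (Kind 𝒱 × Multiset W)} {bd bd' bd'' : Δ → W}
    (h : Equates T bd T' bd') (h' : Equates T' bd' T'' bd'') : Equates T bd T'' bd'' := by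
  obtain ⟨D, hD⟩ := h.right.exists_described
  exact ⟨h.left, h'.right, fun _ _ hE hE' =>
    (h.rewrites _ _ hE hD).trans (h'.rewrites _ _ hD hE')⟩

theorem mem_wires {T : Multiset (Kind 𝒱 × Multiset W)} {w : W} :
    w ∈ wires T ↔ ∃ x ∈ T, w ∈ x.2 := by
  induction T using Multiset.induction_on with
  | empty => simp
  | cons x T ih => simp [ih]

/-- The term of a fragment with external wires `lg` and internal wires `eg`. -/
noncomputable def Fragment.term [Finite K] (L : Fragment 𝒱 K) (lg : K → W) (eg : L.Edge → W) :
    Multiset (Kind 𝒱 × Multiset W) :=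
  fam fun n => (L.kind n, fib (Sum.elim L.leg fun e : L.Edge × Bool => L.ends e.1 e.2)
    (Sum.elim lg fun e : L.Edge × Bool => eg e.1) n)

theorem Fragment.wires_term [Finite K] (L : Fragment 𝒱 K) (lg : K → W) (eg : L.Edge → W) :
    wires (L.term lg eg) = fam lg + (fam eg + fam eg) := by
  simp only [Fragment.term, wires_fam]
  rw [fam_fib, fam_sum]
  simp

theorem Fragment.card_hadamard [Finite K] (L : Fragment 𝒱 K) (lg : K → W) (eg : L.Edge → W) :
    ∀ x ∈ L.term lg eg, x.1 = .hadamard → Multiset.card x.2 = 2 := by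
  intro x hx hk
  obtain ⟨n, rfl⟩ := (mem_fam _ _).1 hx
  rw [card_fib, card_eq_two_iff_ports]
  exact L.hadamard_degree n hk

theorem fib_map_inl {P N N' : Type} [Finite P] (node : P → N) (lab : P → W) (n : N) :
    fib (fun p => (Sum.inl (node p) : N ⊕ N')) lab (Sum.inl n) = fib node lab n := by
  rw [fib_eq_fam, fib_eq_fam]
  exact fam_equiv (Equiv.subtypeEquivRight fun p => Sum.inl_injective.eq_iff)
    (fun p : {p // node p = n} => lab p)

theorem fib_map_inr {P N N' : Type} [Finite P] (node : P → N') (lab : P → W) (n : N') :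
    fib (fun p => (Sum.inr (node p) : N ⊕ N')) lab (Sum.inr n) = fib node lab n := by
  rw [fib_eq_fam, fib_eq_fam]
  exact fam_equiv (Equiv.subtypeEquivRight fun p => Sum.inr_injective.eq_iff)
    (fun p : {p // node p = n} => lab p)

/-- The external wires of `L` take over the boundary names `lg` of the context; only the internal
wires need new names, which must be distinct and fresh. -/
theorem Diagram.Described.plug [Finite K] {C : Diagram 𝒱 (Δ ⊕ K)}
    {T : Multiset (Kind 𝒱 × Multiset W)} {bd : Δ → W} {lg : K → W}
    (h : C.Described T (Sum.elim bd lg)) (L : Fragment 𝒱 K) {eg : L.Edge → W}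
    (he : Function.Injective eg) (hT : ∀ e, eg e ∉ wires T) (hb : ∀ e b, bd b ≠ eg e)
    (hl : ∀ e k, lg k ≠ eg e) :
    (C.plug L).Described (T + L.term lg eg) bd := by
  obtain ⟨lab, hlab, rfl⟩ := h
  have hT' : ∀ e p, lab p ≠ eg e := by
    intro e p hp
    refine hT e (mem_wires.2 ⟨_, (mem_fam _ _).2 ⟨C.node p, rfl⟩, ?_⟩)
    rw [fib_eq_fam]
    exact (mem_fam _ _).2 ⟨⟨p, rfl⟩, hp⟩
  have hne : ∀ e x, Sum.elim lab (Sum.elim bd lg) x ≠ eg e := by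
    rintro e (x | x | x)
    · exact hT' e x
    · exact hb e x
    · exact hl e x
  refine ⟨Sum.elim lab (Sum.elim lg fun e => eg e.1), fun x y => ?_, ?_⟩
  -- Seen through `plugEquiv`, a half-edge is matched either by the context or inside the fragment,
  -- and freshness of `eg` prevents names from being shared between the two kinds.
  · have key : ∀ u v : (C.Port ⊕ (Δ ⊕ K)) ⊕ (L.Edge × Bool),
        Sum.elim (Sum.elim lab (Sum.elim bd lg)) (fun e => eg e.1) u =
          Sum.elim (Sum.elim lab (Sum.elim bd lg)) (fun e => eg e.1) v ↔
        v = u ∨ v = Sum.map C.link (fun e : L.Edge × Bool => (e.1, !e.2)) u := by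
      rintro (u | u) (v | v)
      · simpa using hlab u v
      · simpa using hne v.1 u
      · simpa using (hne u.1 v).symm
      · obtain ⟨u, a⟩ := u
        obtain ⟨v, b⟩ := v
        simp only [Sum.elim_inr, he.eq_iff, Sum.map_inr, Sum.inr.injEq, Prod.mk.injEq]
        cases a <;> cases b <;> simp [eq_comm]
    have hx : ∀ x : (C.Port ⊕ (K ⊕ L.Edge × Bool)) ⊕ Δ,
        Sum.elim (Sum.elim lab (Sum.elim lg fun e => eg e.1)) bd x =
          Sum.elim (Sum.elim lab (Sum.elim bd lg)) (fun e => eg e.1) (plugEquiv _ _ _ _ x) := by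
      rintro ((x | x | x) | x) <;> rfl
    exact ((Eq.congr (hx x) (hx y)).trans (key _ _)).trans
      (Iff.or (plugEquiv _ _ _ _).injective.eq_iff (Equiv.eq_symm_apply _).symm)
  · refine (fam_sum (ι := C.Node) (κ := L.Node) _).trans (congrArg₂ _ ?_ ?_)
    · congr 1
      funext n
      refine Prod.ext rfl ((fib_sum (P := C.Port) (Q := K ⊕ L.Edge × Bool) _ _ _).trans
        ((congrArg₂ _ (fib_map_inl C.node lab n) (fib_of_forall_ne ?_ _)).trans (add_zero _)))
      exact fun _ => Sum.inr_ne_inl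
    · rw [Fragment.term]
      congr 1
      funext n
      refine Prod.ext rfl ((fib_sum (P := C.Port) (Q := K ⊕ L.Edge × Bool) _ _ _).trans
        ((congrArg₂ _ (fib_of_forall_ne ?_ _) (fib_map_inr _ _ n)).trans (zero_add _)))
      exact fun _ => Sum.inl_ne_inr

/-- An internal wire already occurs twice inside the fragment, so its name can occur nowhere else.
Thus the freshness conditions needed for plugging follow from properness of the whole term. -/
theorem Proper.of_term [Finite Δ] [Finite K] {C : Multiset (Kind 𝒱 × Multiset W)} {bd : Δ → W}
    {L : Fragment 𝒱 K} {lg : K → W} {eg : L.Edge → W} (h : Proper (C + L.term lg eg) bd) :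
    Proper C (Sum.elim bd lg) ∧ Function.Injective eg ∧ (∀ e, eg e ∉ wires C) ∧
      (∀ e b, bd b ≠ eg e) ∧ ∀ e k, lg k ≠ eg e := by
  classical
  have hc : ∀ w, (wires C + fam (Sum.elim bd lg)).count w + 2 * (fam eg).count w = 0 ∨
      (wires C + fam (Sum.elim bd lg)).count w + 2 * (fam eg).count w = 2 := by
    intro w
    have := h.count_eq w
    rw [wires_add, Fragment.wires_term] at this
    simp only [fam_sum, Sum.elim_inl, Sum.elim_inr, Multiset.count_add] at this ⊢
    change _ + (Multiset.count w (fam bd) + Multiset.count w (fam lg)) + _ = 0 ∨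
      _ + (Multiset.count w (fam bd) + Multiset.count w (fam lg)) + _ = 2
    omega
  have h1 : ∀ e, 0 < (fam eg).count (eg e) := fun e =>
    Multiset.count_pos.2 ((mem_fam _ _).2 ⟨e, rfl⟩)
  have h0 : ∀ e, (wires C + fam (Sum.elim bd lg)).count (eg e) = 0 := fun e => by
    have := hc (eg e)
    have := h1 e
    omega
  refine ⟨⟨fun w => ?_, fun x hx => h.card_hadamard x (Multiset.mem_add.2 (.inl hx))⟩, ?_, ?_, ?_,
    ?_⟩
  · have := hc w
    omega
  · intro e e' hee
    have h2 : (fam eg).count (eg e) ≤ 1 := by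
      have := hc (eg e)
      omega
    rw [count_fam, Finite.card_le_one_iff_subsingleton] at h2
    have := h2.elim ⟨e, rfl⟩ ⟨e', hee.symm⟩
    simpa using this
  · intro e he
    have := h0 e
    rw [Multiset.count_eq_zero] at this
    exact this (Multiset.mem_add.2 (.inl he))
  · intro e b hb
    have := h0 e
    rw [Multiset.count_eq_zero] at this
    exact this (Multiset.mem_add.2 (.inr ((mem_fam _ _).2 ⟨.inl b, hb⟩)))
  · intro e b hb
    have := h0 e
    rw [Multiset.count_eq_zero] at this
    exact this (Multiset.mem_add.2 (.inr ((mem_fam _ _).2 ⟨.inr b, hb⟩)))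

theorem Rule.equates [Finite Δ] [Finite K] {L R : Fragment 𝒱 K} (h : Rule L R)
    {C : Multiset (Kind 𝒱 × Multiset W)} {bd : Δ → W} {lg : K → W} {eL : L.Edge → W}
    {eR : R.Edge → W} (hL : Proper (C + L.term lg eL) bd) (hR : Proper (C + R.term lg eR) bd) :
    Equates (C + L.term lg eL) bd (C + R.term lg eR) bd := by
  obtain ⟨hC, h1, h2, h3, h4⟩ := hL.of_term
  obtain ⟨-, h1', h2', h3', h4'⟩ := hR.of_term
  obtain ⟨D, hD⟩ := hC.exists_described
  exact .of_rewrites (hD.plug L h1 h2 h3 h4) (hD.plug R h1' h2' h3' h4') (.rel _ _ (.rule h D))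

/-- `F` lists the internal wires that disappear and `G` those that appear. Outside `G` the number of
occurrences drops by twice the multiplicity in `F`; a name in `G` did not occur before. -/
theorem Proper.replace [Finite Δ] {C L R : Multiset (Kind 𝒱 × Multiset W)} {bd : Δ → W}
    (h : Proper (C + L) bd) (F G : Multiset W) (hw : wires R + (F + F) = wires L + (G + G))
    (hG : G.Nodup) (hGL : ∀ w ∈ G, w ∉ wires (C + L)) (hGb : ∀ w ∈ G, ∀ b, bd b ≠ w)
    (hR : ∀ x ∈ R, x.1 = .hadamard → Multiset.card x.2 = 2) : Proper (C + R) bd := by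
  classical
  refine ⟨fun w => ?_, fun x hx => ?_⟩
  · have h1 := congrArg (Multiset.count w) hw
    have h2 := h.count_eq w
    simp only [wires_add, Multiset.count_add] at h1 h2 ⊢
    by_cases hwG : w ∈ G
    · have h3 : (wires (C + L)).count w = 0 := Multiset.count_eq_zero.2 (hGL w hwG)
      have h4 : (fam bd).count w = 0 := Multiset.count_eq_zero.2 fun h => by
        obtain ⟨b, hb⟩ := (mem_fam _ _).1 h
        exact hGb w hwG b hb
      have h5 := Multiset.count_eq_one_of_mem hG hwG
      simp only [wires_add, Multiset.count_add] at h3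
      omega
    · have h5 := Multiset.count_eq_zero.2 hwG
      omega
  · rcases Multiset.mem_add.1 hx with hx | hx
    · exact h.card_hadamard x (Multiset.mem_add.2 (.inl hx))
    · exact hR x hx

/-- In every context the term `L` may be replaced by `R`. -/
def Reduces (L R : Multiset (Kind 𝒱 × Multiset W)) : Prop :=
  ∀ (Δ : Type) [Finite Δ] (C : Multiset (Kind 𝒱 × Multiset W)) (bd : Δ → W),
    Proper (C + L) bd → Equates (C + L) bd (C + R) bd

theorem Reduces.refl (L : Multiset (Kind 𝒱 × Multiset W)) : Reduces L L :=
  fun _ _ _ _ h => Equates.refl h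

theorem Reduces.of_eq {L R : Multiset (Kind 𝒱 × Multiset W)} (h : L = R) : Reduces L R :=
  h ▸ .refl L

theorem Reduces.trans {L M R : Multiset (Kind 𝒱 × Multiset W)} (h : Reduces L M)
    (h' : Reduces M R) : Reduces L R :=
  fun Δ _ C bd hC => (h Δ C bd hC).trans (h' Δ C bd (h Δ C bd hC).right)

theorem Reduces.add_left {L R : Multiset (Kind 𝒱 × Multiset W)} (h : Reduces L R)
    (S : Multiset (Kind 𝒱 × Multiset W)) : Reduces (S + L) (S + R) := by
  intro Δ _ C bd hC
  rw [← add_assoc] at hC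
  rw [← add_assoc, ← add_assoc]
  exact h Δ _ bd hC

theorem Reduces.add_right {L R : Multiset (Kind 𝒱 × Multiset W)} (h : Reduces L R)
    (S : Multiset (Kind 𝒱 × Multiset W)) : Reduces (L + S) (R + S) := by
  rw [add_comm L, add_comm R]
  exact h.add_left S

theorem Reduces.add {L R L' R' : Multiset (Kind 𝒱 × Multiset W)} (h : Reduces L R)
    (h' : Reduces L' R') : Reduces (L + L') (R + R') :=
  (h.add_right L').trans (h'.add_left R)

theorem Reduces.sum {ι : Type} {s : Finset ι} {L R : ι → Multiset (Kind 𝒱 × Multiset W)}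
    (h : ∀ i ∈ s, Reduces (L i) (R i)) : Reduces (∑ i ∈ s, L i) (∑ i ∈ s, R i) := by
  classical
  induction s using Finset.induction_on with
  | empty => exact .refl _
  | insert i s hi ih =>
    rw [Finset.sum_insert hi, Finset.sum_insert hi]
    exact (h i (by simp)).add (ih fun j hj => h j (by simp [hj]))

theorem Reduces.equates [Finite Δ] {L R : Multiset (Kind 𝒱 × Multiset W)} (h : Reduces L R)
    {bd : Δ → W} (hL : Proper L bd) : Equates L bd R bd := by
  simpa using h Δ 0 bd (by simpa using hL)

/-- The internal wires of `R` are among those of `L`, so the replacement needs no fresh names and is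
valid in every context. The rules are therefore always read in the direction in which wires
disappear. -/
theorem Rule.reduces [Finite K] {L R : Fragment 𝒱 K} (h : Rule L R) {lg : K → W} {eL : L.Edge → W}
    {eR : R.Edge → W} (F : Multiset W) (hF : fam eL = fam eR + F) :
    Reduces (L.term lg eL) (R.term lg eR) := by
  intro Δ _ C bd hC
  refine h.equates hC (hC.replace F 0 ?_ (by simp) (by simp) (by simp) (R.card_hadamard _ _))
  rw [Fragment.wires_term, Fragment.wires_term, hF]
  simp only [add_zero]
  abel

/-- The same for a rule whose right-hand side has more internal wires, read backwards. -/
theorem Rule.reduces_symm [Finite K] {L R : Fragment 𝒱 K} (h : Rule R L) {lg : K → W}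
    {eL : L.Edge → W} {eR : R.Edge → W} (F : Multiset W) (hF : fam eL = fam eR + F) :
    Reduces (L.term lg eL) (R.term lg eR) := by
  intro Δ _ C bd hC
  refine (h.equates (hC.replace F 0 ?_ (by simp) (by simp) (by simp) (R.card_hadamard _ _)) hC).symm
  rw [Fragment.wires_term, Fragment.wires_term, hF]
  simp only [add_zero]
  abel

end Replacement

end ZX

/-! ### Cutting wires, and rewriting under operations at the boundary -/

namespace ZX

section Cutting

variable {𝒱 Δ Δ' W N : Type}

/-- Of the two halves of the cut wire, the one at `x` gets the new name `w`, while the other one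
keeps the old name. -/
theorem cutLink_labelling {H : Type} {link : H → H} {l : H → W}
    (hl : ∀ x y, l x = l y ↔ y = x ∨ y = link x) (hne : ∀ x, link x ≠ x) {w : W}
    (hw : ∀ y, l y ≠ w) (x : H) {l' : H → W} (hx : l' x = w) (hl' : ∀ y, y ≠ x → l' y = l y)
    (u v : H ⊕ Bool) :
    Sum.elim l' (fun b => cond b (l x) w) u = Sum.elim l' (fun b => cond b (l x) w) v ↔
      v = u ∨ v = Diagram.cutLink link x u := by
  have h0 : ∀ y, y ≠ x → l' y ≠ w := fun y hy => hl' y hy ▸ hw y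
  have h1 : ∀ y, link y = x ↔ y = link x := by
    intro y
    have a : link (link y) = y := by
      rcases (hl (link y) y).1 (((hl y (link y)).2 (.inr rfl)).symm) with h | h
      · exact absurd h.symm (hne y)
      · exact h.symm
    have b : link (link x) = x := by
      rcases (hl (link x) x).1 (((hl x (link x)).2 (.inr rfl)).symm) with h | h
      · exact absurd h.symm (hne x)
      · exact h.symm
    constructor
    · rintro rfl
      exact a.symm
    · rintro rfl
      exact b
  rcases u with u | _ | _ <;> rcases v with v | _ | _
  · by_cases hu : u = x
    · subst hu
      by_cases hv : v = u
      · simp [hv]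
      · simp [Diagram.cutLink, hx, hv, (h0 v hv).symm]
    · by_cases hv : v = x
      · subst hv
        by_cases huv : u = link v
        · simp [Diagram.cutLink, huv, hne, hx, h0, (hne v).symm]
        · simp [Diagram.cutLink, hu, huv, hx, h0, Ne.symm hu, eq_comm (a := v), h1]
      · by_cases hux : u = link x
        · subst hux
          have := hl (link x) v
          rw [(h1 _).2 rfl] at this
          simp [Diagram.cutLink, hu, hv, hl', this]
        · simp [Diagram.cutLink, hu, hux, hl', hv, hl]
  · by_cases hu : u = x
    · simp [Diagram.cutLink, hu, hx]
    · by_cases hux : u = link x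
      · simp [Diagram.cutLink, hux, hne, h0]
      · simp [Diagram.cutLink, hu, hux, h0]
  · by_cases hu : u = x
    · simp [Diagram.cutLink, hu, hx, (hw x).symm]
    · by_cases hux : u = link x
      · simp [Diagram.cutLink, hux, hne, hl', (hl x (link x)).2]
      · simp [Diagram.cutLink, hu, hux, hl', hl, Ne.symm hu, eq_comm (a := x), h1]
  · by_cases hv : v = x
    · simp [Diagram.cutLink, hv, hx]
    · simp [Diagram.cutLink, hv, (h0 v hv).symm]
  · simp
  · simp [Diagram.cutLink, (hw x).symm]
  · by_cases hv : v = x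
    · simp [Diagram.cutLink, hv, hx, hw, (hne x).symm]
    · simp [Diagram.cutLink, hv, hl', hl]
  · simp [Diagram.cutLink, hw]
  · simp

theorem Diagram.cut_described (D : Diagram 𝒱 Δ) (x : D.Port ⊕ Δ) {lab lab' : D.Port → W}
    {bd bd' : Δ → W}
    (hl : ∀ x y, Sum.elim lab bd x = Sum.elim lab bd y ↔ y = x ∨ y = D.link x) {w : W}
    (hw : ∀ y, Sum.elim lab bd y ≠ w) (hx : Sum.elim lab' bd' x = w)
    (hl' : ∀ y, y ≠ x → Sum.elim lab' bd' y = Sum.elim lab bd y) :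
    (D.cut x).Described (fam fun n => (D.kind n, fib D.node lab' n))
      (Sum.elim bd' fun b => cond b (Sum.elim lab bd x) w) := by
  refine ⟨lab', fun u v => ?_, rfl⟩
  have := cutLink_labelling hl D.link_ne hw x hx hl' ((Equiv.sumAssoc _ _ _).symm u)
    ((Equiv.sumAssoc _ _ _).symm v)
  have he : ∀ u : D.Port ⊕ (Δ ⊕ Bool),
      Sum.elim (Sum.elim lab' bd') (fun b => cond b (Sum.elim lab bd x) w)
        ((Equiv.sumAssoc _ _ _).symm u) =
      Sum.elim lab' (Sum.elim bd' fun b => cond b (Sum.elim lab bd x) w) u := by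
    rintro (u | u | u) <;> rfl
  refine (Eq.congr (he u).symm (he v).symm).trans
    (this.trans (Iff.or (Equiv.sumAssoc _ _ _).symm.injective.eq_iff
      (Equiv.symm_apply_eq _)))

open Classical in
/-- Replacing the wire `w'` by `w`. -/
noncomputable def replaceWire (w' w v : W) : W := if v = w' then w else v

@[simp] theorem replaceWire_self (w' w : W) : replaceWire w' w w' = w := by simp [replaceWire]

theorem replaceWire_of_ne {w' w v : W} (h : v ≠ w') : replaceWire w' w v = v := by
  simp [replaceWire, h]

theorem count_map_replaceWire [DecidableEq W] {w w' : W} (h : w ≠ w') (S : Multiset W) (v : W) :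
    (S.map (replaceWire w' w)).count v =
      if v = w then S.count w + S.count w' else if v = w' then 0 else S.count v := by
  induction S using Multiset.induction_on with
  | empty => simp
  | cons a S ih =>
    simp only [Multiset.map_cons, Multiset.count_cons, ih]
    by_cases ha : a = w'
    · subst ha
      by_cases h1 : v = w
      · simp [h1, h]
        omega
      · by_cases h2 : v = a
        · simp [h2, h.symm]
        · simp [h1, h2]
    · rw [replaceWire_of_ne ha]
      by_cases h1 : v = w
      · simp [h1, Ne.symm ha]
        omega
      · by_cases h2 : v = w'
        · simp [h2, h.symm, Ne.symm ha]
        · simp [h1, h2]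

/-- The identity and `H`-cancel rules end in a bare wire, so removing the fragment `F` merges its
two external wires, which means renaming `w'` to `w`. The merged diagram is built from the renamed
labels; cutting it at the half-edge that carried `w'` gives back the context of `F`. -/
theorem Equates.of_cut [Finite Δ] (F : Fragment 𝒱 Bool)
    (hF : ∀ (D : Diagram 𝒱 Δ) x, Step ((D.cut x).plug F) D)
    {T : Multiset (Kind 𝒱 × Multiset W)} {bd : Δ → W} {w w' : W} {eg : F.Edge → W} (hne : w ≠ w')
    (h : Proper (T + F.term (fun b => cond b w w') eg) bd) :
    Equates (T + F.term (fun b => cond b w w') eg) bd (rename (replaceWire w' w) T)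
      (fun b => replaceWire w' w (bd b)) := by
  classical
  obtain ⟨hC, h1, h2, h3, h4⟩ := h.of_term
  obtain ⟨D₁, hD₁⟩ := hC.exists_described
  have hD₁' := hD₁
  obtain ⟨lab, hl, rfl⟩ := hD₁
  have hext : ∀ y : D₁.Port ⊕ Δ, Sum.elim (fun p => replaceWire w' w (lab p))
      (fun b => replaceWire w' w (bd b)) y = replaceWire w' w (Sum.elim lab bd y) := by
    rintro (y | y) <;> rfl
  have hcount : ∀ v, Nat.card {x // Sum.elim (fun p => replaceWire w' w (lab p))
      (fun b => replaceWire w' w (bd b)) x = v} = 0 ∨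
      Nat.card {x // Sum.elim (fun p => replaceWire w' w (lab p))
      (fun b => replaceWire w' w (bd b)) x = v} = 2 := by
    intro v
    have e : fam (Sum.elim (fun p => replaceWire w' w (lab p)) (fun b => replaceWire w' w (bd b))) =
        (fam (Sum.elim lab bd)).map (replaceWire w' w) := by
      rw [map_fam]
      exact congrArg fam (funext hext)
    rw [← count_fam, e, count_map_replaceWire hne]
    have hc := fun u => hC.count_eq u
    have hc' : ∀ u, (fam (Sum.elim lab bd)).count u + ((if u = w then 1 else 0) +
        if u = w' then 1 else 0) = 0 ∨ (fam (Sum.elim lab bd)).count u +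
        ((if u = w then 1 else 0) + if u = w' then 1 else 0) = 2 := by
      intro u
      have := hc u
      rw [wires_fam, fam_fib, fam_sum, ← add_assoc] at this
      rw [fam_sum]
      simp only [Multiset.count_add, Multiset.count_singleton, Sum.elim_inl, Sum.elim_inr, fam_bool,
        cond_true, cond_false] at this ⊢
      change (fam lab).count u + (fam bd).count u + _ = 0 ∨
        (fam lab).count u + (fam bd).count u + _ = 2 at this
      change (fam lab).count u + (fam bd).count u + _ = 0 ∨
        (fam lab).count u + (fam bd).count u + _ = 2
      omega
    -- Outside the fragment `w` and `w'` have one end each, so the merged wire has two.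
    have ha := hc' w
    have hb := hc' w'
    have hv := hc' v
    rw [if_pos rfl, if_neg hne] at ha
    rw [if_pos rfl, if_neg hne.symm] at hb
    split_ifs with h5 h6
    · omega
    · exact .inl rfl
    · rw [if_neg h5, if_neg h6] at hv
      omega
  let D : Diagram 𝒱 Δ := .ofLabels D₁.kind D₁.node _ _ hcount D₁.hadamard_degree
  have hDl := Diagram.ofLabels_labelling D₁.kind D₁.node _ _ hcount D₁.hadamard_degree
  -- The far ends of the two wires at the fragment. These wires are not joined to each other, since
  -- `w ≠ w'`.
  have hin : ∀ (c : Bool), ∃ y : D₁.Port ⊕ Δ, Sum.elim lab bd y = cond c w w' := by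
    intro c
    have hy : Sum.elim lab (Sum.elim bd fun b => cond b w w') (.inr (.inr c)) =
        Sum.elim lab (Sum.elim bd fun b => cond b w w') (D₁.link (.inr (.inr c))) :=
      (hl _ _).2 (.inr rfl)
    rcases hz : D₁.link (.inr (.inr c)) with y | y | y
    · exact ⟨.inl y, by rw [hz] at hy; exact hy.symm⟩
    · exact ⟨.inr y, by rw [hz] at hy; exact hy.symm⟩
    · rw [hz] at hy
      exfalso
      have : y ≠ c := by
        rintro rfl
        exact D₁.link_ne _ hz
      revert hy this
      cases y <;> cases c <;> simp [hne, hne.symm]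
  obtain ⟨x, hx⟩ := hin false
  obtain ⟨z, hz⟩ := hin true
  -- Any half-edge named `w'` is the partner of the same boundary vertex, hence unique.
  have hx1 : ∀ y, Sum.elim lab bd y = w' → y = x := by
    intro y hy
    have e : ∀ y : D₁.Port ⊕ Δ, Sum.elim lab (Sum.elim bd fun b => cond b w w')
        (Sum.map id Sum.inl y) = Sum.elim lab bd y := by
      rintro (y | y) <;> rfl
    have hs : Function.Injective (Sum.map (id : D₁.Port → D₁.Port) (Sum.inl : Δ → Δ ⊕ Bool)) :=
      Sum.map_injective.2 ⟨Function.injective_id, Sum.inl_injective⟩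
    have hf : ∀ y : D₁.Port ⊕ Δ, Sum.elim lab bd y = w' →
        Sum.map id Sum.inl y = D₁.link (.inr (.inr false)) := by
      intro y hy
      have : Sum.elim lab (Sum.elim bd fun b => cond b w w') (.inr (.inr false)) =
          Sum.elim lab (Sum.elim bd fun b => cond b w w') (Sum.map id Sum.inl y) := by
        rw [e, hy]
        rfl
      rcases (hl _ _).1 this with h | h
      · rcases y with y | y <;> simp at h
      · exact h
    exact hs ((hf y hy).trans (hf x hx).symm)
  have hcut : (D.cut x).Described (fam fun n => (D₁.kind n, fib D₁.node lab n))
      (Sum.elim bd fun b => cond b w w') := by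
    have := Diagram.cut_described D x (lab' := lab) (bd' := bd) hDl (w := w')
      (fun y h => by
        replace h := (hext y).symm.trans h
        by_cases hy : Sum.elim lab bd y = w'
        · rw [hy, replaceWire_self] at h
          exact hne h
        · rw [replaceWire_of_ne hy] at h
          exact hy h) hx
      (fun y hy => ((hext y).trans (replaceWire_of_ne fun h => hy (hx1 y h))).symm)
    have hxw : Sum.elim (fun p => replaceWire w' w (lab p)) (fun b => replaceWire w' w (bd b)) x =
        w := by
      rw [hext, hx, cond_false, replaceWire_self]
    exact (congrArg (fun v => (D.cut x).Described (fam fun n => (D₁.kind n, fib D₁.node lab n))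
      (Sum.elim bd fun b => cond b v w')) hxw).mp this
  refine .of_rewrites (hcut.plug F h1 h2 h3 h4) (D' := D) ⟨_, hDl, ?_⟩ (.rel _ _ (hF D x))
  simp only [rename, map_fam, map_fib]
  rfl

/-- The operation `G` on diagrams adds the vertices of the term `g` at the boundary; the wires of
`g` are old boundary wires and new wires `N`, and `b` describes the new boundary. -/
def Extends (G : Diagram 𝒱 Δ → Diagram 𝒱 Δ') (g : Multiset (Kind 𝒱 × Multiset (Δ ⊕ N)))
    (b : Δ' → Δ ⊕ N) : Prop :=
  ∀ (W : Type) (D : Diagram 𝒱 Δ) (T : Multiset (Kind 𝒱 × Multiset W)) (bd : Δ → W) (ν : N → W),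
    D.Described T bd → Function.Injective ν → (∀ n, ν n ∉ wires T) → (∀ n b, bd b ≠ ν n) →
    (G D).Described (T + rename (Sum.elim bd ν) g) (fun d => Sum.elim bd ν (b d))

theorem Diagram.Described.mem_wires {D : Diagram 𝒱 Δ} {lab : D.Port → W} (p : D.Port) :
    lab p ∈ wires (fam fun n => (D.kind n, fib D.node lab n)) := by
  rw [wires_fam, fam_fib]
  exact (mem_fam _ _).2 ⟨p, rfl⟩

/-- In the term of `G ((D.cut x).plug F)` the vertices of `F` are still present, so they can be
removed there. The resulting renaming restores the old name of the cut wire and thus yields the term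
of `G D`. -/
theorem Extends.rewrites_of_cut [Finite Δ'] {G : Diagram 𝒱 Δ → Diagram 𝒱 Δ'}
    {g : Multiset (Kind 𝒱 × Multiset (Δ ⊕ N))} {b : Δ' → Δ ⊕ N} (h : Extends G g b)
    (F : Fragment 𝒱 Bool) (hF : ∀ (D : Diagram 𝒱 Δ') x, Step ((D.cut x).plug F) D)
    (D : Diagram 𝒱 Δ) (x : D.Port ⊕ Δ) : Rewrites (G ((D.cut x).plug F)) (G D) := by
  classical
  obtain ⟨T, bd, hD⟩ := D.exists_described
  -- The added names are one for the new half of the cut wire, those of the internal wires of `F`,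
  -- and those of the wires created by `G`.
  have hD2 := hD.rename (g := (Sum.inl : _ → _ ⊕ (Unit ⊕ (F.Edge ⊕ N)))) Sum.inl_injective
  have hD3 := hD2
  set T₂ := rename (Sum.inl : _ → _ ⊕ (Unit ⊕ (F.Edge ⊕ N))) T with hT₂
  have hTw : ∀ y, Sum.inr y ∉ wires T₂ := by
    intro y
    rw [hT₂, wires_rename]
    simp
  obtain ⟨lab, hl, hT⟩ := hD2
  have hlw : ∀ y z, Sum.elim lab (fun b => Sum.inl (bd b)) y ≠ Sum.inr z := by
    rintro (y | y) z h
    · refine hTw z ?_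
      rw [← hT, ← h]
      exact Diagram.Described.mem_wires y
    · simp at h
  set w' : Sym2 (D.Port ⊕ Δ) ⊕ (Unit ⊕ (F.Edge ⊕ N)) := .inr (.inl ()) with hw'
  let l := Sum.elim lab (fun b => Sum.inl (bd b))
  let lab' : D.Port → Sym2 (D.Port ⊕ Δ) ⊕ (Unit ⊕ (F.Edge ⊕ N)) :=
    fun p => if .inl p = x then w' else lab p
  let bd' : Δ → Sym2 (D.Port ⊕ Δ) ⊕ (Unit ⊕ (F.Edge ⊕ N)) :=
    fun b => if .inr b = x then w' else .inl (bd b)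
  have hl' : ∀ y, Sum.elim lab' bd' y = if y = x then w' else l y := by
    rintro (y | y) <;> rfl
  have hcut := D.cut_described x (lab' := lab') (bd' := bd') hl (fun y => hlw y _)
    (by rw [hl', if_pos rfl]) (fun y hy => by rw [hl', if_neg hy])
  have hrep : ∀ y, replaceWire w' (l x) (Sum.elim lab' bd' y) = l y := by
    intro y
    rw [hl']
    by_cases hy : y = x
    · rw [if_pos hy, replaceWire_self, hy]
    · rw [if_neg hy, replaceWire_of_ne (hlw y _)]
  set T₁ := fam fun n => (D.kind n, fib D.node lab' n) with hT₁
  have hlab' : ∀ p z, lab' p = .inr z → z = .inl () := by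
    intro p z hp
    have := hl' (.inl p)
    rw [Sum.elim_inl, hp] at this
    split_ifs at this
    · simpa [hw'] using this
    · exact absurd this.symm (hlw _ _)
  have hbd' : ∀ p z, bd' p = .inr z → z = .inl () := by
    intro p z hp
    have := hl' (.inr p)
    rw [Sum.elim_inr, hp] at this
    split_ifs at this
    · simpa [hw'] using this
    · exact absurd this.symm (hlw _ _)
  have hT₁w : ∀ z, Sum.inr z ∈ wires T₁ → z = .inl () := by
    intro z hz
    rw [hT₁, wires_fam, fam_fib, mem_fam] at hz
    obtain ⟨p, hp⟩ := hz
    exact hlab' p z hp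
  have hplug := hcut.plug F (eg := fun e => .inr (.inr (.inl e)))
    (fun e e' h => by simpa using h)
    (fun e h => by simpa using hT₁w _ h)
    (fun e c h => by simpa using hbd' _ _ h)
    (fun e c h => by
      cases c
      · simp at h
      · exact hlw x _ h)
  have hG₁ := h _ _ _ _ (fun n => .inr (.inr (.inr n))) hplug (fun e e' h => by simpa using h)
    (fun n hn => by
      rw [wires_add, Fragment.wires_term, Multiset.mem_add] at hn
      rcases hn with hn | hn
      · simpa using hT₁w _ hn
      · simp at hn
        exact hlw x _ hn.symm)
    (fun e c h => by simpa using hbd' _ _ h)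
  have hG₂ := h _ _ _ _ (fun n => .inr (.inr (.inr n))) hD3 (fun e e' h => by simpa using h)
    (fun n => hTw _) (fun n c => by simp)
  rw [add_right_comm] at hG₁
  refine (Equates.of_cut F hF (hlw x _) hG₁.proper).rewrites _ _ hG₁ ?_
  convert hG₂ using 1
  · rw [rename_add, rename_rename]
    congr 1
    · rw [← hT, hT₁]
      simp only [rename, map_fam, map_fib]
      congr! 4 with n
      funext p
      exact hrep (.inl p)
    · congr 1
      funext y
      rcases y with y | y
      · exact hrep (.inr y)
      · exact replaceWire_of_ne (by simp)
  · funext d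
    rcases b d with y | y
    · exact hrep (.inr y)
    · exact replaceWire_of_ne (by simp)

/-- On terms `G` only adds vertices, and these join the context of a rule applied inside the
diagram. Hence rewriting is a congruence for every such operation. -/
theorem Extends.rewrites [Finite Δ'] {G : Diagram 𝒱 Δ → Diagram 𝒱 Δ'}
    {g : Multiset (Kind 𝒱 × Multiset (Δ ⊕ N))} {b : Δ' → Δ ⊕ N} (h : Extends G g b)
    {D D' : Diagram 𝒱 Δ} (hD : Rewrites D D') : Rewrites (G D) (G D') := by
  induction hD with
  | refl D => exact .refl _
  | symm _ _ _ ih => exact ih.symm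
  | trans _ _ _ _ _ ih ih' => exact ih.trans ih'
  | rel D D' hs =>
    cases hs with
    | iso e =>
      obtain ⟨T, bd, hD⟩ := D.exists_described
      have hD := hD.rename (g := (Sum.inl : _ → _ ⊕ N)) Sum.inl_injective
      have hw : ∀ y : N, Sum.inr y ∉ wires (rename (Sum.inl : _ → _ ⊕ N) T) := by simp
      exact (h _ _ _ _ _ hD Sum.inr_injective hw (by simp)).rewrites
        (h _ _ _ _ _ (hD.of_iso e) Sum.inr_injective hw (by simp))
    | @rule K _ L R hr C =>
      obtain ⟨T, bd, hC⟩ := C.exists_described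
      have hC := hC.rename (g := (Sum.inl : _ → _ ⊕ ((L.Edge ⊕ R.Edge) ⊕ N))) Sum.inl_injective
      have hw : ∀ y, Sum.inr y ∉ wires (rename (Sum.inl : _ → _ ⊕ ((L.Edge ⊕ R.Edge) ⊕ N)) T) := by
        simp
      have e : (fun b => (Sum.inl (bd b) : _ ⊕ ((L.Edge ⊕ R.Edge) ⊕ N))) =
          Sum.elim (fun b => Sum.inl (bd (.inl b))) (fun k => Sum.inl (bd (.inr k))) := by
        funext y
        rcases y with y | y <;> rfl
      rw [e] at hC
      have hL := hC.plug L (eg := fun e => .inr (.inl (.inl e))) (fun e e' h => by simpa using h)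
        (fun e => hw _) (by simp) (by simp)
      have hR := hC.plug R (eg := fun e => .inr (.inl (.inr e))) (fun e e' h => by simpa using h)
        (fun e => hw _) (by simp) (by simp)
      have hGL := h _ _ _ _ (fun n => .inr (.inr n)) hL (fun e e' h => by simpa using h)
        (fun n hn => by
          rw [wires_add, Fragment.wires_term, Multiset.mem_add] at hn
          exact hn.elim (hw _) (by simp)) (by simp)
      have hGR := h _ _ _ _ (fun n => .inr (.inr n)) hR (fun e e' h => by simpa using h)
        (fun n hn => by
          rw [wires_add, Fragment.wires_term, Multiset.mem_add] at hn
          exact hn.elim (hw _) (by simp)) (by simp)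
      rw [add_right_comm] at hGL hGR
      exact (hr.equates hGL.proper hGR.proper).rewrites _ _ hGL hGR
    | identity D x c => exact h.rewrites_of_cut _ (fun D x => .identity D x c) D' x
    | hCancel D x => exact h.rewrites_of_cut _ .hCancel D' x

end Cutting

end ZX

/-! ### The rewrite rules on terms -/

namespace ZX

section DerivedRules

variable {𝒱 Δ W K K₁ K₂ E : Type}

theorem Reduces.congr {L L' R R' : Multiset (Kind 𝒱 × Multiset W)} (h : Reduces L R) (hL : L' = L)
    (hR : R = R') : Reduces L' R' :=
  hL ▸ hR ▸ h

/-- The term of a fragment given by its components: the ends of the internal edges are listed in two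
functions. -/
noncomputable def rawTerm {N : Type} [Finite N] [Finite K] [Finite E] (kind : N → Kind 𝒱)
    (leg : K → N) (end₁ end₀ : E → N) (lg : K → W) (eg : E → W) : Multiset (Kind 𝒱 × Multiset W) :=
  fam fun n => (kind n, fib leg lg n + (fib end₁ eg n + fib end₀ eg n))

theorem Fragment.term_eq_rawTerm [Finite K] (L : Fragment 𝒱 K) (lg : K → W) (eg : L.Edge → W) :
    L.term lg eg =
      rawTerm L.kind L.leg (fun e => L.ends e true) (fun e => L.ends e false) lg eg := by
  simp [Fragment.term, rawTerm]

theorem rawTerm_one [Finite E] [Finite K] (kind : Unit → Kind 𝒱) (lg : K → W) (eg : E → W) :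
    rawTerm kind (fun _ => ()) (fun _ => ()) (fun _ => ()) lg eg =
      {(kind (), fam lg + (fam eg + fam eg))} := by
  simp [rawTerm, fib_of_forall_eq]

theorem Fragment.one_term (c : Colour) (φ : Phase 𝒱) [Finite E] [Finite K] (lg : K → W)
    (eg : E → W) : (Fragment.one c φ E K).term lg eg =
      {(.spider c φ, fam lg + (fam eg + fam eg))} :=
  (Fragment.term_eq_rawTerm _ _ _).trans (rawTerm_one (E := E) (Fragment.one c φ E K).kind lg eg)

theorem rawTerm_two [Finite E] [Finite K₁] [Finite K₂] (kind : Bool → Kind 𝒱) (lg : K₁ ⊕ K₂ → W)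
    (eg : E → W) :
    rawTerm kind (Sum.elim (fun _ => false) fun _ => true) (fun _ => true) (fun _ => false) lg eg =
      {(kind false, (fam fun k => lg (.inl k)) + fam eg)} +
      {(kind true, (fam fun k => lg (.inr k)) + fam eg)} := by
  simp [rawTerm, fib_of_forall_eq, fib_of_forall_ne, add_comm]

theorem Fragment.two_term (c₁ : Colour) (φ₁ : Phase 𝒱) (c₂ : Colour) (φ₂ : Phase 𝒱) [Finite E]
    [Finite K₁] [Finite K₂] (lg : K₁ ⊕ K₂ → W) (eg : E → W) :
    (Fragment.two c₁ φ₁ c₂ φ₂ E K₁ K₂).term lg eg =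
      {(.spider c₁ φ₁, (fam fun k => lg (.inl k)) + fam eg)} +
      {(.spider c₂ φ₂, (fam fun k => lg (.inr k)) + fam eg)} :=
  (Fragment.term_eq_rawTerm _ _ _).trans
    (rawTerm_two (E := E) (Fragment.two c₁ φ₁ c₂ φ₂ E K₁ K₂).kind lg eg)

theorem rawTerm_star [Finite K₁] [Finite K₂] (kind : K₁ ⊕ Unit → Kind 𝒱) (lg : K₁ ⊕ K₂ → W)
    (eg : K₁ → W) :
    rawTerm kind (Sum.map id fun _ => ()) Sum.inl (fun _ => .inr ()) lg eg =
      (fam fun k => (kind (.inl k), {lg (.inl k)} + {eg k})) +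
      {(kind (.inr ()), (fam fun k => lg (.inr k)) + fam eg)} := by
  have h : ∀ k : K₁, fib (Sum.inl : K₁ → K₁ ⊕ Unit) eg (.inl k) = {eg k} := fun k =>
    fib_of_unique (fun q => Sum.inl_injective.eq_iff) eg
  have h' : ∀ k : K₁, fib (fun k => (Sum.inl k : K₁ ⊕ Unit)) (fun k => lg (.inl k)) (.inl k) =
      {lg (.inl k)} := fun k => fib_of_unique (fun q => Sum.inl_injective.eq_iff) _
  simp [rawTerm, fib_of_forall_eq, fib_of_forall_ne, h, h']

theorem Fragment.star_term (c : Colour) (φ : Phase 𝒱) (ray : Kind 𝒱) [Finite K₁] [Finite K₂]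
    (lg : K₁ ⊕ K₂ → W) (eg : K₁ → W) :
    (Fragment.star c φ ray K₁ K₂).term lg eg =
      (fam fun k => (ray, {lg (.inl k)} + {eg k})) +
      {(.spider c φ, (fam fun k => lg (.inr k)) + fam eg)} :=
  (Fragment.term_eq_rawTerm _ _ _).trans
    (rawTerm_star (Fragment.star c φ ray K₁ K₂).kind lg eg)

theorem rawTerm_hh (kind : Bool → Kind 𝒱) (lg : Bool → W) (eg : Unit → W) :
    rawTerm kind id (fun _ => true) (fun _ => false) lg eg =
      {(kind true, {lg true} + {eg ()})} + {(kind false, {lg false} + {eg ()})} := by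
  simp [rawTerm]

theorem Fragment.hh_term (lg : Bool → W) (eg : Unit → W) :
    (Fragment.hh (𝒱 := 𝒱)).term lg eg =
      {(.hadamard, {lg true} + {eg ()})} + {(.hadamard, {lg false} + {eg ()})} :=
  (Fragment.term_eq_rawTerm _ _ _).trans (rawTerm_hh (Fragment.hh (𝒱 := 𝒱)).kind lg eg)

@[simp] theorem Phase.on_zero (U : Set 𝒱) : Phase.on 0 U = Phase.on 0 ∅ := by
  simp [Phase.on]

/-- In this and the following rules the legs form an arbitrary multiset of wires; the leg type of
the fragment is the index type of its enumeration by `occ`. -/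
theorem reduces_fuse (c : Colour) (α β : Real.Angle) (U : Set 𝒱) (a b : Multiset W) (e : W) :
    Reduces ({(.spider c (.on α U), a + {e})} + {(.spider c (.on β U), b + {e})})
      {(.spider c (.on (α + β) U), a + b)} := by
  have hF : fam (fun _ : Unit => e) = fam (Empty.elim : Empty → W) + {e} := by simp
  refine ((Rule.spider c α β U (Fin a.toList.length) (Fin b.toList.length)).reduces
    (lg := Sum.elim (occ a) (occ b)) {e} hF).congr (.trans ?_ (Fragment.two_term ..).symm)
    ((Fragment.one_term ..).trans ?_)
  · simp [fam_occ]
  · simp [fam_occ]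

theorem reduces_alphaCommute (c : Colour) (φ ψ : Phase 𝒱) (a b : Multiset W) (e : W) :
    Reduces ({(.spider c φ, a + {e})} + {(.spider c ψ, b + {e})})
      ({(.spider c ψ, a + {e})} + {(.spider c φ, b + {e})}) := by
  have hF : fam (fun _ : Unit => e) = fam (fun _ : Unit => e) + 0 := (add_zero _).symm
  refine ((Rule.alphaCommute c φ ψ (Fin a.toList.length) (Fin b.toList.length)).reduces
    (lg := Sum.elim (occ a) (occ b)) 0 hF).congr (.trans ?_ (Fragment.two_term ..).symm)
    ((Fragment.two_term ..).trans ?_)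
  · simp [fam_occ]
  · simp [fam_occ]

theorem map_eq_fam {α β : Type} (Q : Multiset α) (g : α → β) : Q.map g = fam fun k => g (occ Q k) := by
  rw [← map_fam, fam_occ]

/-- A pair in `Q` consists of the inner and the outer wire at a Hadamard vertex. The rule is read
from the star to the single spider, so that the inner wires disappear. -/
theorem reduces_hCommute (c : Colour) (φ : Phase 𝒱) (Q : Multiset (W × W)) :
    Reduces ({(.spider c.swap φ, Q.map Prod.fst)} + Q.map fun q => (.hadamard, {q.1} + {q.2}))
      {(.spider c φ, Q.map Prod.snd)} := by
  have hF : (fam fun k => (occ Q k).1) = fam (Empty.elim : Empty → W) + Q.map Prod.fst := by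
    rw [map_eq_fam Q, fam_of_isEmpty (ι := Empty), zero_add]
  refine ((Rule.hCommute c φ (Fin Q.toList.length)).reduces_symm
    (lg := Sum.elim (fun k => (occ Q k).2) Empty.elim) (Q.map Prod.fst) hF).congr
    (.trans ?_ (Fragment.star_term ..).symm) ((Fragment.one_term ..).trans ?_)
  · simp [map_eq_fam, add_comm]
  · simp [map_eq_fam]

/-- The inner wire of the distinguished leg `e` serves again as the wire between the two spiders of
the result. This requires at least one leg besides `w`. -/
theorem reduces_piCommute (c : Colour) (β : Real.Angle) (U V : Set 𝒱)
    (h : U = ∅ ∨ U = V ∨ -β = β) (w : W) (e : W × W) (Q : Multiset (W × W)) :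
    Reduces ({(.spider c (.on (-β) V), (e ::ₘ Q).map Prod.fst + {w})} +
        (e ::ₘ Q).map fun q => (.spider c.swap (.on Real.pi U), {q.1} + {q.2}))
      ({(.spider c (.on β V), (e ::ₘ Q).map Prod.snd + {e.1})} +
        {(.spider c.swap (.on Real.pi U), {w} + {e.1})}) := by
  have hF : (fam fun k => (occ (e ::ₘ Q) k).1) = fam (fun _ : Unit => e.1) + Q.map Prod.fst := by
    rw [← map_eq_fam, fam_unit, Multiset.map_cons, Multiset.singleton_add]
  refine ((Rule.piCommute c β U V (Fin (e ::ₘ Q).toList.length) h).reduces_symm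
    (lg := Sum.elim (fun k => (occ (e ::ₘ Q) k).2) fun _ => w) (Q.map Prod.fst) hF).congr
    (.trans ?_ (Fragment.star_term ..).symm) ((Fragment.two_term ..).trans ?_)
  · simp [map_eq_fam (e ::ₘ Q), add_comm]
  · simp [map_eq_fam (e ::ₘ Q)]

/-- Without other legs there is no inner wire to reuse, and the wire-removing direction is the
opposite one. -/
theorem reduces_piCommute_end (c : Colour) (β : Real.Angle) (U V : Set 𝒱)
    (h : U = ∅ ∨ U = V ∨ -β = β) (w e : W) :
    Reduces ({(.spider c (.on β V), {e})} + {(.spider c.swap (.on Real.pi U), {w} + {e})})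
      {(.spider c (.on (-β) V), {w})} := by
  have hF : fam (fun _ : Unit => e) = fam (Empty.elim : Empty → W) + {e} := by simp
  refine ((Rule.piCommute c β U V Empty h).reduces (lg := Sum.elim Empty.elim fun _ => w) {e}
    hF).congr (.trans ?_ (Fragment.two_term ..).symm) ((Fragment.star_term ..).trans ?_)
  · simp
  · simp

/-- The two ends of `w'` are at the vertex `k` and at the fragment, so merging `w'` into `w` changes
no name anywhere else. This is the local form of `Equates.of_cut`. -/
theorem reduces_of_cut (F : Fragment 𝒱 Bool)
    (hF : ∀ {Δ : Type} (D : Diagram 𝒱 Δ) x, Step ((D.cut x).plug F) D) (k : Kind 𝒱)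
    (a : Multiset W) (w w' : W) (eg : F.Edge → W) :
    Reduces ({(k, a + {w'})} + F.term (fun b => cond b w w') eg) {(k, a + {w})} := by
  classical
  intro Δ _ C bd h
  rw [← add_assoc] at h ⊢
  have hc : ∀ v, (wires C).count v + a.count v + (fam bd).count v +
      ((if v = w then 1 else 0) + 2 * if v = w' then 1 else 0) ≤ 2 := by
    intro v
    have := h.count_eq v
    rw [wires_add, wires_add, wires_singleton, Fragment.wires_term, fam_bool] at this
    simp only [Multiset.count_add, Multiset.count_singleton, cond_true, cond_false] at this
    omega
  have hne : w ≠ w' := by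
    rintro rfl
    have := hc w
    simp at this
  have h0 := hc w'
  rw [if_neg hne.symm, if_pos rfl] at h0
  have hC : w' ∉ wires C := Multiset.count_eq_zero.1 (by omega)
  have ha : w' ∉ a := Multiset.count_eq_zero.1 (by omega)
  have hb : w' ∉ fam bd := Multiset.count_eq_zero.1 (by omega)
  have := Equates.of_cut F hF hne h
  convert this using 1
  · rw [rename_add, rename_singleton, Multiset.map_add, Multiset.map_singleton, replaceWire_self,
      rename_congr (h := fun v => v), rename_id, Multiset.map_congr rfl (g := id), Multiset.map_id]
    · exact fun v hv => replaceWire_of_ne fun h => ha (h ▸ hv)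
    · exact fun v hv => replaceWire_of_ne fun h => hC (h ▸ hv)
  · funext b
    exact (replaceWire_of_ne fun h => hb ((mem_fam _ _).2 ⟨b, h⟩)).symm

theorem reduces_identity (c : Colour) (k : Kind 𝒱) (a : Multiset W) (w w' : W) :
    Reduces ({(k, a + {w'})} + {(.spider c (.on 0 ∅), {w} + {w'})}) {(k, a + {w})} := by
  refine (reduces_of_cut _ (fun D x => .identity D x c) k a w w' Empty.elim).congr
    (congrArg _ (.trans ?_ (Fragment.one_term ..).symm)) rfl
  simp

theorem reduces_hCancel (k : Kind 𝒱) (a : Multiset W) (w e w' : W) :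
    Reduces ({(k, a + {w'})} + ({(.hadamard, {w} + {e})} + {(.hadamard, {e} + {w'})}))
      {(k, a + {w})} := by
  refine (reduces_of_cut _ .hCancel k a w w' fun _ => e).congr
    (congrArg _ (.trans ?_ (Fragment.hh_term ..).symm)) rfl
  simp only [cond_true, cond_false, add_comm]

end DerivedRules

end ZX

/-! ### Commands as operations on terms -/

namespace ZX

section Gates

variable {V A W N : Type}

/-- The new piece of wire is the one at the boundary vertex; hence the vertices of the diagram keep
their names. -/
theorem Diagram.Described.cut_boundary {𝒱 Δ : Type} {D : Diagram 𝒱 Δ}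
    {T : Multiset (Kind 𝒱 × Multiset W)} {bd : Δ → W} [DecidableEq Δ] (h : D.Described T bd) (b : Δ)
    {w : W} (hT : w ∉ wires T) (hb : ∀ b, bd b ≠ w) :
    (D.cut (.inr b)).Described T
      (Sum.elim (Function.update bd b w) fun c => cond c (bd b) w) := by
  obtain ⟨lab, hl, rfl⟩ := h
  refine D.cut_described (.inr b) hl ?_ ?_ ?_
  · rintro (y | y) h
    · exact hT (h ▸ Diagram.Described.mem_wires y)
    · exact hb y h
  · simp
  · rintro (y | y) h
    · rfl
    · have : y ≠ b := fun h' => h (by rw [h'])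
      simp [this]

theorem Diagram.Described.relabel {𝒱 Δ Δ' : Type} {D : Diagram 𝒱 Δ}
    {T : Multiset (Kind 𝒱 × Multiset W)} {bd : Δ → W} (h : D.Described T bd) (e : Δ ≃ Δ') :
    (D.relabel e).Described T fun d => bd (e.symm d) := by
  obtain ⟨lab, hl, rfl⟩ := h
  refine ⟨lab, fun x y => ?_, rfl⟩
  have he : ∀ x, Sum.elim lab (fun d => bd (e.symm d)) x =
      Sum.elim lab bd (Sum.map id e.symm x) := by
    rintro (x | x) <;> rfl
  have hs : ∀ x y : D.Port ⊕ Δ', Sum.map id e.symm y = Sum.map id e.symm x ↔ y = x :=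
    fun x y => (Sum.map_injective.2 ⟨Function.injective_id, e.symm.injective⟩).eq_iff
  have hs' : ∀ x y, Sum.map id e.symm y = D.link x ↔ y = Sum.map id e (D.link x) := by
    intro x y
    constructor
    · intro h
      rw [← h]
      rcases y with y | y <;> simp
    · rintro rfl
      rcases D.link x with y | y <;> simp
  exact (Eq.congr (he x) (he y)).trans ((hl _ _).trans (Iff.or (hs x y) (hs' _ y)))

/-- Inserting a vertex into an output wire. -/
noncomputable def insertVertex (c : Colour) (φ : Phase V) (i : V) (D : Diagram V (A ⊕ V)) :
    Diagram V (A ⊕ V) :=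
  (D.cut (.inr (.inr i))).plug (.one c φ Empty Bool)

section Described

open Classical

theorem Diagram.Described.insertVertex {D : Diagram V (A ⊕ V)}
    {T : Multiset (Kind V × Multiset W)} {bd : A ⊕ V → W} (h : D.Described T bd) (c : Colour)
    (φ : Phase V) (i : V) {w : W} (hT : w ∉ wires T) (hb : ∀ b, bd b ≠ w) :
    (insertVertex c φ i D).Described (T + {(.spider c φ, {bd (.inr i)} + {w})})
      (Function.update bd (.inr i) w) := by
  have := (h.cut_boundary (.inr i) hT hb).plug (.one c φ Empty Bool) (eg := Empty.elim)
    (fun e => e.elim) (fun e => e.elim) (fun e => e.elim) (fun e => e.elim)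
  refine (congrArg (fun S => (ZX.insertVertex c φ i D).Described (T + S) _)
    ((Fragment.one_term c φ _ Empty.elim).trans ?_)).mp this
  simp

theorem Fragment.cz_term (lg : Bool ⊕ Bool → W) (eg : Bool → W) :
    (czFragment (V := V)).term lg eg =
      {(.spider .Z (.on 0 ∅), {lg (.inl true)} + {lg (.inl false)} + {eg false})} +
      {(.spider .Z (.on 0 ∅), {lg (.inr true)} + {lg (.inr false)} + {eg true})} +
      {(.hadamard, {eg false} + {eg true})} := by
  refine (Fragment.term_eq_rawTerm _ _ _).trans ?_
  have : ∀ (kind : Bool ⊕ Unit → Kind V),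
      rawTerm kind (Sum.elim (fun _ => .inl false) fun _ => .inl true) (fun _ => .inr ()) Sum.inl
        lg eg = {(kind (.inl false), {lg (.inl true)} + {lg (.inl false)} + {eg false})} +
          {(kind (.inl true), {lg (.inr true)} + {lg (.inr false)} + {eg true})} +
          {(kind (.inr ()), {eg false} + {eg true})} := by
    intro kind
    simp only [rawTerm, fam_sum, fam_bool, fam_unit, fib_sum, fib_bool, Sum.elim_inl, Sum.elim_inr]
    simp [add_comm]
  exact this (czFragment (V := V)).kind

-- Four fresh names are needed: `w` and `w'` for the new output wires, `x` and `y` for the two wires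
-- at the Hadamard vertex.
set_option maxHeartbeats 1000000 in
theorem Diagram.Described.entangle {D : Diagram V (A ⊕ V)}
    {T : Multiset (Kind V × Multiset W)} {bd : A ⊕ V → W} (h : D.Described T bd) {i j : V}
    (hij : i ≠ j) {w w' x y : W} (hT : ∀ v ∈ [w, w', x, y], v ∉ wires T)
    (hb : ∀ v ∈ [w, w', x, y], ∀ b, bd b ≠ v) (hnd : [w, w', x, y].Nodup) :
    (applyCommand D (.E i j)).Described
      (T + ({(.spider .Z (.on 0 ∅), {bd (.inr i)} + {w} + {x})} +
        {(.spider .Z (.on 0 ∅), {bd (.inr j)} + {w'} + {y})} + {(.hadamard, {x} + {y})}))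
      (Function.update (Function.update bd (.inr i) w) (.inr j) w') := by
  simp only [List.mem_cons, List.not_mem_nil, or_false, forall_eq_or_imp, forall_eq] at hT hb
  simp only [List.nodup_cons, List.mem_cons, List.not_mem_nil, or_false, not_or,
    List.nodup_nil, not_false_eq_true, and_true] at hnd
  have h1 := (h.cut_boundary (.inr i) hT.1 hb.1).cut_boundary (.inl (.inr j)) hT.2.1 (by
    rintro (b | _ | _)
    · by_cases hbi : b = .inr i
      · subst hbi
        simpa using hnd.1.1
      · simpa [hbi] using hb.2.1 b
    · exact hnd.1.1
    · exact hb.2.1 _)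
  have h2 := h1.relabel (Equiv.sumAssoc _ _ _)
  have e : (fun d => Sum.elim (Function.update (Sum.elim (Function.update bd (.inr i) w)
        fun c => cond c (bd (.inr i)) w) (.inl (.inr j)) w')
        (fun c => cond c ((Sum.elim (Function.update bd (.inr i) w)
        fun c => cond c (bd (.inr i)) w) (.inl (.inr j))) w') ((Equiv.sumAssoc _ _ _).symm d)) =
      Sum.elim (Function.update (Function.update bd (.inr i) w) (.inr j) w')
        (Sum.elim (fun c => cond c (bd (.inr i)) w) fun c => cond c (bd (.inr j)) w') := by
    have hji : (Sum.inr j : A ⊕ V) ≠ .inr i := fun h => hij (Sum.inr_injective h).symm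
    funext d
    rcases d with b | b | b
    · rw [Equiv.sumAssoc_symm_apply_inl, Sum.elim_inl, Sum.elim_inl]
      by_cases hb : b = .inr j
      · rw [hb, Function.update_self, Function.update_self]
      · have hb' : (Sum.inl b : (A ⊕ V) ⊕ Bool) ≠ .inl (.inr j) :=
          fun h => hb (Sum.inl_injective h)
        rw [Function.update_of_ne hb, Function.update_of_ne hb', Sum.elim_inl]
    · rfl
    · rw [Equiv.sumAssoc_symm_apply_inr_inr]
      simp only [Sum.elim_inl, Sum.elim_inr, Function.update_of_ne hji]
  rw [e] at h2
  have hbx : ∀ v, w ≠ v → w' ≠ v → (∀ b, bd b ≠ v) → ∀ b,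
      Function.update (Function.update bd (.inr i) w) (.inr j) w' b ≠ v := by
    intro v h1 h2 h3 b
    by_cases hj : b = .inr j
    · rwa [hj, Function.update_self]
    · rw [Function.update_of_ne hj]
      by_cases hi : b = .inr i
      · rwa [hi, Function.update_self]
      · rw [Function.update_of_ne hi]
        exact h3 b
  have g1 : Function.Injective (fun c => cond c y x : Bool → W) := by
    rintro (_ | _) (_ | _) h
    exacts [rfl, absurd h hnd.2.2, absurd h.symm hnd.2.2, rfl]
  have g2 : ∀ c : Bool, cond c y x ∉ wires T := by
    rintro (_ | _)
    exacts [hT.2.2.1, hT.2.2.2]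
  have g3 : ∀ (c : Bool) b,
      Function.update (Function.update bd (.inr i) w) (.inr j) w' b ≠ cond c y x := by
    rintro (_ | _) b
    exacts [hbx _ hnd.1.2.1 hnd.2.1.1 hb.2.2.1 b, hbx _ hnd.1.2.2 hnd.2.1.2 hb.2.2.2 b]
  have g4 : ∀ (c : Bool) k, Sum.elim (fun c => cond c (bd (.inr i)) w)
      (fun c => cond c (bd (.inr j)) w') k ≠ cond c y x := by
    rintro (_ | _) ((_ | _) | (_ | _))
    exacts [hnd.1.2.1, hb.2.2.1 _, hnd.2.1.1, hb.2.2.1 _, hnd.1.2.2, hb.2.2.2 _, hnd.2.1.2,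
      hb.2.2.2 _]
  have h3 := h2.plug czFragment g1 g2 g3 g4
  rw [Fragment.cz_term] at h3
  exact h3

theorem extends_insertVertex (c : Colour) (φ : Phase V) (i : V) :
    Extends (fun D : Diagram V (A ⊕ V) => insertVertex c φ i D)
      {(.spider c φ, {Sum.inl (Sum.inr i)} + {Sum.inr ()})}
      (Function.update Sum.inl (.inr i) (.inr ())) := by
  intro W D T bd ν h hν hT hb
  have := h.insertVertex c φ i (hT ()) (hb ())
  convert this using 1
  · simp
  · funext d
    by_cases hd : d = .inr i
    · subst hd
      simp
    · simp [Function.update_of_ne hd]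

theorem extends_entangle {i j : V} (hij : i ≠ j) :
    Extends (fun D : Diagram V (A ⊕ V) => applyCommand D (.E i j))
      ({(.spider .Z (.on 0 ∅), {Sum.inl (Sum.inr i)} + {Sum.inr (0 : Fin 4)} + {Sum.inr 2})} +
        {(.spider .Z (.on 0 ∅), {Sum.inl (Sum.inr j)} + {Sum.inr 1} + {Sum.inr 3})} +
        {(.hadamard, {Sum.inr 2} + {Sum.inr 3})})
      (Function.update (Function.update Sum.inl (.inr i) (.inr 0)) (.inr j) (.inr 1)) := by
  intro W D T bd ν h hν hT hb
  have := h.entangle hij (w := ν 0) (w' := ν 1) (x := ν 2) (y := ν 3)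
    (by simp [hT]) (by simp [hb]) (by simp [hν.eq_iff])
  convert this using 1
  · simp only [rename_add, rename_singleton, Multiset.map_add, Multiset.map_singleton, Sum.elim_inl,
      Sum.elim_inr]
  · funext d
    by_cases hd : d = .inr j
    · subst hd
      simp
    · by_cases hd' : d = .inr i
      · subst hd'
        simp [Function.update_of_ne hd]
      · simp [Function.update_of_ne hd, Function.update_of_ne hd']

end Described

theorem Rewrites.applyCommand [Finite V] [Finite A] {D D' : Diagram V (A ⊕ V)} (h : Rewrites D D')
    {c : Command V} (hc : ∀ i, c ≠ .E i i) :
    Rewrites (ZX.applyCommand D c) (ZX.applyCommand D' c) := by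
  cases c with
  | N i => exact h
  | M i α => exact h
  | E i j => exact (extends_entangle fun h : i = j => hc i (h ▸ rfl)).rewrites h
  | X i s => exact (extends_insertVertex .X _ i).rewrites h
  | Z i s => exact (extends_insertVertex .Z _ i).rewrites h

theorem Rewrites.foldl [Finite V] [Finite A] {D D' : Diagram V (A ⊕ V)} (h : Rewrites D D')
    {l : List (Command V)} (hl : ∀ i, .E i i ∉ l) :
    Rewrites (l.foldl ZX.applyCommand D) (l.foldl ZX.applyCommand D') := by
  induction l generalizing D D' with
  | nil => exact h
  | cons c l ih =>
    exact ih (h.applyCommand fun i hc => hl i (by simp [hc])) fun i hi => hl i (by simp [hi])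

/-- An unlimited supply of unused names lets two composites be described with common boundary names
and compared as terms. -/
theorem Diagram.exists_fresh_described {𝒱 Δ : Type} (D : Diagram 𝒱 Δ) :
    ∃ (W : Type) (T : Multiset (Kind 𝒱 × Multiset W)) (bd : Δ → W) (ν : ℕ → W),
      D.Described T bd ∧ Function.Injective ν ∧ (∀ n, ν n ∉ wires T) ∧ ∀ n b, bd b ≠ ν n := by
  obtain ⟨T, bd, h⟩ := D.exists_described
  exact ⟨_, _, _, Sum.inr, h.rename (Sum.inl_injective (β := ℕ)), Sum.inr_injective,
    by simp, by simp⟩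

end Gates

end ZX

/-! ### Commutation of corrections with each other and with the controlled `Z` gate -/

namespace ZX

section Words

variable {V A W : Type}

/-- For equations in which each side has to gain wires before it can become the other: both are
reached from a larger term `B`, whose additional wires `G` are chosen fresh. -/
theorem Reduces.meet {𝒱 Δ : Type} [Finite Δ] {B C L R : Multiset (Kind 𝒱 × Multiset W)} {bd : Δ → W}
    (hL : Reduces B L) (hR : Reduces B R) (h : Proper (C + L) bd) (F G : Multiset W)
    (hw : wires B + (F + F) = wires L + (G + G)) (hG : G.Nodup)
    (hGL : ∀ w ∈ G, w ∉ wires (C + L)) (hGb : ∀ w ∈ G, ∀ b, bd b ≠ w)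
    (hB : ∀ x ∈ B, x.1 = .hadamard → Multiset.card x.2 = 2) : Equates (C + L) bd (C + R) bd :=
  have hP := h.replace F G hw hG hGL hGb hB
  (hL _ C bd hP).symm.trans (hR _ C bd hP)

theorem Equates.rewrites_of_described {𝒱 Δ : Type} [Finite Δ]
    {T T' : Multiset (Kind 𝒱 × Multiset W)} {bd bd' : Δ → W} {D D' : Diagram 𝒱 Δ}
    (h : D.Described T bd) (h' : D'.Described T' bd') (e : Equates T bd T' bd') : Rewrites D D' :=
  e.rewrites D D' h h'

section

open Classical

theorem insertVertex_comm_of_ne (c c' : Colour) (φ φ' : Phase V) {i j : V} (h : i ≠ j)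
    (D : Diagram V (A ⊕ V)) :
    Rewrites (insertVertex c φ i (insertVertex c' φ' j D))
      (insertVertex c' φ' j (insertVertex c φ i D)) := by
  obtain ⟨W, T, bd, ν, hD, hν, hT, hb⟩ := D.exists_fresh_described
  have hi : (Sum.inr i : A ⊕ V) ≠ .inr j := by simpa using h
  have h1 := (hD.insertVertex c φ i (hT 0) (hb 0)).insertVertex c' φ' j (w := ν 1)
    (by simp [hT, Ne.symm (hb _ _), hν.eq_iff]) (by
      intro b
      by_cases hb' : b = .inr i
      · simp [hb', hν.eq_iff]
      · simp [hb', hb])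
  have h2 := (hD.insertVertex c' φ' j (hT 1) (hb 1)).insertVertex c φ i (w := ν 0)
    (by simp [hT, Ne.symm (hb _ _), hν.eq_iff]) (by
      intro b
      by_cases hb' : b = .inr j
      · simp [hb', hν.eq_iff]
      · simp [hb', hb])
  rw [Function.update_of_ne hi] at h2
  rw [Function.update_of_ne hi.symm] at h1
  rw [Function.update_comm hi, add_right_comm] at h1
  exact h2.rewrites h1

theorem Diagram.Described.insertVertex_insertVertex {D : Diagram V (A ⊕ V)}
    {T : Multiset (Kind V × Multiset W)} {bd : A ⊕ V → W} {ν : ℕ → W} (h : D.Described T bd)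
    (hν : Function.Injective ν) (hT : ∀ n, ν n ∉ wires T) (hb : ∀ n b, bd b ≠ ν n)
    (c c' : Colour) (φ φ' : Phase V) (i : V) :
    (ZX.insertVertex c' φ' i (ZX.insertVertex c φ i D)).Described
      (T + ({(.spider c φ, {bd (.inr i)} + {ν 0})} + {(.spider c' φ', {ν 1} + {ν 0})}))
      (Function.update bd (.inr i) (ν 1)) := by
  have h1 := (h.insertVertex c φ i (hT 0) (hb 0)).insertVertex c' φ' i (w := ν 1)
    (by simp [hT, Ne.symm (hb _ _), hν.eq_iff]) (by
      intro b
      by_cases hb' : b = .inr i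
      · simp [hb', hν.eq_iff]
      · simp [hb', hb])
  rwa [Function.update_self, Function.update_idem, add_assoc, add_comm {ν 0} {ν 1}] at h1

theorem insertVertex_comm_same [Finite A] [Finite V] (c : Colour) (φ φ' : Phase V) (i : V)
    (D : Diagram V (A ⊕ V)) :
    Rewrites (insertVertex c φ' i (insertVertex c φ i D))
      (insertVertex c φ i (insertVertex c φ' i D)) := by
  obtain ⟨W, T, bd, ν, hD, hν, hT, hb⟩ := D.exists_fresh_described
  have h1 := hD.insertVertex_insertVertex hν hT hb c c φ φ' i
  have h2 := hD.insertVertex_insertVertex hν hT hb c c φ' φ i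
  exact (reduces_alphaCommute c φ φ' _ _ _ _ _ _ h1.proper).rewrites_of_described h1 h2

theorem insertVertex_comm_pi [Finite A] [Finite V] (c : Colour) (U U' : Set V) (i : V)
    (D : Diagram V (A ⊕ V)) :
    Rewrites (insertVertex c (.on Real.pi U) i (insertVertex c.swap (.on Real.pi U') i D))
      (insertVertex c.swap (.on Real.pi U') i (insertVertex c (.on Real.pi U) i D)) := by
  obtain ⟨W, T, bd, ν, hD, hν, hT, hb⟩ := D.exists_fresh_described
  have h1 := hD.insertVertex_insertVertex hν hT hb c.swap c (.on Real.pi U') (.on Real.pi U) i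
  have h2 := hD.insertVertex_insertVertex hν hT hb c c.swap (.on Real.pi U) (.on Real.pi U') i
  -- Since $-\pi=\pi$, the last alternative of the side condition admits arbitrary signal sets.
  have h3 := reduces_piCommute c Real.pi U' U (.inr (.inr Real.Angle.neg_coe_pi)) (bd (.inr i))
    (ν 0, ν 1) 0
  have h4 := h3.congr (L' := {(.spider c (.on Real.pi U), {bd (.inr i)} + {ν 0})} +
      {(.spider c.swap (.on Real.pi U'), {ν 1} + {ν 0})})
    (R' := {(.spider c.swap (.on Real.pi U'), {bd (.inr i)} + {ν 0})} +
      {(.spider c (.on Real.pi U), {ν 1} + {ν 0})})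
    (by simp [Real.Angle.neg_coe_pi, add_comm]) (by simp [add_comm])
  exact ((h4 _ _ _ h2.proper).rewrites_of_described h2 h1).symm

/-- The two vertices fuse to angle $2\pi=0$, whose label carries no variables, and this vertex is
removed by the identity rule. -/
theorem insertVertex_sq [Finite A] [Finite V] (c : Colour) (U : Set V) (i : V)
    (D : Diagram V (A ⊕ V)) :
    Rewrites (insertVertex c (.on Real.pi U) i (insertVertex c (.on Real.pi U) i D)) D := by
  obtain ⟨W, T, bd, ν, hD, hν, hT, hb⟩ := D.exists_fresh_described
  have h1 := hD.insertVertex_insertVertex hν hT hb c c (.on Real.pi U) (.on Real.pi U) i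
  have h2 := reduces_fuse c Real.pi Real.pi U _ _ _ _ _ _ h1.proper
  have h3 : (Fragment.one c (.on (0 : Real.Angle) (∅ : Set V)) Empty Bool).term
      (fun b => cond b (bd (.inr i)) (ν 1)) Empty.elim =
      {(.spider c (.on (Real.pi + Real.pi : Real.Angle) U), {bd (.inr i)} + {ν 1})} := by
    refine (Fragment.one_term ..).trans ?_
    simp [Real.Angle.coe_pi_add_coe_pi]
  have h4 := h2.right
  rw [← h3] at h4 h2
  have h5 := Equates.of_cut _ (fun D x => Step.identity D x c) (hb 1 _) h4
  have hne : ∀ w, w ≠ ν 1 → replaceWire (ν 1) (bd (.inr i)) w = w := fun w => replaceWire_of_ne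
  have h6 : rename (replaceWire (ν 1) (bd (.inr i))) T = T := by
    rw [rename_congr (h := fun w => w), rename_id]
    exact fun w hw => hne w fun h => hT 1 (h ▸ hw)
  have h7 : (fun b => replaceWire (ν 1) (bd (.inr i)) (Function.update bd (.inr i) (ν 1) b)) =
      bd := by
    funext b
    by_cases hb' : b = .inr i
    · simp [hb', replaceWire_self]
    · simp [hb', hne _ (hb 1 b)]
  rw [h6, h7] at h5
  exact (h2.trans h5).rewrites_of_described h1 hD

theorem update_ne_of_ne {Δ : Type} [DecidableEq Δ] {f : Δ → W} {b : Δ} {w v : W} (h : w ≠ v)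
    (hf : ∀ b, f b ≠ v) (b' : Δ) : Function.update f b w b' ≠ v := by
  by_cases hb : b' = b
  · rwa [hb, Function.update_self]
  · rw [Function.update_of_ne hb]
    exact hf b'

theorem entangle_symm {i j : V} (hij : i ≠ j) (D : Diagram V (A ⊕ V)) :
    Rewrites (applyCommand D (.E i j)) (applyCommand D (.E j i)) := by
  obtain ⟨W, T, bd, ν, hD, hν, hT, hb⟩ := D.exists_fresh_described
  have h1 := hD.entangle hij (w := ν 0) (w' := ν 1) (x := ν 2) (y := ν 3)
    (by simp [hT]) (by simp [hb]) (by simp [hν.eq_iff])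
  have h2 := hD.entangle hij.symm (w := ν 1) (w' := ν 0) (x := ν 3) (y := ν 2)
    (by simp [hT]) (by simp [hb]) (by simp [hν.eq_iff])
  have hi : (Sum.inr i : A ⊕ V) ≠ .inr j := by simpa using hij
  rw [Function.update_comm hi.symm, add_comm {(Kind.spider _ _, _)}, add_comm {ν 3}] at h2
  exact h1.rewrites h2

theorem entangle_insertVertex_of_ne (c : Colour) (φ : Phase V) {i j k : V} (hij : i ≠ j)
    (hi : k ≠ i) (hj : k ≠ j) (D : Diagram V (A ⊕ V)) :
    Rewrites (applyCommand (insertVertex c φ k D) (.E i j))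
      (insertVertex c φ k (applyCommand D (.E i j))) := by
  obtain ⟨W, T, bd, ν, hD, hν, hT, hb⟩ := D.exists_fresh_described
  have hij' : (Sum.inr i : A ⊕ V) ≠ .inr j := by simpa using hij
  have hi' : (Sum.inr k : A ⊕ V) ≠ .inr i := by simpa using hi
  have hj' : (Sum.inr k : A ⊕ V) ≠ .inr j := by simpa using hj
  have h1 := (hD.insertVertex c φ k (hT 4) (hb 4)).entangle hij
    (w := ν 0) (w' := ν 1) (x := ν 2) (y := ν 3)
    (by simp [hT, Ne.symm (hb _ _), hν.eq_iff]) (by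
      simp only [List.forall_mem_cons]
      refine ⟨?_, ?_, ?_, ?_, by simp⟩ <;>
      exact update_ne_of_ne (by simp [hν.eq_iff]) (hb _)) (by simp [hν.eq_iff])
  have h2 := (hD.entangle hij (w := ν 0) (w' := ν 1) (x := ν 2) (y := ν 3)
    (by simp [hT]) (by simp [hb]) (by simp [hν.eq_iff])).insertVertex c φ k (w := ν 4)
    (by simp [hT, Ne.symm (hb _ _), hν.eq_iff])
    (update_ne_of_ne (by simp [hν.eq_iff]) (update_ne_of_ne (by simp [hν.eq_iff]) (hb _)))
  rw [Function.update_of_ne hi'.symm, Function.update_of_ne hj'.symm,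
    add_right_comm, Function.update_comm hi', Function.update_comm hj'] at h1
  rw [Function.update_of_ne hj', Function.update_of_ne hi'] at h2
  exact h1.rewrites h2

/-- On both sides the correction fuses with the `Z` vertex of the gate, with the same result. -/
theorem entangle_insertVertex_Z [Finite A] [Finite V] (β : Real.Angle) (U : Set V) {i j : V}
    (hij : i ≠ j) (D : Diagram V (A ⊕ V)) :
    Rewrites (applyCommand (insertVertex .Z (.on β U) i D) (.E i j))
      (insertVertex .Z (.on β U) i (applyCommand D (.E i j))) := by
  obtain ⟨W, T, bd, ν, hD, hν, hT, hb⟩ := D.exists_fresh_described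
  have hij' : (Sum.inr i : A ⊕ V) ≠ .inr j := by simpa using hij
  have h1 := (hD.insertVertex .Z (.on β U) i (hT 4) (hb 4)).entangle hij
    (w := ν 0) (w' := ν 1) (x := ν 2) (y := ν 3)
    (by simp [hT, Ne.symm (hb _ _), hν.eq_iff]) (by
      simp only [List.forall_mem_cons]
      refine ⟨?_, ?_, ?_, ?_, by simp⟩ <;>
      exact update_ne_of_ne (by simp [hν.eq_iff]) (hb _)) (by simp [hν.eq_iff])
  have h2 := (hD.entangle hij (w := ν 4) (w' := ν 1) (x := ν 2) (y := ν 3)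
    (by simp [hT]) (by simp [hb]) (by simp [hν.eq_iff])).insertVertex .Z (.on β U) i (w := ν 0)
    (by simp [hT, Ne.symm (hb _ _), hν.eq_iff])
    (update_ne_of_ne (by simp [hν.eq_iff]) (update_ne_of_ne (by simp [hν.eq_iff]) (hb _)))
  rw [Function.update_self, Function.update_of_ne hij'.symm, Function.update_idem] at h1
  rw [Function.update_of_ne hij', Function.update_self, Function.update_comm hij'.symm,
    Function.update_idem] at h2
  set a := bd (.inr i)
  set b := bd (.inr j)
  set Z0 : Multiset W → Multiset (Kind V × Multiset W) :=
    fun S => {(.spider .Z (.on 0 ∅), S)} with hZ0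
  set Zb : Multiset W → Multiset (Kind V × Multiset W) :=
    fun S => {(.spider .Z (.on β U), S)} with hZb
  set H : Multiset W → Multiset (Kind V × Multiset W) := fun S => {(.hadamard, S)} with hH
  have e1 : Reduces (Zb ({a} + {ν 4}) + (Z0 ({ν 4} + {ν 0} + {ν 2}) + Z0 ({b} + {ν 1} + {ν 3}) +
      H ({ν 2} + {ν 3}))) (Zb ({a} + {ν 0} + {ν 2}) + Z0 ({b} + {ν 1} + {ν 3}) +
      H ({ν 2} + {ν 3})) := by
    refine ((reduces_fuse .Z β 0 U {a} ({ν 0} + {ν 2}) (ν 4)).add_right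
      (Z0 ({b} + {ν 1} + {ν 3}) + H ({ν 2} + {ν 3}))).congr ?_ ?_
    · simp only [hZb, hZ0, hH, Phase.on_zero, add_comm, add_left_comm, add_assoc]
    · simp only [hZb, hZ0, hH, add_zero, add_assoc]
  have e2 : Reduces (Z0 ({a} + {ν 4} + {ν 2}) + Z0 ({b} + {ν 1} + {ν 3}) +
      H ({ν 2} + {ν 3}) + Zb ({ν 4} + {ν 0})) (Zb ({a} + {ν 0} + {ν 2}) +
      Z0 ({b} + {ν 1} + {ν 3}) + H ({ν 2} + {ν 3})) := by
    refine ((reduces_fuse .Z β 0 U {ν 0} ({a} + {ν 2}) (ν 4)).add_right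
      (Z0 ({b} + {ν 1} + {ν 3}) + H ({ν 2} + {ν 3}))).congr ?_ ?_
    · simp only [hZb, hZ0, hH, Phase.on_zero, add_comm, add_left_comm, add_assoc]
    · simp only [hZb, hZ0, hH, add_zero, add_comm, add_left_comm]
  rw [add_assoc] at h1 h2
  exact ((e1 _ _ _ h1.proper).trans (e2 _ _ _ h2.proper).symm).rewrites_of_described h1 h2

/-- The term that reduces to both sides of the commutation of `X` with the controlled `Z` gate. -/
noncomputable def crossing (U : Set V) (a b : W) (w : Fin 9 → W) : Multiset (Kind V × Multiset W) :=
  {(.spider .Z (.on 0 ∅), {a} + {w 0} + {w 6})} +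
    {(.spider .X (.on Real.pi U), {w 0} + {w 1})} +
    ({(.spider .Z (.on Real.pi U), {w 7} + {w 8})} +
    ({(.hadamard, {w 7} + {w 6})} + {(.hadamard, {w 8} + {w 3})})) +
    {(.hadamard, {w 3} + {w 4})} + {(.spider .Z (.on 0 ∅), {b} + {w 2} + {w 4})}

/-- A `Z` vertex of angle $\pi$ between two Hadamard vertices becomes an `X` vertex. Then two legs
of a `Z` vertex of angle zero carry `X` vertices of angle $\pi$, which are pulled to the third leg.
-/
theorem crossing_reduces_left (U : Set V) (a b : W) (w : Fin 9 → W) :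
    Reduces (crossing U a b w)
      ({(.spider .X (.on Real.pi U), {a} + {w 0})} +
        ({(.spider .Z (.on 0 ∅), {w 0} + {w 1} + {w 3})} +
        {(.spider .Z (.on 0 ∅), {b} + {w 2} + {w 4})} + {(.hadamard, {w 3} + {w 4})})) := by
  have h1 : Reduces ({(.spider .Z (.on Real.pi U), {w 7} + {w 8})} +
      ({(.hadamard, {w 7} + {w 6})} + {(.hadamard, {w 8} + {w 3})}))
      {(.spider .X (.on Real.pi U), {w 6} + {w 3})} :=
    (reduces_hCommute .X (.on Real.pi U) ((w 7, w 6) ::ₘ {(w 8, w 3)})).congr rfl rfl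
  have h2 : Reduces ({(.spider .Z (.on 0 ∅), {a} + {w 0} + {w 6})} +
      {(.spider .X (.on Real.pi U), {w 0} + {w 1})} +
      {(.spider .X (.on Real.pi U), {w 6} + {w 3})})
      ({(.spider .X (.on Real.pi U), {a} + {w 0})} +
        {(.spider .Z (.on 0 ∅), {w 0} + {w 1} + {w 3})}) := by
    refine (reduces_piCommute .Z 0 U ∅ (.inr (.inr neg_zero)) a (w 0, w 1) {(w 6, w 3)}).congr
      ?_ ?_
    · simp only [← Multiset.singleton_add, Multiset.map_add, Multiset.map_singleton, neg_zero,
        add_assoc, Colour.swap]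
      simp only [add_comm, add_left_comm]
    · simp only [← Multiset.singleton_add, Multiset.map_add, Multiset.map_singleton,
        add_comm, add_assoc, Colour.swap]
  refine ((((h1.add_left _).trans h2).add_right _).add_right _).congr rfl ?_
  rw [add_assoc, add_assoc, add_assoc, add_comm {(Kind.hadamard, _)}]
  simp only [add_assoc]

/-- The other pairing: two consecutive Hadamard vertices cancel, and the `Z` vertex of angle $\pi$
fuses into the vertex of the second qubit. -/
theorem crossing_reduces_right (U : Set V) (a b : W) (w : Fin 9 → W) :
    Reduces (crossing U a b w)
      ({(.spider .Z (.on 0 ∅), {a} + {w 0} + {w 6})} +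
        {(.spider .X (.on Real.pi U), {w 0} + {w 1})} +
        ({(.spider .Z (.on Real.pi U), {w 7} + ({b} + {w 2}))} +
        {(.hadamard, {w 7} + {w 6})})) := by
  have h1 := reduces_hCancel (.spider .Z (.on Real.pi U)) {w 7} (w 4) (w 3) (w 8)
  have h2 := reduces_fuse .Z Real.pi 0 U {w 7} ({b} + {w 2}) (w 4)
  rw [Phase.on_zero, add_zero] at h2
  refine (((h1.add_right _).trans (h2.congr rfl rfl)).add_left
    ({(.spider .Z (.on 0 ∅), {a} + {w 0} + {w 6})} +
        {(.spider .X (.on Real.pi U), {w 0} + {w 1})} + {(.hadamard, {w 7} + {w 6})})).congr ?_ ?_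
  · rw [crossing, add_comm {w 3} {w 4}, add_comm {w 8} {w 3}]
    abel
  · abel

theorem entangle_insertVertex_X [Finite A] [Finite V] (U : Set V) {i j : V}
    (hij : i ≠ j) (D : Diagram V (A ⊕ V)) :
    Rewrites (applyCommand (insertVertex .X (.on Real.pi U) i D) (.E i j))
      (insertVertex .Z (.on Real.pi U) j
        (insertVertex .X (.on Real.pi U) i (applyCommand D (.E i j)))) := by
  obtain ⟨W, T, bd, ν, hD, hν, hT, hb⟩ := D.exists_fresh_described
  have hij' : (Sum.inr i : A ⊕ V) ≠ .inr j := by simpa using hij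
  have h1 := (hD.insertVertex .X (.on Real.pi U) i (hT 0) (hb 0)).entangle hij
    (w := ν 1) (w' := ν 2) (x := ν 3) (y := ν 4)
    (by simp [hT, Ne.symm (hb _ _), hν.eq_iff]) (by
      simp only [List.forall_mem_cons]
      refine ⟨?_, ?_, ?_, ?_, by simp⟩ <;>
      exact update_ne_of_ne (by simp [hν.eq_iff]) (hb _)) (by simp [hν.eq_iff])
  have h2 := ((hD.entangle hij (w := ν 0) (w' := ν 5) (x := ν 6) (y := ν 7)
    (by simp [hT]) (by simp [hb]) (by simp [hν.eq_iff])).insertVertex .X (.on Real.pi U) i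
    (w := ν 1) (by simp [hT, Ne.symm (hb _ _), hν.eq_iff])
    (update_ne_of_ne (by simp [hν.eq_iff]) (update_ne_of_ne (by simp [hν.eq_iff])
      (hb _)))).insertVertex .Z (.on Real.pi U) j (w := ν 2)
    (by simp [hT, Ne.symm (hb _ _), hν.eq_iff, Function.update_of_ne hij'])
    (update_ne_of_ne (by simp [hν.eq_iff]) (update_ne_of_ne (by simp [hν.eq_iff])
      (update_ne_of_ne (by simp [hν.eq_iff]) (hb _))))
  rw [Function.update_self, Function.update_of_ne hij'.symm, Function.update_idem] at h1
  rw [Function.update_of_ne hij', Function.update_self, Function.update_of_ne hij'.symm,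
    Function.update_self, Function.update_comm hij'.symm, Function.update_idem,
    Function.update_idem] at h2
  set a := bd (.inr i)
  set b := bd (.inr j)
  -- The correction on `j` is fused into the gate, which is the form reached by
  -- `crossing_reduces_right`.
  have s1 : Reduces ({(.spider .Z (.on 0 ∅), {a} + {ν 0} + {ν 6})} +
      {(.spider .Z (.on 0 ∅), {b} + {ν 5} + {ν 7})} + {(.hadamard, {ν 6} + {ν 7})} +
      {(.spider .X (.on Real.pi U), {ν 0} + {ν 1})} +
      {(.spider .Z (.on Real.pi U), {ν 5} + {ν 2})})
      ({(.spider .Z (.on 0 ∅), {a} + {ν 0} + {ν 6})} +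
        {(.spider .X (.on Real.pi U), {ν 0} + {ν 1})} +
        ({(.spider .Z (.on Real.pi U), {ν 7} + ({b} + {ν 2}))} +
        {(.hadamard, {ν 7} + {ν 6})})) := by
    have := reduces_fuse .Z Real.pi 0 U {ν 2} ({b} + {ν 7}) (ν 5)
    rw [Phase.on_zero, add_zero] at this
    refine (this.add_left ({(.spider .Z (.on 0 ∅), {a} + {ν 0} + {ν 6})} +
      {(.spider .X (.on Real.pi U), {ν 0} + {ν 1})} + {(.hadamard, {ν 6} + {ν 7})})).congr ?_ ?_
    · rw [add_right_comm ({b} : Multiset W) {ν 5}, add_comm ({ν 5} : Multiset W) {ν 2}]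
      abel
    · rw [add_comm ({ν 6} : Multiset W) {ν 7}, ← add_assoc ({ν 2} : Multiset W),
        add_comm ({ν 2} + {b} : Multiset W) {ν 7}, add_comm ({ν 2} : Multiset W) {b}]
      abel
  have hbn : ∀ n, n ∉ [1, 2] → ∀ b, Function.update (Function.update bd (.inr i) (ν 1)) (.inr j)
      (ν 2) b ≠ ν n := fun n hn =>
    update_ne_of_ne (fun h => hn (by simp [hν h])) (update_ne_of_ne
      (fun h => hn (by simp [hν h])) (hb _))
  rw [add_assoc] at h1
  rw [add_assoc, add_assoc, ← add_assoc _ {(Kind.spider .X _, _)} {(Kind.spider .Z _, _)}] at h2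
  -- The names `ν 6`, `ν 7`, `ν 8` belong to the wires of `crossing` that are absent from its left
  -- reduct.
  refine (((crossing_reduces_left U a b fun n => ν n).meet (crossing_reduces_right U a b _)
    h1.proper 0 ({ν 6} + {ν 7} + {ν 8}) ?_ ?_ ?_ ?_ ?_).trans
    (s1 _ _ _ h2.proper).symm).rewrites_of_described h1 h2
  · simp only [crossing, wires_add, wires_singleton, add_zero]
    simp only [Fin.isValue, Fin.coe_ofNat_eq_mod, Nat.reduceMod, Nat.zero_mod, Nat.one_mod]
    abel
  · simp [hν.eq_iff]
  · simp [hT, hν.eq_iff, Ne.symm (hb _ _), a, b]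
  · intro w hw
    simp only [Multiset.mem_add, Multiset.mem_singleton] at hw
    rcases hw with (rfl | rfl) | rfl <;> exact hbn _ (by simp)
  · simp [crossing]

end

end Words

end ZX

/-! ### Words of commands -/

namespace ZX

section Words

variable {V : Type}

/-- The correction of colour `c` on the qubit `i`, controlled by `s`. -/
def Command.corr (c : Colour) (i : V) (s : Option V) : Command V :=
  match c with
  | .Z => .Z i s
  | .X => .X i s

def Command.IsCorrection (x : Command V) : Prop := ∃ c i s, x = .corr c i s

theorem applyCommand_corr {A : Type} (D : Diagram V (A ⊕ V)) (c : Colour) (i : V) (s : Option V) :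
    applyCommand D (.corr c i s) = insertVertex c (.on Real.pi (signalSet s)) i D := by
  cases c <;> rfl

theorem Command.IsCorrection.ne {x : Command V} (h : x.IsCorrection) (i : V) : x ≠ .E i i := by
  obtain ⟨_ | _, j, s, rfl⟩ := h <;> simp [Command.corr]

/-- Two words of commands have the same effect on every diagram. -/
def WordEq (l l' : List (Command V)) : Prop :=
  ∀ (A : Type) [Finite A] (D : Diagram V (A ⊕ V)),
    Rewrites (l.foldl applyCommand D) (l'.foldl applyCommand D)

theorem WordEq.refl (l : List (Command V)) : WordEq l l := fun _ _ _ => .refl _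

theorem WordEq.symm {l l' : List (Command V)} (h : WordEq l l') : WordEq l' l :=
  fun _ _ D => (h _ D).symm

theorem WordEq.trans {l l' l'' : List (Command V)} (h : WordEq l l') (h' : WordEq l' l'') :
    WordEq l l'' :=
  fun _ _ D => (h _ D).trans (h' _ D)

theorem WordEq.append_left {l l' : List (Command V)} (h : WordEq l l') (m : List (Command V)) :
    WordEq (m ++ l) (m ++ l') := by
  intro A _ D
  rw [List.foldl_append, List.foldl_append]
  exact h _ _

theorem notMem_E_of_corrections {l : List (Command V)} (h : ∀ x ∈ l, x.IsCorrection) (i : V) :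
    .E i i ∉ l := fun hi => (h _ hi).ne i rfl

/-- The entangling commands of a list of pairs. -/
def entanglers (ps : List (V × V)) : List (Command V) := ps.map fun p => .E p.1 p.2

theorem notMem_entanglers {ps : List (V × V)} (h : ∀ p ∈ ps, p.1 ≠ p.2) (i : V) :
    .E i i ∉ entanglers ps := by
  simp only [entanglers, List.mem_map, Command.E.injEq, not_exists, not_and]
  rintro p hp rfl h'
  exact h p hp h'.symm

variable [Finite V]

theorem WordEq.append_right {l l' : List (Command V)} (h : WordEq l l') {m : List (Command V)}
    (hm : ∀ i, .E i i ∉ m) : WordEq (l ++ m) (l' ++ m) := by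
  intro A _ D
  rw [List.foldl_append, List.foldl_append]
  exact (h _ D).foldl hm

/-- Corrections of different colours on one qubit anticommute, and the sign is an ignored scalar; so
all corrections commute. -/
theorem correction_comm {x y : Command V} (hx : x.IsCorrection) (hy : y.IsCorrection) :
    WordEq [x, y] [y, x] := by
  obtain ⟨c, i, s, rfl⟩ := hx
  obtain ⟨c', j, t, rfl⟩ := hy
  intro A _ D
  simp only [List.foldl_cons, List.foldl_nil, applyCommand_corr]
  by_cases hij : i = j
  · subst hij
    rcases c with _ | _ <;> rcases c' with _ | _
    · exact insertVertex_comm_same _ _ _ _ D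
    · exact insertVertex_comm_pi .X _ _ _ D
    · exact insertVertex_comm_pi .Z _ _ _ D
    · exact insertVertex_comm_same _ _ _ _ D
  · exact insertVertex_comm_of_ne _ _ _ _ (Ne.symm hij) D

theorem correction_sq {x : Command V} (hx : x.IsCorrection) : WordEq [x, x] [] := by
  obtain ⟨c, i, s, rfl⟩ := hx
  intro A _ D
  simp only [List.foldl_cons, List.foldl_nil, applyCommand_corr]
  exact insertVertex_sq _ _ _ D

theorem WordEq.of_perm {l l' : List (Command V)} (h : l.Perm l') (hl : ∀ x ∈ l, x.IsCorrection) :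
    WordEq l l' := by
  induction h with
  | nil => exact .refl _
  | cons x h ih => exact (ih fun y hy => hl y (by simp [hy])).append_left [x]
  | swap x y l =>
    exact (correction_comm (hl y (by simp)) (hl x (by simp))).append_right (m := l)
      (notMem_E_of_corrections fun z hz => hl z (by simp [hz]))
  | trans h h' ih ih' => exact (ih hl).trans (ih' fun x hx => hl x (h.mem_iff.2 hx))

section Parity

open Classical

/-- A letter of even multiplicity that occurs has a second copy, which commutes next to the first
and cancels with it. -/
theorem WordEq.nil_of_even {l : List (Command V)} (hl : ∀ x ∈ l, x.IsCorrection)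
    (h : ∀ x, Even (l.count x)) : WordEq l [] := by
  induction hn : l.length using Nat.strong_induction_on generalizing l with
  | _ n ih =>
    rcases l with _ | ⟨x, t⟩
    · exact .refl _
    · have hx : x ∈ t := by
        have := h x
        rw [List.count_cons_self, Nat.even_add_one, Nat.not_even_iff_odd] at this
        exact List.count_pos_iff.1 this.pos
      have ht : ∀ y ∈ t.erase x, y.IsCorrection := fun y hy =>
        hl y (by simp [List.mem_of_mem_erase hy])
      have h1 : WordEq (x :: t) (x :: x :: t.erase x) :=
        .of_perm ((List.perm_cons_erase hx).cons x) hl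
      have h2 : WordEq ([x, x] ++ t.erase x) ([] ++ t.erase x) :=
        (correction_sq (hl x (by simp))).append_right (notMem_E_of_corrections ht)
      refine h1.trans (h2.trans (ih (t.erase x).length ?_ ht ?_ rfl))
      · have := List.length_erase_of_mem hx
        simp only [List.length_cons] at hn
        omega
      · intro y
        have h3 := h y
        rw [((List.perm_cons_erase hx).cons x).count_eq] at h3
        by_cases hy : x = y
        · subst hy
          rw [List.count_cons_self, List.count_cons_self] at h3
          simpa [Nat.even_add_one] using h3
        · rwa [List.count_cons_of_ne hy, List.count_cons_of_ne hy] at h3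

/-- Corrections generate an elementary abelian 2-group, so a word in them depends only on the
parities of its letters. The proof inserts `l' ++ l'` and cancels `l ++ l'`. -/
theorem WordEq.of_even {l l' : List (Command V)} (hl : ∀ x ∈ l, x.IsCorrection)
    (hl' : ∀ x ∈ l', x.IsCorrection) (h : ∀ x, Even (l.count x + l'.count x)) : WordEq l l' := by
  have h1 : WordEq (l ++ (l' ++ l')) (l ++ []) :=
    (WordEq.nil_of_even (by simpa using fun x hx => hl' x hx) fun x => by simp).append_left l
  have h2 : WordEq ((l ++ l') ++ l') ([] ++ l') :=
    (WordEq.nil_of_even (by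
      simpa [or_imp, forall_and] using ⟨hl, hl'⟩) fun x => by simpa using h x).append_right
        (notMem_E_of_corrections hl')
  rw [List.append_nil] at h1
  rw [List.append_assoc] at h2
  exact h1.symm.trans h2

/-- The qubits entangled with `q`. -/
noncomputable def partners (q : V) (ps : List (V × V)) : List V :=
  ps.flatMap fun p => if p.1 = q then [p.2] else if p.2 = q then [p.1] else []

theorem entangle_Z {i j : V} (hij : i ≠ j) (k : V) (s : Option V) :
    WordEq [.Z k s, .E i j] [.E i j, .Z k s] := by
  intro A _ D
  by_cases hi : k = i
  · subst hi
    exact entangle_insertVertex_Z _ _ hij D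
  · by_cases hj : k = j
    · subst hj
      have h := (entangle_symm hij (insertVertex .Z (.on Real.pi (signalSet s)) k D)).trans
        (entangle_insertVertex_Z Real.pi (signalSet s) hij.symm D)
      exact h.trans (Rewrites.applyCommand (c := .Z k s) (entangle_symm hij.symm D) (by simp))
    · exact entangle_insertVertex_of_ne _ _ hij hi hj D

theorem entangle_X {p : V × V} (hp : p.1 ≠ p.2) (k : V) (s : Option V) :
    WordEq [.X k s, .E p.1 p.2]
      ([.E p.1 p.2, .X k s] ++ (partners k [p]).map fun j => .Z j s) := by
  obtain ⟨i, j⟩ := p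
  intro A _ D
  by_cases hi : i = k
  · subst hi
    simp only [partners, List.flatMap_cons, List.flatMap_nil, if_true, List.append_nil]
    exact entangle_insertVertex_X (signalSet s) hp D
  · by_cases hj : j = k
    · subst hj
      have h := ((entangle_symm hp (insertVertex .X (.on Real.pi (signalSet s)) j D)).trans
        (entangle_insertVertex_X (signalSet s) (Ne.symm hp) D)).trans
        (Rewrites.applyCommand (c := .Z i s) (Rewrites.applyCommand (c := .X j s)
          (entangle_symm (Ne.symm hp) D) (by simp)) (by simp))
      simp only [partners, List.flatMap_cons, List.flatMap_nil, if_neg hi, if_true, List.append_nil]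
      exact h
    · simp only [partners, List.flatMap_cons, List.flatMap_nil, if_neg hi, if_neg hj,
        List.append_nil]
      exact entangle_insertVertex_of_ne .X (.on Real.pi (signalSet s)) hp
        (Ne.symm hi) (Ne.symm hj) D

theorem entanglers_Z {ps : List (V × V)} (hps : ∀ p ∈ ps, p.1 ≠ p.2) (zs : List (V × Option V)) :
    WordEq (zs.map (fun z => .Z z.1 z.2) ++ entanglers ps)
      (entanglers ps ++ zs.map fun z => .Z z.1 z.2) := by
  have h1 : ∀ z : V × Option V, ∀ ps : List (V × V), (∀ p ∈ ps, p.1 ≠ p.2) →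
      WordEq ([.Z z.1 z.2] ++ entanglers ps) (entanglers ps ++ [.Z z.1 z.2]) := by
    intro z ps hps
    induction ps with
    | nil => exact .refl _
    | cons p ps ih =>
      have hps' : ∀ p ∈ ps, p.1 ≠ p.2 := fun q hq => hps q (by simp [hq])
      exact ((entangle_Z (hps p (by simp)) z.1 z.2).append_right
        (notMem_entanglers hps')).trans ((ih hps').append_left [.E p.1 p.2])
  induction zs with
  | nil => simpa using .refl _
  | cons z zs ih =>
    have h2 := ih.append_left [.Z z.1 z.2]
    have h3 := (h1 z ps hps).append_right (m := zs.map fun z => .Z z.1 z.2) (by simp)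
    simp only [List.append_assoc] at h3
    exact (h2.trans h3)

/-- Every entangler at `k` leaves a `Z` on its other qubit, and that `Z` commutes with the remaining
entanglers. Hence one `Z` results for each edge at `k`. -/
theorem entanglers_X {ps : List (V × V)} (hps : ∀ p ∈ ps, p.1 ≠ p.2) (k : V) (s : Option V) :
    WordEq ([.X k s] ++ entanglers ps)
      (entanglers ps ++ ([.X k s] ++ (partners k ps).map fun j => .Z j s)) := by
  induction ps with
  | nil => exact .refl _
  | cons p ps ih =>
    have hps' : ∀ p ∈ ps, p.1 ≠ p.2 := fun q hq => hps q (by simp [hq])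
    have h1 := (entangle_X (hps p (by simp)) k s).append_right (notMem_entanglers hps')
    have h2 := (entanglers_Z hps' ((partners k [p]).map fun j => (j, s))).append_left
      [.E p.1 p.2, .X k s]
    have h3 := ((ih hps').append_right (m := (partners k [p]).map fun j => .Z j s)
      (by simp)).append_left [.E p.1 p.2]
    simp only [List.map_map, Function.comp_def] at h2
    simp only [List.append_assoc] at h1 h2 h3
    have h4 : WordEq (entanglers (p :: ps) ++ ([.X k s] ++ ((partners k ps).map (fun j => .Z j s) ++
        (partners k [p]).map fun j => .Z j s))) (entanglers (p :: ps) ++ ([.X k s] ++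
        (partners k (p :: ps)).map fun j => .Z j s)) := by
      refine ((WordEq.of_perm ?_ ?_).append_left [.X k s]).append_left _
      · rw [← List.map_append]
        refine List.Perm.map _ (List.perm_append_comm.trans (.of_eq ?_))
        simp [partners]
      · simp only [List.mem_append, List.mem_map]
        rintro x (⟨j, -, rfl⟩ | ⟨j, -, rfl⟩) <;> exact ⟨.Z, j, s, rfl⟩
    exact h1.trans (h2.trans (h3.trans h4))

theorem entanglers_Xs {ps : List (V × V)} (hps : ∀ p ∈ ps, p.1 ≠ p.2) (xs : List (V × Option V)) :
    WordEq (xs.map (fun x => .X x.1 x.2) ++ entanglers ps)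
      (entanglers ps ++ xs.flatMap fun x => .X x.1 x.2 :: (partners x.1 ps).map fun j => .Z j x.2) := by
  induction xs with
  | nil => simpa using .refl _
  | cons x xs ih =>
    have h2 := ih.append_left [.X x.1 x.2]
    have h3 := (entanglers_X hps x.1 x.2).append_right
      (m := xs.flatMap fun x => .X x.1 x.2 :: (partners x.1 ps).map fun j => .Z j x.2) (by simp)
    simp only [List.append_assoc] at h3
    exact h2.trans h3

omit [Finite V] in
theorem count_partners {ps : List (V × V)} (hps : ∀ p ∈ ps, p.1 ≠ p.2) {q j : V} :
    (partners q ps).count j = (ps.map fun p => s(p.1, p.2)).count s(q, j) := by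
  induction ps with
  | nil => simp [partners]
  | cons p ps ih =>
    have := ih fun r hr => hps r (by simp [hr])
    have hp := hps p (by simp)
    rw [List.map_cons, List.count_cons, ← this, partners, List.flatMap_cons, List.count_append,
      add_comm]
    congr 1
    obtain ⟨a, b⟩ := p
    by_cases ha : a = q
    · subst ha
      have : ¬(a = j ∧ b = a) := fun h => hp h.2.symm
      simp [List.count_cons, this]
    · by_cases hb : b = q
      · subst hb
        simp only [if_neg ha, if_true, List.count_cons, List.count_nil, zero_add]
        simp [ha]
      · simp [ha, hb]

end Parity

end Words

end ZX

/-! ### Cancellation of the controlled corrections -/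

namespace ZX

section Normal

open Classical

variable {V : Type}

theorem foldl_eq_self {A : Type} {l : List (Command V)} (D : Diagram V (A ⊕ V))
    (h : ∀ c ∈ l, c.IsInit) : l.foldl applyCommand D = D := by
  induction l generalizing D with
  | nil => rfl
  | cons c l ih =>
    have hc := h c (by simp)
    cases c <;> simp only [Command.IsInit] at hc
    exact ih D fun c hc => h c (by simp [hc])

theorem foldl_filter_corrections {A : Type} {l : List (Command V)} (D : Diagram V (A ⊕ V))
    (h : ∀ c ∈ l, ¬ c.IsInit ∧ ¬ c.IsEntangle) :
    (l.filter fun c => c.IsCorrection).foldl applyCommand D = l.foldl applyCommand D := by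
  induction l generalizing D with
  | nil => rfl
  | cons c l ih =>
    have hc := h c (by simp)
    have ih := fun D => ih D fun c hc => h c (by simp [hc])
    by_cases hcor : c.IsCorrection
    · rw [List.filter_cons_of_pos (by simpa using hcor)]
      exact ih _
    · rw [List.filter_cons_of_neg (by simpa using hcor)]
      cases c with
      | N i => exact absurd trivial hc.1
      | E i j => exact absurd trivial hc.2
      | M i α => exact ih D
      | X i s => exact absurd ⟨.X, i, s, rfl⟩ hcor
      | Z i s => exact absurd ⟨.Z, i, s, rfl⟩ hcor

theorem exists_eq_entanglers {l : List (Command V)} (h : ∀ c ∈ l, c.IsEntangle) :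
    ∃ ps, l = entanglers ps := by
  induction l with
  | nil => exact ⟨[], rfl⟩
  | cons c l ih =>
    obtain ⟨ps, rfl⟩ := ih fun c hc => h c (by simp [hc])
    have hc := h c (by simp)
    cases c <;> simp only [Command.IsEntangle] at hc
    exact ⟨(_, _) :: ps, rfl⟩

variable [Finite V]

theorem initDiagram_described (I : Set V) :
    (initDiagram I).Described (fam fun q : {q // q ∉ I} => (.spider .Z (.on 0 ∅), {q.1}))
      (Sum.elim (fun q : I => q.1) id) := by
  have key : ∀ link : {q // q ∉ I} ⊕ (I ⊕ V) → {q // q ∉ I} ⊕ (I ⊕ V),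
      (∀ q, link (.inl q) = .inr (.inr q.1)) → (∀ q, link (.inr (.inl q)) = .inr (.inr q.1)) →
      (∀ q, link (.inr (.inr q)) = if h : q ∈ I then .inr (.inl ⟨q, h⟩) else .inl ⟨q, h⟩) →
      ∀ x y, (Sum.elim (fun q => q.1) (Sum.elim (fun q : I => q.1) id) x : V) =
        Sum.elim (fun q => q.1) (Sum.elim (fun q : I => q.1) id) y ↔ y = x ∨ y = link x := by
    intro link h1 h2 h3 x y
    have hn : ∀ (a : {q // q ∉ I}) (b : I), a.1 ≠ b.1 := fun a b h => a.2 (h ▸ b.2)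
    rcases x with x | x | x
    · rw [h1]
      rcases y with y | y | y <;> simp [hn, Subtype.ext_iff, eq_comm]
    · rw [h2]
      rcases y with y | y | y <;> simp [(hn _ _).symm, Subtype.ext_iff, eq_comm]
    · rw [h3]
      by_cases hx : x ∈ I
      · have := fun a : {q // q ∉ I} => hn a ⟨x, hx⟩
        rcases y with y | y | y <;> simp [hx, (this _).symm, Subtype.ext_iff, eq_comm]
      · have := fun a : I => hn ⟨x, hx⟩ a
        rcases y with y | y | y <;> simp [hx, this, Subtype.ext_iff, eq_comm]
  refine ⟨fun q : {q // q ∉ I} => q.1, key _ (fun _ => rfl) (fun _ => rfl) (fun _ => rfl), ?_⟩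
  change fam (fun n : {q // q ∉ I} => (Kind.spider Colour.Z (.on 0 ∅),
    fib (id : {q // q ∉ I} → _) (fun q => q.1) n)) = _
  congr 1
  funext n
  refine Prod.ext rfl ?_
  exact fib_of_unique (node := id) (p := n) (fun _ => Iff.rfl) _

/-- A `Z` vertex of degree one with angle zero is invariant under the `X` correction: this is the
$\pi$-commute rule without other legs. As $-0=0$, its side condition holds for every `U`. -/
theorem initDiagram_absorbs (I : Set V) (U : Set V) {q : V} (hq : q ∉ I) :
    Rewrites (insertVertex .X (.on Real.pi U) q (initDiagram I)) (initDiagram I) := by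
  have h := initDiagram_described I
  obtain ⟨R, hR⟩ := Multiset.exists_cons_of_mem ((mem_fam (fun q : {q // q ∉ I} =>
    ((.spider .Z (.on 0 ∅) : Kind V), ({q.1} : Multiset V))) _).2 ⟨⟨q, hq⟩, rfl⟩)
  rw [hR] at h
  have hqR : q ∉ wires R := by
    intro hm
    have h1 := h.proper.count_eq q
    have h2 := Multiset.count_pos.2 hm
    have h3 : 0 < (fam (Sum.elim (fun q : I => q.1) id : I ⊕ V → V)).count q :=
      Multiset.count_pos.2 ((mem_fam _ _).2 ⟨.inr q, rfl⟩)
    rw [wires_cons, Multiset.count_add, Multiset.count_add,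
      show Multiset.count q _ = 1 from Multiset.count_singleton_self q] at h1
    omega
  -- Inserting the vertex makes `none` the output wire of `q`. In the other diagram the wire of `q`
  -- is itself called `none`, so that the boundary names agree.
  set g : V → Option V := fun v => if v = q then none else some v with hg
  have hginj : Function.Injective g := by
    intro a b hab
    by_cases ha : a = q <;> by_cases hb : b = q <;> simp_all
  have h1 := (h.rename (Option.some_injective V)).insertVertex .X (.on Real.pi U) q (w := none)
    (by simp) (by simp)
  have h2 := h.rename hginj
  have hbd : ∀ _ : DecidableEq (I ⊕ V), Function.update (fun b => some ((Sum.elim (fun q : I => q.1) id : I ⊕ V → V) b))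
      (.inr q) none = fun b => g ((Sum.elim (fun q : I => q.1) id : I ⊕ V → V) b) := by
    intro _
    funext b
    by_cases hb : b = .inr q
    · subst hb
      simp [hg]
    · rw [Function.update_of_ne hb]
      rcases b with b | b
      · have : b.1 ≠ q := fun h => hq (h ▸ b.2)
        simp [hg, this]
      · have : b ≠ q := fun h => hb (by rw [h])
        simp [hg, this]
  have hren : rename g R = rename some R :=
    rename_congr fun w hw => if_neg fun h : w = q => hqR (h ▸ hw)
  rw [hbd] at h1
  rw [← Multiset.singleton_add, rename_add, rename_singleton, Multiset.map_singleton] at h1 h2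
  rw [hren, add_comm, show g q = none from if_pos rfl] at h2
  rw [add_comm {_}, add_assoc, Sum.elim_inr, id_eq, add_comm {some q}] at h1
  have h3 := reduces_piCommute_end .Z 0 U ∅ (.inr (.inr neg_zero)) none (some q) _ _ _ h1.proper
  rw [neg_zero] at h3
  exact h3.rewrites_of_described h1 h2

theorem foldl_X_initDiagram (I : Set V) (xs : List (V × Option V)) (h : ∀ x ∈ xs, x.1 ∉ I) :
    Rewrites ((xs.map fun x => Command.X x.1 x.2).foldl applyCommand (initDiagram I))
      (initDiagram I) := by
  induction xs with
  | nil => exact .refl _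
  | cons x xs ih =>
    exact ((initDiagram_absorbs I (signalSet x.2) (h x (by simp))).foldl (by simp)).trans
      (ih fun y hy => h y (by simp [hy]))

theorem count_flatMap_of_unique {α β : Type} {l : List α} (hl : l.Nodup) {g : α → List β} {x : β}
    {i : α} (h : ∀ j, j ≠ i → x ∉ g j) :
    (l.flatMap g).count x = if i ∈ l then (g i).count x else 0 := by
  induction l with
  | nil => simp
  | cons j l ih =>
    rw [List.flatMap_cons, List.count_append, ih hl.of_cons]
    by_cases hj : j = i
    · subst hj
      simp [(List.nodup_cons.1 hl).1]
    · rw [List.count_eq_zero_of_not_mem (h j hj)]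
      simp [Ne.symm hj]

theorem count_eq_ite_mem {α : Type} {l : List α} {x : α} (h : ¬ List.Duplicate x l) :
    l.count x = if x ∈ l then 1 else 0 := by
  by_cases hx : x ∈ l
  · rw [if_pos hx]
    have h1 := List.count_pos_iff.2 hx
    have h2 : ¬ 2 ≤ l.count x := fun h' => h (List.duplicate_iff_two_le_count.2 h')
    omega
  · rw [if_neg hx, List.count_eq_zero_of_not_mem hx]

/-- The corrections to which those of a pattern with flow are equivalent. -/
def normalCorrections (zl xl ms : List V) : List (Command V) :=
  zl.map (fun q => .Z q none) ++ (xl.map (fun q => .X q none) ++ ms.map fun q => .Z q (some q))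

/-- The hypotheses say that, modulo 2, the controlled letters are exactly $Z^i_i$ for `i` in `ms`.
Nothing is assumed of the unconditional ones; `p` and `p'` record their parities. -/
theorem exists_wordEq_normalCorrections {l : List (Command V)} {vs ms : List V}
    (hvs : vs.Nodup) (hvs' : ∀ v, v ∈ vs) (hl : ∀ x ∈ l, x.IsCorrection)
    (hX : ∀ i j, Even (l.count (.X j (some i))))
    (hZ : ∀ i j, Even (l.count (.Z j (some i)) + ms.count i * if j = i then 1 else 0)) :
    ∃ p p' : V → Prop, WordEq l (normalCorrections (vs.filter p) (vs.filter p') ms) := by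
  refine ⟨fun q => Odd (l.count (.Z q none)), fun q => Odd (l.count (.X q none)),
    .of_even hl ?_ ?_⟩
  · intro x hx
    simp only [normalCorrections, List.mem_append, List.mem_map] at hx
    rcases hx with ⟨q, -, rfl⟩ | ⟨q, -, rfl⟩ | ⟨q, -, rfl⟩
    exacts [⟨.Z, q, _, rfl⟩, ⟨.X, q, _, rfl⟩, ⟨.Z, q, _, rfl⟩]
  · intro x
    have hz : Function.Injective fun q : V => Command.Z q none := fun a b h => by simpa using h
    have hx : Function.Injective fun q : V => Command.X q none := fun a b h => by simpa using h
    have hzz : Function.Injective fun q : V => Command.Z q (some q) := fun a b h => by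
      simpa using h
    simp only [normalCorrections, List.count_append]
    have h0 : ∀ (l : List V) (g : V → Command V), (∀ q, g q ≠ x) → (l.map g).count x = 0 :=
      fun l g h => List.count_eq_zero_of_not_mem (by simpa using fun q _ => h q)
    cases x with
    | N i =>
      rw [List.count_eq_zero_of_not_mem fun h => by
        obtain ⟨_ | _, _, _, h⟩ := hl _ h <;> simp [Command.corr] at h]
      simp [h0]
    | E i j =>
      rw [List.count_eq_zero_of_not_mem fun h => by
        obtain ⟨_ | _, _, _, h⟩ := hl _ h <;> simp [Command.corr] at h]
      simp [h0]
    | M i α =>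
      rw [List.count_eq_zero_of_not_mem fun h => by
        obtain ⟨_ | _, _, _, h⟩ := hl _ h <;> simp [Command.corr] at h]
      simp [h0]
    | X i s =>
      cases s with
      | none =>
        rw [h0 _ (fun q => .Z q none) (by simp), h0 _ (fun q => .Z q (some q)) (by simp),
          List.count_map_of_injective _ _ hx i, (hvs.filter _).count]
        by_cases hi : Odd (l.count (.X i none))
        · rw [if_pos (List.mem_filter.2 ⟨hvs' i, by simpa only [decide_eq_true_eq] using hi⟩)]
          exact hi.add_odd ⟨0, rfl⟩
        · rw [if_neg fun h => hi (by simpa only [decide_eq_true_eq] using (List.mem_filter.1 h).2)]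
          exact (Nat.not_odd_iff_even.1 hi).add ⟨0, rfl⟩
      | some t =>
        rw [h0 _ (fun q => .Z q none) (by simp), h0 _ (fun q => .Z q (some q)) (by simp),
          h0 _ (fun q => .X q none) (by simp)]
        simpa using hX t i
    | Z i s =>
      cases s with
      | none =>
        rw [h0 _ (fun q => .X q none) (by simp),
          h0 _ (fun q => .Z q (some q)) (by simp), List.count_map_of_injective _ _ hz i,
          (hvs.filter _).count]
        by_cases hi : Odd (l.count (.Z i none))
        · rw [if_pos (List.mem_filter.2 ⟨hvs' i, by simpa only [decide_eq_true_eq] using hi⟩)]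
          exact hi.add_odd ⟨0, rfl⟩
        · rw [if_neg fun h => hi (by simpa only [decide_eq_true_eq] using (List.mem_filter.1 h).2)]
          exact (Nat.not_odd_iff_even.1 hi).add ⟨0, rfl⟩
      | some t =>
        rw [h0 _ (fun q => .X q none) (by simp),
          h0 _ (fun q => .Z q none) (by simp)]
        by_cases hit : i = t
        · subst hit
          rw [List.count_map_of_injective _ _ hzz i]
          simpa using hZ i i
        · rw [h0 _ (fun q => .Z q (some q)) (by
            rintro q h
            simp only [Command.Z.injEq, Option.some.injEq] at h
            exact hit (h.1 ▸ h.2))]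
          simpa [hit] using hZ t i

/-- $X^i_{f(i)}$ is inserted at the beginning for each measured `i` and moved past the entanglers.
The result agrees with the controlled corrections of the pattern except for $Z^i_i$, so the combined
word has odd controlled multiplicity only there. -/
theorem Pattern.exists_rewrites_normal (P : Pattern V) (F : P.geometry.Flow)
    (hP : P.HasFlowCorrectors F) {vs : List V} (hvs : vs.Nodup) (hvs' : ∀ v, v ∈ vs) :
    ∃ (ps : List (V × V)) (p p' : V → Prop), (∀ p ∈ ps, p.1 ≠ p.2) ∧
      (ps.map fun p => s(p.1, p.2)).Nodup ∧
      (∀ u v, P.geometry.graph.Adj u v ↔ s(u, v) ∈ ps.map fun p => s(p.1, p.2)) ∧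
      Rewrites (P.cmds.foldl applyCommand (initDiagram P.inputs))
        ((entanglers ps ++ normalCorrections (vs.filter p) (vs.filter p')
          (vs.filter fun q => P.Measured q)).foldl applyCommand (initDiagram P.inputs)) := by
  obtain ⟨l₁, l₂, l₃, hcmds, hl₁, hl₂, hl₃⟩ := P.standard
  obtain ⟨ps, rfl⟩ := exists_eq_entanglers hl₂
  have hE : ∀ i j, .E i j ∈ P.cmds ↔ (i, j) ∈ ps := by
    intro i j
    rw [hcmds]
    simp only [List.mem_append, entanglers, List.mem_map, Command.E.injEq]
    constructor
    · rintro ((h | ⟨p, hp, rfl, rfl⟩) | h)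
      · exact absurd (hl₁ _ h) (by simp [Command.IsInit])
      · exact hp
      · exact absurd trivial (hl₃ _ h).2
    · exact fun h => .inl (.inr ⟨_, h, rfl, rfl⟩)
  have hps : ∀ p ∈ ps, p.1 ≠ p.2 := by
    rintro ⟨i, j⟩ hp (h : i = j)
    exact P.entangle_ne i ((hE i i).2 (h ▸ hp))
  -- No edge is listed twice, not even with its ends exchanged.
  have hnd : (ps.map fun p => s(p.1, p.2)).Nodup := by
    have key : ∀ ps₁ ps₂, ps = ps₁ ++ ps₂ → (ps₂.map fun p => s(p.1, p.2)).Nodup := by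
      intro ps₁ ps₂ h
      induction ps₂ generalizing ps₁ with
      | nil => simp
      | cons p ps₂ ih =>
        rw [List.map_cons, List.nodup_cons]
        refine ⟨fun hm => ?_, ih (ps₁ ++ [p]) (by simpa using h)⟩
        obtain ⟨q, hq, hqp⟩ := List.mem_map.1 hm
        have := P.entangle_once (l₁ ++ entanglers ps₁) (entanglers ps₂ ++ l₃) p.1 p.2
          (by rw [hcmds, h]; simp [entanglers])
        rcases Sym2.eq_iff.1 hqp with ⟨h1, h2⟩ | ⟨h1, h2⟩
        · exact this.1 (List.mem_append_left _ (List.mem_map.2 ⟨q, hq, by rw [h1, h2]⟩))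
        · exact this.2 (List.mem_append_left _ (List.mem_map.2 ⟨q, hq, by rw [h1, h2]⟩))
    exact key [] ps rfl
  have hadj : ∀ u v, P.geometry.graph.Adj u v ↔ s(u, v) ∈ ps.map fun p => s(p.1, p.2) := by
    intro u v
    change (u ≠ v ∧ (_ ∈ P.cmds ∨ _ ∈ P.cmds)) ↔ _
    rw [hE, hE, List.mem_map]
    constructor
    · rintro ⟨-, h | h⟩
      · exact ⟨_, h, rfl⟩
      · exact ⟨_, h, Sym2.eq_swap⟩
    · rintro ⟨⟨a, b⟩, hp, h⟩
      have hne := hps _ hp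
      rcases Sym2.eq_iff.1 h with ⟨rfl, rfl⟩ | ⟨rfl, rfl⟩
      · exact ⟨hne, .inl hp⟩
      · exact ⟨Ne.symm hne, .inr hp⟩
  set ms := vs.filter fun q => P.Measured q with hms
  have hmem : ∀ i, i ∈ ms ↔ i ∉ P.geometry.outputs := by
    intro i
    simp [hms, hvs', Pattern.geometry, Pattern.outputs]
  have hmsnd : ms.Nodup := hvs.filter _
  set f : V → V := fun i => if h : i ∉ P.geometry.outputs then (F.f ⟨i, h⟩).1 else i with hf
  have hf' : ∀ i (h : i ∉ P.geometry.outputs), f i = (F.f ⟨i, h⟩).1 := fun i h => dif_pos h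
  set xs : List (V × Option V) := ms.map fun i => (f i, some i) with hxs
  set cor := l₃.filter fun c => c.IsCorrection with hcor
  -- What the inserted `X` corrections have become behind the entanglers.
  set mid := xs.flatMap fun x => Command.X x.1 x.2 :: (partners x.1 ps).map fun j => Command.Z j x.2 with hmid
  have hmid' : mid = ms.flatMap fun i => Command.X (f i) (some i) ::
      (partners (f i) ps).map fun j => Command.Z j (some i) := by
    rw [hmid, hxs, List.flatMap_map]
  have hcorc : ∀ c ∈ cor, c.IsCorrection := fun c hc => by simpa using (List.mem_filter.1 hc).2
  have hmidc : ∀ c ∈ mid, c.IsCorrection := by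
    intro c hc
    rw [hmid'] at hc
    obtain ⟨i, -, hc⟩ := List.mem_flatMap.1 hc
    rcases List.mem_cons.1 hc with rfl | hc
    · exact ⟨.X, _, _, rfl⟩
    · obtain ⟨j, -, rfl⟩ := List.mem_map.1 hc
      exact ⟨.Z, _, _, rfl⟩
  have hcount : ∀ c : Command V, c.IsCorrection → cor.count c = P.cmds.count c := by
    intro c hc
    rw [hcor, List.count_filter (by simpa using hc), hcmds, List.count_append, List.count_append,
      List.count_eq_zero_of_not_mem (l := l₁), List.count_eq_zero_of_not_mem (l := entanglers ps),
      zero_add, zero_add]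
    · intro h
      obtain ⟨p, -, hp⟩ := List.mem_map.1 h
      obtain ⟨_ | _, _, _, rfl⟩ := hc <;> simp [Command.corr] at hp
    · intro h
      have := hl₁ _ h
      obtain ⟨_ | _, _, _, rfl⟩ := hc <;> simp [Command.corr, Command.IsInit] at this
  obtain ⟨p₁, p₂, hword⟩ := exists_wordEq_normalCorrections (l := mid ++ cor) (ms := ms) hvs hvs'
    (by simpa [or_imp, forall_and] using ⟨hmidc, hcorc⟩) (by
      intro i j
      rw [List.count_append, hcount (.X j (some i)) ⟨.X, j, some i, rfl⟩, count_eq_ite_mem (hP.once_X i j), hmid',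
        count_flatMap_of_unique hmsnd (i := i) (by
          intro k hk
          simp [Ne.symm hk]), List.count_cons, List.count_eq_zero_of_not_mem (by simp), zero_add]
      by_cases hi : i ∈ ms
      · have hi' := (hmem i).1 hi
        have hX : Command.X j (some i) ∈ P.cmds ↔ f i = j := by
          rw [hf' i hi']
          exact ⟨fun h => (hP.only_X i j h).2.symm, fun h => h ▸ hP.mem_X ⟨i, hi'⟩⟩
        by_cases hj : f i = j <;> simp [hi, hX, hj]
      · have hX : Command.X j (some i) ∉ P.cmds := fun h => hi ((hmem i).2 (hP.only_X i j h).1)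
        simp [hi, hX]) (by
      intro i j
      have hinj : Function.Injective fun j => Command.Z j (some i) := fun a b h => by
        simpa using h
      rw [List.count_append, hcount (.Z j (some i)) ⟨.Z, j, some i, rfl⟩, count_eq_ite_mem (hP.once_Z i j), hmid',
        count_flatMap_of_unique hmsnd (i := i) (by
          intro k hk
          simp [hk]), List.count_cons_of_ne (by simp),
        List.count_map_of_injective _ _ hinj j, count_partners hps,
        List.Nodup.count hnd, List.Nodup.count hmsnd]
      by_cases hi : i ∈ ms
      · have hi' := (hmem i).1 hi
        -- The exceptional letter: $i$ is a neighbour of $f(i)$, so $Z^i_i$ occurs in `mid`, but it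
        -- is not a corrector of the pattern. It pairs with the summand for `ms`.
        by_cases hji : j = i
        · subst hji
          have h1 : s(f j, j) ∈ ps.map fun p => s(p.1, p.2) := by
            rw [← hadj, hf' j hi']
            exact F.adj ⟨j, hi'⟩
          have h2 : Command.Z j (some j) ∉ P.cmds := fun h => (hP.only_Z j j h).2.1 rfl
          rw [if_pos hi, if_pos h1, if_neg h2, if_pos hi, if_pos rfl]
          exact ⟨1, rfl⟩
        · have hZ : Command.Z j (some i) ∈ P.cmds ↔ s(f i, j) ∈ ps.map fun p => s(p.1, p.2) := by
            rw [← hadj, hf' i hi']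
            exact ⟨fun h => (hP.only_Z i j h).2.2, fun h => hP.mem_Z ⟨i, hi'⟩ j hji h⟩
          rw [if_pos hi, if_neg hji, mul_zero, add_zero]
          by_cases h : s(f i, j) ∈ ps.map fun p => s(p.1, p.2)
          · rw [if_pos h, if_pos (hZ.2 h)]
            exact ⟨1, rfl⟩
          · rw [if_neg h, if_neg (mt hZ.1 h)]
            exact ⟨0, rfl⟩
      · have hZ : Command.Z j (some i) ∉ P.cmds := fun h => hi ((hmem i).2 (hP.only_Z i j h).1)
        simp [hi, hZ])
  refine ⟨ps, p₁, p₂, hps, hnd, hadj, ?_⟩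
  have hwords : WordEq (xs.map (fun x => Command.X x.1 x.2) ++ (entanglers ps ++ cor))
      (entanglers ps ++ normalCorrections (vs.filter p₁) (vs.filter p₂) ms) := by
    have h1 := (entanglers_Xs hps xs).append_right (m := cor) (notMem_E_of_corrections hcorc)
    rw [List.append_assoc, List.append_assoc] at h1
    exact h1.trans (hword.append_left _)
  -- No `f i` is an input, so the inserted corrections are absorbed by the initialisations.
  have hstart := (foldl_X_initDiagram P.inputs xs (by
    intro x hx
    obtain ⟨i, hi, rfl⟩ := List.mem_map.1 hx
    change f i ∉ _
    rw [hf' i ((hmem i).1 hi)]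
    exact (F.f _).2)).foldl (l := entanglers ps ++ cor) (fun i hi => by
      rcases List.mem_append.1 hi with hi | hi
      · exact notMem_entanglers hps i hi
      · exact notMem_E_of_corrections hcorc i hi)
  have hcm : P.cmds.foldl applyCommand (initDiagram P.inputs) =
      (entanglers ps ++ cor).foldl applyCommand (initDiagram P.inputs) := by
    rw [hcmds, List.foldl_append, List.foldl_append, foldl_eq_self _ hl₁, List.foldl_append, hcor,
      foldl_filter_corrections _ hl₃]
  have h2 := hwords _ (initDiagram P.inputs)
  rw [List.foldl_append] at h2
  rw [hcm]
  exact hstart.symm.trans h2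

end Normal

end ZX

/-! ### Layers of vertices on all output wires -/

namespace ZX

section Layers

open Classical

variable {V A W : Type}

/-- Inserting a vertex into each output wire of a list. -/
noncomputable def layer (c : Colour) (φ : V → Phase V) (l : List V) (D : Diagram V (A ⊕ V)) :
    Diagram V (A ⊕ V) :=
  l.foldl (fun D q => insertVertex c (φ q) q D) D

theorem Diagram.Described.layer {D : Diagram V (A ⊕ V)} {T : Multiset (Kind V × Multiset W)}
    {bd : A ⊕ V → W} (h : D.Described T bd) (c : Colour) (φ : V → Phase V) {l : List V}
    (hl : l.Nodup) {x : V → W} (hx : Function.Injective x) (hT : ∀ q ∈ l, x q ∉ wires T)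
    (hb : ∀ q ∈ l, ∀ b, bd b ≠ x q) :
    (layer c φ l D).Described
      (T + (l : Multiset V).map fun q => (.spider c (φ q), {bd (.inr q)} + {x q}))
      (Sum.elim (fun a => bd (.inl a)) fun q => if q ∈ l then x q else bd (.inr q)) := by
  induction l generalizing D T bd with
  | nil =>
    have : Sum.elim (fun a => bd (.inl a)) (fun q => bd (.inr q)) = bd := by
      funext b
      rcases b with b | b <;> rfl
    change D.Described _ _
    simpa [this] using h
  | cons q l ih =>
    obtain ⟨hq, hl⟩ := List.nodup_cons.1 hl
    have hne : ∀ r ∈ l, x q ≠ x r := fun r hr h => hq (hx h ▸ hr)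
    have h1 := h.insertVertex c (φ q) q (hT q (by simp)) (hb q (by simp))
    have h2 := ih h1 hl (by
      intro r hr
      simp only [wires_add, wires_singleton, Multiset.mem_add, Multiset.mem_singleton, not_or]
      exact ⟨hT r (by simp [hr]), Ne.symm (hb r (by simp [hr]) _), (hne r hr).symm⟩)
      fun r hr => update_ne_of_ne (hne r hr) (hb r (by simp [hr]))
    refine (congrArg₂ (Diagram.Described _) ?_ ?_).mp h2
    · rw [← Multiset.cons_coe, Multiset.map_cons, ← Multiset.singleton_add, ← add_assoc]
      congr 1
      refine Multiset.map_congr rfl fun r hr => ?_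
      have : (Sum.inr r : A ⊕ V) ≠ .inr q := fun h => hq (Sum.inr_injective h ▸ hr)
      rw [Function.update_of_ne this]
    · funext b
      rcases b with b | r
      · simp
      · by_cases hr : r ∈ l
        · simp [hr]
        · by_cases hrq : r = q
          · subst hrq
            simp [hr]
          · simp [hr, hrq]

theorem Diagram.Described.layer_univ [Fintype V] {D : Diagram V (A ⊕ V)}
    {T : Multiset (Kind V × Multiset W)} {bd : A ⊕ V → W} (h : D.Described T bd) (c : Colour)
    (φ : V → Phase V) {l : List V} (hl : l.Nodup) (hl' : ∀ q, q ∈ l) {x : V → W}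
    (hx : Function.Injective x) (hT : ∀ q, x q ∉ wires T) (hb : ∀ q b, bd b ≠ x q) :
    (ZX.layer c φ l D).Described (T + ∑ q, {(.spider c (φ q), {bd (.inr q)} + {x q})})
      (Sum.elim (fun a => bd (.inl a)) x) := by
  have h1 := h.layer c φ hl hx (fun q _ => hT q) (fun q _ => hb q)
  refine (congrArg₂ (Diagram.Described _) ?_ ?_).mp h1
  · congr 1
    have hu : (l : Multiset V) = Finset.univ.val := (Multiset.Nodup.ext (Multiset.coe_nodup.2 hl)
      Finset.univ.nodup).2 fun q => by simp [hl']
    rw [hu, ← fam_eq_map, fam_eq_sum]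
  · simp [hl']

theorem fam_subtype {ι α : Type} [Fintype ι] (p : ι → Prop) (g : ι → α) :
    (fam fun q : {q // p q} => g q) = ∑ q, if p q then {g q} else 0 := by
  rw [fam_eq_sum, ← Finset.sum_filter]
  exact (Finset.sum_subtype _ (by simp) fun q => ({g q} : Multiset α)).symm

theorem rename_fam {ι 𝒱 W' : Type} [Finite ι] (g : W → W') (f : ι → Kind 𝒱 × Multiset W) :
    rename g (fam f) = fam fun i => ((f i).1, (f i).2.map g) :=
  map_fam _ f

variable [Finite V] [Finite A]

theorem Rewrites.insertVertex {D D' : Diagram V (A ⊕ V)} (h : Rewrites D D') (c : Colour)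
    (φ : Phase V) (i : V) : Rewrites (insertVertex c φ i D) (ZX.insertVertex c φ i D') :=
  (extends_insertVertex c φ i).rewrites h

theorem Rewrites.layer {D D' : Diagram V (A ⊕ V)} (h : Rewrites D D') (c : Colour)
    (φ : V → Phase V) (l : List V) : Rewrites (layer c φ l D) (ZX.layer c φ l D') := by
  induction l generalizing D D' with
  | nil => exact h
  | cons q l ih => exact ih (h.insertVertex c (φ q) q)

-- Trivial vertices on all wires allow terms to be written as uniform sums over qubits.
omit [Finite V] [Finite A] in
theorem rewrites_layer_zero (c : Colour) (l : List V) (D : Diagram V (A ⊕ V)) :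
    Rewrites D (layer c (fun _ => .on 0 ∅) l D) := by
  induction l generalizing D with
  | nil => exact .refl _
  | cons q l ih =>
    have h1 : Rewrites (insertVertex c (.on 0 ∅) q D) D := .rel _ _ (.identity D _ c)
    exact h1.symm.trans (ih _)

/-- Corrections on a subset of the qubits become a layer on all of them, with angle $\pi$ on the
subset and $0$ elsewhere. -/
theorem foldl_filter_rewrites_layer (c : Colour) (p : V → Prop) (s : V → Option V) (l : List V)
    (D : Diagram V (A ⊕ V)) :
    Rewrites (((l.filter p).map fun q => Command.corr c q (s q)).foldl applyCommand D)
      (layer c (fun q => .on (if p q then Real.pi else 0) (signalSet (s q))) l D) := by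
  induction l generalizing D with
  | nil => exact .refl _
  | cons q l ih =>
    by_cases hp : p q
    · rw [List.filter_cons_of_pos (by simpa using hp), List.map_cons, List.foldl_cons,
        applyCommand_corr]
      refine (ih _).trans ?_
      rw [ZX.layer, ZX.layer, List.foldl_cons, if_pos hp]
      exact .refl _
    · rw [List.filter_cons_of_neg (by simpa using hp)]
      have h1 : Rewrites (insertVertex c (.on 0 ∅) q D) D := .rel _ _ (.identity D _ c)
      refine (ih _).trans ?_
      rw [ZX.layer, ZX.layer, List.foldl_cons, if_neg hp, Phase.on_zero]
      exact h1.symm.layer c _ l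

end Layers

/-! ### The graph state -/

section Graph

open Classical

variable {V : Type}

/-- Names of wires: families indexed by one vertex, two vertices, or a vertex and a number. -/
inductive Wire (V : Type) where
  | vertex (k : ℕ) (q : V)
  | edge (k : ℕ) (i j : V)
  | level (k : ℕ) (q : V) (n : ℕ)

/-- The input wire at the vertex `q`, if there is one. -/
noncomputable def inputWire (I : Set V) (q : V) : Multiset (Wire V) :=
  if q ∈ I then {.vertex 0 q} else 0

/-- The wires at `q` that belong to the edges of a list. -/
noncomputable def edgeWires (ps : List (V × V)) (q : V) : Multiset (Wire V) :=
  (partners q ps : Multiset V).map (.edge 0 q)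

/-- The Hadamard vertices on the edges of a list. -/
def edgeHadamards (ps : List (V × V)) : Multiset (Kind V × Multiset (Wire V)) :=
  (ps : Multiset (V × V)).map fun p => (.hadamard, {.edge 0 p.1 p.2} + {.edge 0 p.2 p.1})

theorem mem_inputWire {I : Set V} {q : V} {w : Wire V} :
    w ∈ inputWire I q ↔ q ∈ I ∧ w = .vertex 0 q := by
  by_cases h : q ∈ I <;> simp [inputWire, h]

theorem mem_edgeWires {ps : List (V × V)} {q : V} {w : Wire V} :
    w ∈ edgeWires ps q ↔ ∃ r ∈ partners q ps, w = .edge 0 q r := by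
  simp [edgeWires, eq_comm]

theorem mem_wires_edgeHadamards {ps : List (V × V)} {w : Wire V} :
    w ∈ wires (edgeHadamards ps) ↔
      ∃ p ∈ ps, w = .edge 0 p.1 p.2 ∨ w = .edge 0 p.2 p.1 := by
  rw [mem_wires]
  simp [edgeHadamards]

variable [Fintype V]

/-- The graph state of a list of edges, before measurements. -/
noncomputable def graphTerm (I : Set V) (ps : List (V × V)) : Multiset (Kind V × Multiset (Wire V)) :=
  (∑ q, {(.spider .Z (.on 0 ∅), inputWire I q + edgeWires ps q +
    {.level 0 q (partners q ps).length})}) + edgeHadamards ps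

/-- The boundary wires of a graph state. -/
noncomputable def graphBoundary (I : Set V) (ps : List (V × V)) : I ⊕ V → Wire V :=
  Sum.elim (fun q => .vertex 0 q) fun q => .level 0 q (partners q ps).length

theorem mem_wires_graphTerm {I : Set V} {ps : List (V × V)} {w : Wire V} :
    w ∈ wires (graphTerm I ps) ↔ (∃ q, w ∈ inputWire I q ∨ w ∈ edgeWires ps q ∨
      w = .level 0 q (partners q ps).length) ∨ w ∈ wires (edgeHadamards ps) := by
  simp [graphTerm, Multiset.mem_sum, or_assoc]

/-- A trivial `Z` vertex is put on every wire. At a non-input it fuses with the initialisation; at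
an input it stays. Afterwards each qubit owns exactly one `Z` vertex. -/
theorem initDiagram_rewrites_graph (I : Set V) {l : List V} (hl : l.Nodup) (hl' : ∀ q, q ∈ l) :
    ∃ D, Rewrites (initDiagram I) D ∧ D.Described (graphTerm I []) (graphBoundary I []) := by
  have h1 := (initDiagram_described I).rename (g := Wire.vertex 0) (fun a b h => by simpa using h)
  have h2 := h1.layer_univ .Z (fun _ => .on 0 ∅) hl hl' (x := fun q => .level 0 q 0)
    (fun a b h => by simpa using h) (by simp) (by simp)
  have h3 : rename (Wire.vertex 0) (fam fun q : {q // q ∉ I} =>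
      ((.spider .Z (.on 0 ∅) : Kind V), ({q.1} : Multiset V))) =
      ∑ q, if q ∈ I then 0 else {(.spider .Z (.on 0 ∅), {Wire.vertex 0 q})} := by
    rw [rename_fam]
    refine (fam_subtype (fun q => q ∉ I) fun q =>
      ((.spider .Z (.on 0 ∅) : Kind V), ({q} : Multiset V).map (Wire.vertex 0))).trans ?_
    refine Finset.sum_congr rfl fun q _ => ?_
    by_cases hq : q ∈ I <;> simp [hq]
  have h4 : Reduces ((∑ q, if q ∈ I then 0 else {(.spider .Z (.on 0 ∅), {Wire.vertex 0 q})}) +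
      ∑ q, {((.spider .Z (.on 0 ∅) : Kind V), {Wire.vertex 0 q} + {Wire.level 0 q 0})})
      (graphTerm I []) := by
    rw [← Finset.sum_add_distrib]
    refine (Reduces.sum (R := fun q => {(.spider .Z (.on 0 ∅), inputWire I q + {.level 0 q 0})})
      fun q _ => ?_).congr rfl ?_
    · by_cases hq : q ∈ I
      · simpa [hq, inputWire] using .refl _
      · rw [if_neg hq, inputWire, if_neg hq, zero_add]
        have := reduces_fuse .Z 0 0 (∅ : Set V) 0 {Wire.level 0 q 0} (Wire.vertex 0 q)
        rw [zero_add, zero_add, zero_add, add_comm {Wire.level 0 q 0}] at this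
        exact this
    · simp [graphTerm, edgeWires, edgeHadamards, partners]
  rw [h3] at h2
  have h5 := h4.equates h2.proper
  obtain ⟨D, hD⟩ := h5.right.exists_described
  refine ⟨D, (rewrites_layer_zero .Z l _).trans (h5.rewrites _ _ h2 hD), ?_⟩
  exact hD

omit [Fintype V] in
theorem graphBoundary_append (I : Set V) (_ : DecidableEq (I ⊕ V)) (ps : List (V × V)) {i j : V} (hij : i ≠ j) :
    graphBoundary I (ps ++ [(i, j)]) =
      Function.update (Function.update (graphBoundary I ps) (.inr i)
        (.level 0 i ((partners i ps).length + 1))) (.inr j)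
        (.level 0 j ((partners j ps).length + 1)) := by
  funext b
  by_cases hj : b = .inr j
  · subst hj
    rw [Function.update_self]
    simp only [graphBoundary, Sum.elim_inr, partners, List.flatMap_append, List.length_append,
      List.flatMap_singleton, if_neg hij, if_true, List.length_singleton]
  · rw [Function.update_of_ne hj]
    by_cases hi : b = .inr i
    · subst hi
      rw [Function.update_self]
      simp [graphBoundary, partners]
    · rw [Function.update_of_ne hi]
      rcases b with b | b
      · rfl
      · have h1 : ¬ i = b := fun h => hi (by rw [h])
        have h2 : ¬ j = b := fun h => hj (by rw [h])
        simp [graphBoundary, partners, h1, h2]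

/-- The `Z` vertices of the new gate fuse with the vertices of `i` and `j` along their old output
wires. Numbering an output wire by the edges met so far makes its successor a new name. -/
theorem reduces_graphTerm_append (I : Set V) (ps : List (V × V)) {i j : V} (hij : i ≠ j) :
    Reduces (graphTerm I ps +
      ({(.spider .Z (.on 0 ∅), {.level 0 i (partners i ps).length} +
          {.level 0 i ((partners i ps).length + 1)} + {.edge 0 i j})} +
        {(.spider .Z (.on 0 ∅), {.level 0 j (partners j ps).length} +
          {.level 0 j ((partners j ps).length + 1)} + {.edge 0 j i})} +
        {(.hadamard, {.edge 0 i j} + {.edge 0 j i})}))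
      (graphTerm I (ps ++ [(i, j)])) := by
  set L : V → V → Multiset (Kind V × Multiset (Wire V)) := fun q r =>
    {(.spider .Z (.on 0 ∅), {.level 0 q (partners q ps).length} +
          {.level 0 q ((partners q ps).length + 1)} + {.edge 0 q r})} with hL
  have h1 : ∀ q r, partners q (ps ++ [(i, j)]) = partners q ps ++ [r] →
      Reduces ({(.spider .Z (.on 0 ∅), inputWire I q + edgeWires ps q +
        {.level 0 q (partners q ps).length})} + L q r)
        {(.spider .Z (.on 0 ∅), inputWire I q + edgeWires (ps ++ [(i, j)]) q +
          {.level 0 q (partners q (ps ++ [(i, j)])).length})} := by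
    intro q r h
    refine (reduces_fuse .Z 0 0 (∅ : Set V) (inputWire I q + edgeWires ps q)
      ({.level 0 q ((partners q ps).length + 1)} + {.edge 0 q r})
      (.level 0 q (partners q ps).length)).congr ?_ ?_
    · simp only [hL]
      congr 3
      rw [add_assoc, add_comm]
    · rw [edgeWires, edgeWires, h, List.length_append, ← Multiset.coe_add, Multiset.map_add]
      simp only [zero_add, List.length_singleton, Multiset.coe_singleton, Multiset.map_singleton]
      congr 2
      abel
  have hi : partners i (ps ++ [(i, j)]) = partners i ps ++ [j] := by simp [partners]
  have hj : partners j (ps ++ [(i, j)]) = partners j ps ++ [i] := by simp [partners, hij]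
  have h2 : Reduces ((∑ q, ({(.spider .Z (.on 0 ∅), inputWire I q + edgeWires ps q +
      {.level 0 q (partners q ps).length})} + ((if q = i then L q j else 0) +
        if q = j then L q i else 0))) +
      (edgeHadamards ps + {(.hadamard, {.edge 0 i j} + {.edge 0 j i})}))
      (graphTerm I (ps ++ [(i, j)])) := by
    refine .add (.sum fun q _ => ?_) (.of_eq ?_)
    · by_cases hqi : q = i
      · subst hqi
        simpa [hij] using h1 q j hi
      · by_cases hqj : q = j
        · subst hqj
          simpa [hqi] using h1 q i hj
        · refine .of_eq ?_
          have : partners q (ps ++ [(i, j)]) = partners q ps := by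
            simp [partners, Ne.symm hqi, Ne.symm hqj]
          simp [hqi, hqj, edgeWires, this]
    · simp [edgeHadamards, ← Multiset.coe_add]
  refine h2.congr ?_ rfl
  rw [Finset.sum_add_distrib, Finset.sum_add_distrib, Finset.sum_ite_eq', Finset.sum_ite_eq',
    if_pos (Finset.mem_univ _), if_pos (Finset.mem_univ _), graphTerm]
  abel

theorem foldl_entanglers_rewrites_graph (I : Set V) (ps : List (V × V))
    (hps : ∀ p ∈ ps, p.1 ≠ p.2) (hnd : (ps.map fun p => s(p.1, p.2)).Nodup)
    {D₀ : Diagram V (I ⊕ V)} (hD₀ : D₀.Described (graphTerm I []) (graphBoundary I [])) :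
    ∃ D, Rewrites ((entanglers ps).foldl applyCommand D₀) D ∧
      D.Described (graphTerm I ps) (graphBoundary I ps) := by
  induction ps using List.reverseRecOn with
  | nil => exact ⟨D₀, .refl _, hD₀⟩
  | append_singleton ps p ih =>
    obtain ⟨i, j⟩ := p
    have hij : i ≠ j := hps (i, j) (by simp)
    rw [List.map_append, List.nodup_append] at hnd
    have hps' : ∀ p ∈ ps, p.1 ≠ p.2 := fun p hp => hps p (by simp [hp])
    obtain ⟨D, h1, h2⟩ := ih hps' hnd.1
    have hnot : s(i, j) ∉ ps.map fun p => s(p.1, p.2) := fun h => hnd.2.2 _ h _ (by simp) rfl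
    -- The wire names of the new edge are unused because the edge was not listed before in either
    -- direction.
    have hedge : ∀ a b, s(a, b) = s(i, j) → Wire.edge 0 a b ∉ wires (graphTerm I ps) := by
      intro a b hab h
      rw [← hab] at hnot
      rcases mem_wires_graphTerm.1 h with ⟨q, h | h | h⟩ | h
      · simpa using (mem_inputWire.1 h).2
      · obtain ⟨r, hr, h⟩ := mem_edgeWires.1 h
        simp only [Wire.edge.injEq, true_and] at h
        obtain ⟨rfl, rfl⟩ := h
        have := List.count_pos_iff.2 hr
        rw [count_partners hps', List.count_eq_zero_of_not_mem hnot] at this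
        exact lt_irrefl _ this
      · simp at h
      · obtain ⟨⟨c, d⟩, hp, h | h⟩ := mem_wires_edgeHadamards.1 h <;>
          simp only [Wire.edge.injEq, true_and] at h <;> obtain ⟨rfl, rfl⟩ := h
        · exact hnot (List.mem_map.2 ⟨_, hp, rfl⟩)
        · exact hnot (List.mem_map.2 ⟨_, hp, Sym2.eq_swap⟩)
    have hlevel : ∀ q, Wire.level 0 q ((partners q ps).length + 1) ∉ wires (graphTerm I ps) := by
      intro q h
      rcases mem_wires_graphTerm.1 h with ⟨r, h | h | h⟩ | h
      · simpa using (mem_inputWire.1 h).2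
      · simpa using mem_edgeWires.1 h
      · simp only [Wire.level.injEq, true_and] at h
        obtain ⟨rfl, h⟩ := h
        omega
      · simpa using mem_wires_edgeHadamards.1 h
    have h3 := h2.entangle hij (w := .level 0 i ((partners i ps).length + 1))
      (w' := .level 0 j ((partners j ps).length + 1)) (x := .edge 0 i j) (y := .edge 0 j i) (by
        simp only [List.forall_mem_cons]
        exact ⟨hlevel i, hlevel j, hedge _ _ rfl, hedge _ _ Sym2.eq_swap, by simp⟩) (by
        simp only [List.forall_mem_cons]
        refine ⟨?_, ?_, ?_, ?_, by simp⟩ <;> rintro (b | b)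
        all_goals simp [graphBoundary]
        · rintro rfl
          omega
        · rintro rfl
          omega) (by simp [hij])
    have h4 := (reduces_graphTerm_append I ps hij).equates h3.proper
    obtain ⟨D', hD'⟩ := h4.right.exists_described
    refine ⟨D', ?_, (graphBoundary_append I _ ps hij).symm ▸ hD'⟩
    rw [entanglers, List.map_append, List.foldl_append]
    exact (h1.applyCommand (c := .E i j) (fun k h => hij (by simp_all))).trans
      (h4.rewrites _ _ h3 hD')

end Graph

end ZX

/-! ### Measurements -/

namespace ZX

theorem Diagram.Described.reduce {𝒱 Δ W : Type} [Finite Δ] {D : Diagram 𝒱 Δ}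
    {T T' : Multiset (Kind 𝒱 × Multiset W)} {bd : Δ → W} (h : D.Described T bd)
    (hT : Reduces T T') : ∃ D', Rewrites D D' ∧ D'.Described T' bd := by
  have e := hT.equates h.proper
  obtain ⟨D', hD'⟩ := e.right.exists_described
  exact ⟨D', e.rewrites _ _ h hD', hD'⟩

section Measurement

open Classical

variable {V W : Type} [Fintype V]

omit [Fintype V] in
theorem rawTerm_meas {V' : Type} {N : Type} [Finite N] (kind : N × Bool → Kind V') (lg eg : N → W) :
    rawTerm kind (fun q => (q, false)) (fun q => (q, true)) (fun q => (q, false)) lg eg =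
      (fam fun q => (kind (q, false), {lg q} + {eg q})) + fam fun q => (kind (q, true), {eg q}) := by
  have h : ∀ (f : N → W) (b : Bool) q, fib (fun q => ((q, b) : N × Bool)) f (q, b) = {f q} :=
    fun f b q => fib_of_unique (fun r => by simp) f
  have h' : ∀ (f : N → W) (b c : Bool) q, b ≠ c →
      fib (fun q => ((q, b) : N × Bool)) f (q, c) = 0 :=
    fun f b c q hbc => fib_of_forall_ne (fun r hr => hbc (Prod.ext_iff.1 hr).2) f
  rw [rawTerm, fam_prod_bool, add_comm]
  simp only [h, h' _ true false _ (by simp),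
    h' _ false true _ (by simp), zero_add, add_zero]

theorem measFragment_term {K : V → Prop} (α : {q // K q} → Real.Angle) (lg eg : {q // K q} → W) :
    (measFragment α).term lg eg =
      (fam fun q : {q // K q} => (.spider .Z (.on Real.pi {q.1}), {lg q} + {eg q})) +
        fam fun q => (.spider .Z (.on (-α q) ∅), {eg q}) :=
  (Fragment.term_eq_rawTerm _ _ _).trans (rawTerm_meas (measFragment α).kind lg eg)

/-- Composing with the measurements. -/
noncomputable def Pattern.measure (P : Pattern V) (D : Diagram V (P.inputs ⊕ V)) :
    Diagram V (P.inputs ⊕ P.outputs) :=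
  (D.relabel P.splitEquiv).plug (measFragment P.angle)

theorem Diagram.Described.measure (P : Pattern V) {D : Diagram V (P.inputs ⊕ V)}
    {T : Multiset (Kind V × Multiset W)} {bd : P.inputs ⊕ V → W} (h : D.Described T bd)
    {y : {q // P.Measured q} → W} (hy : Function.Injective y) (hT : ∀ q, y q ∉ wires T)
    (hb : ∀ q b, bd b ≠ y q) :
    (P.measure D).Described (T +
      ((fam fun q : {q // P.Measured q} =>
        (.spider .Z (.on Real.pi {q.1}), {bd (.inr q.1)} + {y q})) +
        fam fun q => (.spider .Z (.on (-P.angle q) ∅), {y q})))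
      (Sum.elim (fun a => bd (.inl a)) fun q => bd (.inr q.1)) := by
  have h1 := h.relabel P.splitEquiv
  have h2 : (fun d => bd (P.splitEquiv.symm d)) =
      Sum.elim (Sum.elim (fun a => bd (.inl a)) fun q => bd (.inr q.1))
        fun q : {q // P.Measured q} => bd (.inr q.1) := by
    funext d
    rcases d with (d | d) | d <;> rfl
  rw [h2] at h1
  have h3 := h1.plug (measFragment P.angle) hy hT (by
    rintro e (b | b)
    exacts [hb e _, hb e _]) fun e k => hb e _
  rw [measFragment_term] at h3
  exact h3

theorem Pattern.extends_measure (P : Pattern V) :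
    Extends P.measure
      ((fam fun q : {q // P.Measured q} => (.spider .Z (.on Real.pi {q.1}),
        {Sum.inl (Sum.inr q.1)} + {Sum.inr q})) +
        fam fun q => (.spider .Z (.on (-P.angle q) ∅), {Sum.inr q}))
      (Sum.elim (fun a => .inl (.inl a)) fun q => .inl (.inr q.1)) := by
  intro W D T bd ν h hν hT hb
  have h1 := h.measure P hν hT hb
  refine (congrArg₂ (Diagram.Described _) ?_ ?_).mp h1
  · simp [rename_add, rename_fam]
  · funext d
    rcases d with d | d <;> rfl

omit [Fintype V] in
theorem signalSet_some (q : V) : signalSet (some q) = {q} := by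
  ext t
  simp [signalSet, eq_comm]

omit [Fintype V] in
theorem signalSet_none : signalSet (none : Option V) = ∅ := by
  ext t
  simp [signalSet]

-- The conditional vertices disappear here: the remaining correction $Z(\pi,U)$ and the one of the
-- measurement fuse to angle $2\pi=0$. The `X` vertex then either is trivial or changes the sign of
-- the measurement angle, and all angles add up on the graph vertex.
omit [Fintype V] in
theorem reduces_measured (a b α : Real.Angle) (hb : b = 0 ∨ b = Real.pi) (U : Set V)
    (S : Multiset W) (l x x' x'' y : W) :
    ∃ γ, Reduces ({(.spider .Z (.on 0 ∅), S + {l})} + {(.spider .Z (.on a ∅), {l} + {x})} +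
      {(.spider .X (.on b ∅), {x} + {x'})} + {(.spider .Z (.on Real.pi U), {x'} + {x''})} +
      ({(.spider .Z (.on Real.pi U), {x''} + {y})} + {(.spider .Z (.on α ∅), {y})}))
      {(.spider .Z (.on γ ∅), S)} := by
  have h1 := reduces_fuse .Z Real.pi Real.pi U {x'} {y} x''
  rw [Real.Angle.coe_pi_add_coe_pi, Phase.on_zero] at h1
  have h2 := reduces_fuse .Z 0 α (∅ : Set V) {x'} 0 y
  rw [zero_add, zero_add, add_zero] at h2
  have h3 : ∃ γ, Reduces ({(.spider .X (.on b ∅), {x} + {x'})} + {(.spider .Z (.on α ∅), {x'})})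
      {(.spider .Z (.on γ (∅ : Set V)), {x})} := by
    rcases hb with rfl | rfl
    · refine ⟨α, (reduces_identity .X (.spider .Z (.on α ∅)) 0 x x').congr ?_ ?_⟩
      · rw [zero_add, add_comm]
      · rw [zero_add]
    · exact ⟨-α, (reduces_piCommute_end .Z α ∅ ∅ (.inl rfl) x x').congr (add_comm _ _) rfl⟩
  obtain ⟨γ, h3⟩ := h3
  have h4 := reduces_fuse .Z a γ (∅ : Set V) {l} 0 x
  rw [zero_add, add_zero] at h4
  have h5 := reduces_fuse .Z 0 (a + γ) (∅ : Set V) S 0 l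
  rw [zero_add, zero_add, add_zero] at h5
  have g1 : Reduces ({(.spider .Z (.on Real.pi U), {x'} + {x''})} +
      {(.spider .Z (.on Real.pi U), {x''} + {y})} + {(.spider .Z (.on α ∅), {y})})
      {(.spider .Z (.on α ∅), {x'})} := by
    rw [add_comm ({x''} : Multiset W) {y}]
    exact (h1.add_right _).trans h2
  refine ⟨a + γ, ((((((g1.add_left _).trans h3).add_left _).trans h4).add_left _).trans h5).congr
    ?_ rfl⟩
  simp only [add_assoc]

-- At an output the `Z` correction fuses into the graph vertex, but the `X` correction has to stay
-- on the wire; the trivial vertex of the last layer is removed.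
omit [Fintype V] in
theorem reduces_unmeasured (a b : Real.Angle) (U : Set V) (S : Multiset W)
    (l x x' x'' : W) :
    Reduces ({(.spider .Z (.on 0 ∅), S + {l})} + {(.spider .Z (.on a ∅), {l} + {x})} +
      {(.spider .X (.on b ∅), {x} + {x'})} + {(.spider .Z (.on 0 U), {x'} + {x''})})
      ({(.spider .Z (.on a ∅), S + {x})} + {(.spider .X (.on b ∅), {x} + {x''})}) := by
  have h1 := reduces_fuse .Z 0 a (∅ : Set V) S {x} l
  rw [zero_add] at h1
  have h2 := reduces_identity .Z (.spider .X (.on b (∅ : Set V))) {x} x'' x'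
  rw [add_assoc, Phase.on_zero U, add_comm ({l} : Multiset W) {x},
    add_comm ({x'} : Multiset W) {x''}]
  exact h1.add h2

/-- The graph state of a list of edges after the measurements. -/
noncomputable def measuredTerm (I M : Set V) (ps : List (V × V)) (θ b : V → Real.Angle) :
    Multiset (Kind V × Multiset (Wire V)) :=
  (∑ q, ({(.spider .Z (.on (θ q) ∅), inputWire I q + edgeWires ps q +
    if q ∈ M then 0 else {.vertex 2 q})} +
    if q ∈ M then 0 else {(.spider .X (.on (b q) ∅), {.vertex 2 q} + {.vertex 1 q})})) +
    edgeHadamards ps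

/-- After the cancellation each qubit carries an unconditional `Z`, an unconditional `X` and a
conditional `Z` layer, followed at measured qubits by the measurement. Each qubit is simplified on
its own, since the term is a sum over qubits. -/
theorem Pattern.exists_rewrites_measuredTerm (P : Pattern V) (F : P.geometry.Flow)
    (hP : P.HasFlowCorrectors F) :
    ∃ (ps : List (V × V)) (θ b : V → Real.Angle), (∀ p ∈ ps, p.1 ≠ p.2) ∧
      (ps.map fun p => s(p.1, p.2)).Nodup ∧
      (∀ u v, P.geometry.graph.Adj u v ↔ s(u, v) ∈ ps.map fun p => s(p.1, p.2)) ∧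
      ∃ D, Rewrites P.diagram D ∧ D.Described
        (measuredTerm P.inputs {q | P.Measured q} ps θ b)
        (Sum.elim (fun q => .vertex 0 q) fun q => .vertex 1 q) := by
  set vs := (Finset.univ : Finset V).toList with hvs
  have hnd : vs.Nodup := Finset.nodup_toList _
  have hall : ∀ q, q ∈ vs := fun q => by simp [hvs]
  obtain ⟨ps, p₁, p₂, hps, hpnd, hadj, hrew⟩ := P.exists_rewrites_normal F hP hnd hall
  obtain ⟨D₀, hD₀, hD₀'⟩ := initDiagram_rewrites_graph P.inputs hnd hall
  obtain ⟨D₁, hD₁, hD₁'⟩ := foldl_entanglers_rewrites_graph P.inputs ps hps hpnd hD₀'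
  set a : V → Real.Angle := fun q => if p₁ q then Real.pi else 0 with ha
  set b : V → Real.Angle := fun q => if p₂ q then Real.pi else 0 with hb
  set c : V → Real.Angle := fun q => if P.Measured q then Real.pi else 0 with hc
  have h1 : Rewrites ((entanglers ps ++ normalCorrections (vs.filter p₁) (vs.filter p₂)
      (vs.filter fun q => P.Measured q)).foldl applyCommand (initDiagram P.inputs))
      (layer .Z (fun q => .on (c q) (signalSet (some q))) vs
        (layer .X (fun q => .on (b q) (signalSet none)) vs
          (layer .Z (fun q => .on (a q) (signalSet none)) vs D₁))) := by
    rw [List.foldl_append, normalCorrections, List.foldl_append, List.foldl_append]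
    have h2 := (hD₀.foldl (notMem_entanglers hps)).trans hD₁
    exact (foldl_filter_rewrites_layer .Z P.Measured some vs _).trans (.layer
      ((foldl_filter_rewrites_layer .X p₂ (fun _ => none) vs _).trans (.layer
        ((foldl_filter_rewrites_layer .Z p₁ (fun _ => none) vs _).trans
          (h2.layer _ _ _)) _ _ _)) _ _ _)
  have hinj : ∀ k, Function.Injective (Wire.vertex k : V → _) := fun k a b h => by simpa using h
  have hfresh : ∀ k q, k ≠ 0 → Wire.vertex k q ∉ wires (graphTerm P.inputs ps) := by
    intro k q hk h
    rcases mem_wires_graphTerm.1 h with ⟨r, h | h | h⟩ | h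
    · exact hk (Wire.vertex.inj (mem_inputWire.1 h).2).1
    · simpa using mem_edgeWires.1 h
    · simp at h
    · simpa using mem_wires_edgeHadamards.1 h
  -- The layers end in the wires numbered 2, 3 and 1 in this order, so that the outputs end in
  -- `vertex 1`; number 4 is the wire inside a measurement.
  have d1 := hD₁'.layer_univ .Z (fun q => .on (a q) (signalSet none)) hnd hall (hinj 2)
    (fun q => hfresh _ _ (by simp)) (by
      rintro q (b | b) <;> simp [graphBoundary])
  have d2 := d1.layer_univ .X (fun q => .on (b q) (signalSet none)) hnd hall (hinj 3)
    (fun q => by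
      simp [hfresh, Multiset.mem_sum, graphBoundary]) (by
      rintro q (b | b) <;> simp [graphBoundary])
  have d3 := d2.layer_univ .Z (fun q => .on (c q) (signalSet (some q))) hnd hall (hinj 1)
    (fun q => by
      simp [hfresh, Multiset.mem_sum, graphBoundary]) (by
      rintro q (b | b) <;> simp [graphBoundary])
  have d4 := d3.measure P (y := fun q => .vertex 4 q.1) (fun q r h => Subtype.ext (by simpa using h))
    (fun q => by
      simp [hfresh, Multiset.mem_sum, graphBoundary]) (by
      rintro q (b | b) <;> simp [graphBoundary])
  set α : V → Real.Angle := fun q => if h : P.Measured q then - P.angle ⟨q, h⟩ else 0 with hα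
  have hα' : ∀ q : {q // P.Measured q}, -P.angle q = α q.1 := fun q => by
    simp only [hα, dif_pos q.2]
  -- One angle per qubit: the total angle at a measured qubit, and the `Z` correction at an output.
  have hγ : ∀ q, ∃ γ, (P.Measured q → Reduces
      ({(.spider .Z (.on 0 ∅), inputWire P.inputs q + edgeWires ps q +
          {.level 0 q (partners q ps).length})} +
        {(.spider .Z (.on (a q) ∅), {Wire.level 0 q (partners q ps).length} + {.vertex 2 q})} +
        {(.spider .X (.on (b q) ∅), {.vertex 2 q} + {.vertex 3 q})} +
        {(.spider .Z (.on Real.pi {q}), {.vertex 3 q} + {.vertex 1 q})} +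
      ({(.spider .Z (.on Real.pi {q}), {.vertex 1 q} + {.vertex 4 q})} +
        {(.spider .Z (.on (α q) ∅), {.vertex 4 q})}))
      {(.spider .Z (.on γ ∅), inputWire P.inputs q + edgeWires ps q)}) ∧
      (¬ P.Measured q → γ = a q) := by
    intro q
    by_cases hq : P.Measured q
    · have hbq : b q = 0 ∨ b q = Real.pi := by
        by_cases h : p₂ q
        · exact .inr (if_pos h)
        · exact .inl (if_neg h)
      obtain ⟨γ, h⟩ := reduces_measured (a q) (b q) (α q) hbq {q}
        (inputWire P.inputs q + edgeWires ps q) (.level 0 q (partners q ps).length) (.vertex 2 q)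
        (.vertex 3 q) (.vertex 1 q) (.vertex 4 q)
      exact ⟨γ, fun _ => h, fun h => absurd hq h⟩
    · exact ⟨a q, fun h => absurd h hq, fun _ => rfl⟩
  choose θ hθ hθ' using hγ
  have key : Reduces ((∑ q, ({(.spider .Z (.on 0 ∅), inputWire P.inputs q + edgeWires ps q +
          {.level 0 q (partners q ps).length})} +
        {(.spider .Z (.on (a q) ∅), {Wire.level 0 q (partners q ps).length} + {.vertex 2 q})} +
        {(.spider .X (.on (b q) ∅), {.vertex 2 q} + {.vertex 3 q})} +
        {(.spider .Z (.on (c q) {q}), {.vertex 3 q} + {.vertex 1 q})} +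
      ((if P.Measured q then {(.spider .Z (.on Real.pi {q}), {.vertex 1 q} + {.vertex 4 q})} else 0)
        + if P.Measured q then {(.spider .Z (.on (α q) ∅), {.vertex 4 q})} else 0))) +
        edgeHadamards ps) (measuredTerm P.inputs {q | P.Measured q} ps θ b) := by
    refine (Reduces.sum fun q _ => ?_).add_right _
    by_cases hq : P.Measured q
    · have := hθ q hq
      simp only [hq, if_true, Set.mem_ofPred_eq, add_zero]
      simpa only [hc, hq, if_true] using this
    · simp only [hq, if_false, Set.mem_ofPred_eq, add_zero]
      rw [hθ' q hq, show c q = 0 from if_neg hq]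
      exact reduces_unmeasured _ _ _ _ _ _ _ _
  refine ⟨ps, θ, b, hps, hpnd, hadj, ?_⟩
  obtain ⟨D, h5, hD⟩ := d4.reduce (key.congr (by
    simp only [hα', signalSet_some, signalSet_none, graphBoundary, Sum.elim_inr]
    rw [fam_subtype P.Measured fun q => ((.spider .Z (.on Real.pi {q}) : Kind V),
        ({Wire.vertex 1 q} + {Wire.vertex 4 q} : Multiset (Wire V))),
      fam_subtype P.Measured fun q => ((.spider .Z (.on (α q) ∅) : Kind V),
        ({Wire.vertex 4 q} : Multiset (Wire V))), graphTerm]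
    simp only [Finset.sum_add_distrib]
    abel) rfl)
  have h6 : Rewrites P.diagram (P.measure _) := Extends.rewrites P.extends_measure (hrew.trans h1)
  exact ⟨D, h6.trans h5, hD⟩

end Measurement

end ZX

/-! ### From the graph state to a circuit along a schedule -/

namespace ZX

section Circuit

open Classical

variable {V : Type} [Fintype V]

theorem coe_partners {G : SimpleGraph V} {ps : List (V × V)} (hps : ∀ p ∈ ps, p.1 ≠ p.2)
    (hnd : (ps.map fun p => s(p.1, p.2)).Nodup)
    (hadj : ∀ u v, G.Adj u v ↔ s(u, v) ∈ ps.map fun p => s(p.1, p.2)) (q : V) :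
    (partners q ps : Multiset V) = (Finset.univ.filter fun t => G.Adj q t).val := by
  ext j
  rw [Multiset.coe_count, count_partners hps, hnd.count, Multiset.count_eq_of_nodup
    (Finset.nodup _)]
  simp only [← hadj, Finset.mem_val, Finset.mem_filter, Finset.mem_univ, true_and]

theorem edgeWires_eq {G : SimpleGraph V} {ps : List (V × V)} (hps : ∀ p ∈ ps, p.1 ≠ p.2)
    (hnd : (ps.map fun p => s(p.1, p.2)).Nodup)
    (hadj : ∀ u v, G.Adj u v ↔ s(u, v) ∈ ps.map fun p => s(p.1, p.2)) (q : V) :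
    edgeWires ps q = ∑ t with G.Adj q t, {Wire.edge 0 q t} := by
  rw [edgeWires, coe_partners hps hnd hadj, ← Multiset.sum_map_singleton (Multiset.map _ _),
    Multiset.map_map]
  rfl

/-- Every edge has exactly one orientation from the earlier to the later vertex, and the term of its
Hadamard vertex is symmetric in the two ends. -/
theorem edgeHadamards_eq {G : SimpleGraph V} {ps : List (V × V)}
    (hnd : (ps.map fun p => s(p.1, p.2)).Nodup)
    (hadj : ∀ u v, G.Adj u v ↔ s(u, v) ∈ ps.map fun p => s(p.1, p.2)) {time : V → ℕ}
    (ht : Function.Injective time) :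
    edgeHadamards ps = ∑ w, ∑ t with G.Adj w t ∧ time w < time t,
      {((.hadamard : Kind V), {Wire.edge 0 w t} + {Wire.edge 0 t w})} := by
  let g : Sym2 V → Kind V × Multiset (Wire V) := Sym2.lift
    ⟨fun w t => (.hadamard, {Wire.edge 0 w t} + {Wire.edge 0 t w}), fun w t =>
      congrArg (Prod.mk _) (add_comm _ _)⟩
  have h1 : edgeHadamards ps = ((ps.map fun p => s(p.1, p.2) : List _) : Multiset (Sym2 V)).map g := by
    rw [← Multiset.map_coe, Multiset.map_map]
    rfl
  have h2 : ((ps.map fun p => s(p.1, p.2) : List _) : Multiset (Sym2 V)) =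
      (Finset.univ.filter fun p : V × V => G.Adj p.1 p.2 ∧ time p.1 < time p.2).val.map
        fun p => s(p.1, p.2) := by
    refine (Multiset.Nodup.ext (Multiset.coe_nodup.2 hnd) (Multiset.Nodup.map_on ?_
      (Finset.nodup _))).2 fun e => ?_
    · rintro ⟨a, b⟩ hp ⟨c, d⟩ hq h
      simp only [Finset.mem_val, Finset.mem_filter, Finset.mem_univ, true_and] at hp hq
      rcases Sym2.eq_iff.1 h with ⟨rfl, rfl⟩ | ⟨rfl, rfl⟩
      · rfl
      · exact absurd hp.2 hq.2.not_gt
    · induction e with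
      | _ u v =>
      rw [Multiset.mem_coe, ← hadj, Multiset.mem_map]
      constructor
      · intro h
        rcases lt_or_gt_of_ne (ht.ne h.ne) with hlt | hlt
        · exact ⟨(u, v), by simp [h, hlt], rfl⟩
        · exact ⟨(v, u), by simp [h.symm, hlt], Sym2.eq_swap⟩
      · rintro ⟨⟨a, b⟩, hp, h⟩
        simp only [Finset.mem_val, Finset.mem_filter, Finset.mem_univ, true_and] at hp
        rcases Sym2.eq_iff.1 h with ⟨rfl, rfl⟩ | ⟨rfl, rfl⟩
        · exact hp.1
        · exact hp.1.symm
  rw [h1, h2, Multiset.map_map, ← Multiset.sum_map_singleton (Multiset.map _ _), Multiset.map_map]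
  change ∑ p with _, _ = _
  rw [Finset.sum_filter, Fintype.sum_prod_type]
  exact Finset.sum_congr rfl fun w _ => (Finset.sum_filter _ _).symm

/-- An order in which the vertices of an open graph, with inputs `I` and measured vertices `M`, can
be treated one after the other on the wires of a circuit: the vertex `w` is on its wire from the
time `birth w` until the time `time w`, when the wire of a measured vertex passes to `next w`. -/
structure Schedule (G : SimpleGraph V) (I M : Set V) where
  time : V → ℕ
  birth : V → ℕ
  next : V → V
  time_injective : Function.Injective time
  birth_le : ∀ w, birth w ≤ time w
  birth_le_of_adj : ∀ w t, G.Adj w t → time t < time w → birth w ≤ time t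
  next_adj : ∀ u ∈ M, G.Adj u (next u)
  next_notMem : ∀ u ∈ M, next u ∉ I
  time_lt : ∀ u ∈ M, time u < time (next u)
  birth_next : ∀ u ∈ M, birth (next u) = time u

namespace Schedule

variable {G : SimpleGraph V} {I M : Set V} (S : Schedule G I M)

/-- The wire on which `w` reaches the time `k`. -/
noncomputable def entry (w : V) (k : ℕ) : Multiset (Wire V) :=
  if k = S.birth w then inputWire I w else {.level 1 w k}

omit [Fintype V] in
theorem entry_birth (w : V) : S.entry w (S.birth w) = inputWire I w := if_pos rfl

omit [Fintype V] in
theorem entry_succ {w : V} {k : ℕ} (h : S.birth w ≤ k) :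
    S.entry w (k + 1) = {.level 1 w (k + 1)} :=
  if_neg (by lia)

/-- The wires to `w` from its neighbour that is treated at the time `k`. -/
noncomputable def link (w : V) (k : ℕ) : Multiset (Wire V) :=
  ∑ t with G.Adj w t ∧ S.time t = k, {.edge 0 w t}

/-- The wires from `w` to its later neighbours. -/
noncomputable def fan (w : V) : Multiset (Wire V) :=
  ∑ t with G.Adj w t ∧ S.time w < S.time t, {.edge 0 t w}

/-- The vertices of the circuit that follow the wire of `w` until it is treated. -/
noncomputable def cells (w : V) : Multiset (Kind V × Multiset (Wire V)) :=
  ∑ k ∈ Finset.Ico (S.birth w) (S.time w),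
    ({(.spider .Z (.on 0 ∅), S.entry w k + {.level 2 w k} + S.link w k)} +
      {(.spider .X (.on 0 ∅), {.level 2 w k} + {.level 1 w (k + 1)})})

/-- The final vertices of the circuit on the wire of an output. -/
noncomputable def tail (M : Set V) (b : V → Real.Angle) (w : V) :
    Multiset (Kind V × Multiset (Wire V)) :=
  if w ∈ M then 0 else {(.hadamard, {.vertex 7 w} + {.vertex 8 w})} +
    {(.spider .X (.on (b w) ∅), {.vertex 8 w} + {.vertex 1 w})}

/-- The circuit. -/
noncomputable def circuitTerm (θ b : V → Real.Angle) : Multiset (Kind V × Multiset (Wire V)) :=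
  ∑ w, (S.cells w + {(.spider .Z (.on (θ w) ∅), S.entry w (S.time w) + {.vertex 5 w})} +
    {(.hadamard, {.vertex 5 w} + {.vertex 6 w})} +
    {(.spider .X (.on 0 ∅), {.vertex 6 w} + S.fan w + if w ∈ M then 0 else {.vertex 7 w})} +
    tail M b w)

/-- The circuit, with the `X` vertices that branch replaced by `Z` vertices with Hadamard vertices
on their legs. -/
noncomputable def expandedTerm (θ b : V → Real.Angle) : Multiset (Kind V × Multiset (Wire V)) :=
  ∑ w, (S.cells w + {(.spider .Z (.on (θ w) ∅), S.entry w (S.time w) + {.vertex 5 w})} +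
    {(.hadamard, {.vertex 5 w} + {.vertex 6 w})} +
    ({(.spider .Z (.on 0 ∅), {.vertex 9 w} + (∑ t with G.Adj w t ∧ S.time w < S.time t,
        {.edge 0 w t}) + if w ∈ M then 0 else {.vertex 2 w})} +
      ({(.hadamard, {.vertex 9 w} + {.vertex 6 w})} +
        (∑ t with G.Adj w t ∧ S.time w < S.time t,
          {(.hadamard, {.edge 0 w t} + {.edge 0 t w})}) +
        if w ∈ M then 0 else {(.hadamard, {.vertex 2 w} + {.vertex 7 w})})) +
    tail M b w)

/-- The $H$-commute rule recolours the outgoing part of each vertex. All its legs carry Hadamard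
vertices: the one from the main vertex, those to later neighbours, and the output wire. -/
theorem expandedTerm_reduces_circuitTerm (θ b : V → Real.Angle) :
    Reduces (S.expandedTerm θ b) (S.circuitTerm θ b) := by
  refine .sum fun w _ => ((Reduces.congr (reduces_hCommute .X (.on 0 ∅)
    ({(Wire.vertex 9 w, Wire.vertex 6 w)} + (∑ t with G.Adj w t ∧ S.time w < S.time t,
      {(Wire.edge 0 w t, Wire.edge 0 t w)}) +
        if w ∈ M then 0 else {(Wire.vertex 2 w, Wire.vertex 7 w)})) ?_ ?_).add_left _).add_right _
  · simp only [Multiset.map_add, Multiset.map_singleton, ← Multiset.coe_mapAddMonoidHom, map_sum]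
    simp only [Multiset.coe_mapAddMonoidHom, Multiset.map_singleton]
    by_cases hw : w ∈ M
    · simp only [hw, if_true, Multiset.map_zero, Colour.swap]
    · simp only [hw, if_false, Multiset.map_singleton, Colour.swap]
  · simp only [Multiset.map_add, Multiset.map_singleton, ← Multiset.coe_mapAddMonoidHom, map_sum]
    simp only [Multiset.coe_mapAddMonoidHom, Multiset.map_singleton, fan]
    by_cases hw : w ∈ M
    · simp only [hw, if_true, Multiset.map_zero]
    · simp only [hw, if_false, Multiset.map_singleton]

/-- The last `X` vertex of the chain is removed by the identity rule, the last `Z` vertex is then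
fused into the final one, and so on back to the first. -/
theorem cells_reduces (w : V) {m : ℕ} (hm : S.birth w ≤ m) (α : Real.Angle)
    (R : Multiset (Wire V)) :
    Reduces ((∑ k ∈ Finset.Ico (S.birth w) m,
      ({((.spider .Z (.on 0 ∅) : Kind V), S.entry w k + {.level 2 w k} + S.link w k)} +
        {(.spider .X (.on 0 ∅), {.level 2 w k} + {.level 1 w (k + 1)})})) +
      {(.spider .Z (.on α ∅), S.entry w m + R)})
      {(.spider .Z (.on α ∅), inputWire I w + ∑ k ∈ Finset.Ico (S.birth w) m, S.link w k + R)} := by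
  induction m, hm using Nat.le_induction generalizing R with
  | base => simpa [entry] using Reduces.refl _
  | succ m hm ih =>
    have h1 := reduces_identity .X (.spider .Z (.on α (∅ : Set V))) R (.level 2 w m)
      (.level 1 w (m + 1))
    have h2 := reduces_fuse .Z 0 α (∅ : Set V) (S.entry w m + S.link w m) R (.level 2 w m)
    rw [zero_add, add_assoc (S.entry w m) (S.link w m) R] at h2
    refine ((((h1.add_left _).trans h2).add_left _).trans (ih (S.link w m + R))).congr ?_ ?_
    · rw [Finset.sum_Ico_succ_top hm, add_right_comm (S.entry w m), S.entry_succ hm,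
        add_comm R]
      abel
    · rw [Finset.sum_Ico_succ_top hm]
      congr 2
      abel

/-- An earlier neighbour of `w` is not treated before `w` is born, by `birth_le_of_adj`, so its edge
is taken up by exactly one cell. This is where the third flow condition enters the circuit. -/
theorem sum_link (w : V) :
    ∑ k ∈ Finset.Ico (S.birth w) (S.time w), S.link w k =
      ∑ t with G.Adj w t ∧ S.time t < S.time w, {.edge 0 w t} := by
  have h : ∀ k ∈ Finset.Ico (S.birth w) (S.time w), S.link w k =
      ∑ t with G.Adj w t ∧ S.time t < S.time w, if S.time t = k then {.edge 0 w t} else 0 := by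
    intro k hk
    rw [link, ← Finset.sum_filter, Finset.filter_filter]
    refine Finset.sum_congr (Finset.filter_congr fun t _ => ?_) fun _ _ => rfl
    have := (Finset.mem_Ico.1 hk).2
    constructor
    · rintro ⟨h, rfl⟩
      exact ⟨⟨h, this⟩, rfl⟩
    · rintro ⟨⟨h, -⟩, rfl⟩
      exact ⟨h, rfl⟩
  rw [Finset.sum_congr rfl h, Finset.sum_comm]
  refine Finset.sum_congr rfl fun t ht => ?_
  simp only [Finset.mem_filter, Finset.mem_univ, true_and] at ht
  rw [Finset.sum_ite_eq, if_pos (Finset.mem_Ico.2 ⟨S.birth_le_of_adj w t ht.1 ht.2, ht.2⟩)]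

theorem sum_adj (w : V) :
    (∑ t with G.Adj w t ∧ S.time t < S.time w, {Wire.edge 0 w t} : Multiset (Wire V)) +
      ∑ t with G.Adj w t ∧ S.time w < S.time t, {Wire.edge 0 w t} =
      ∑ t with G.Adj w t, {Wire.edge 0 w t} := by
  rw [← Finset.sum_union]
  · refine Finset.sum_congr ?_ fun _ _ => rfl
    ext t
    simp only [Finset.mem_union, Finset.mem_filter, Finset.mem_univ, true_and]
    constructor
    · rintro (h | h) <;> exact h.1
    · intro h
      exact (lt_or_gt_of_ne (S.time_injective.ne h.ne)).symm.imp (⟨h, ·⟩) (⟨h, ·⟩)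
  · rw [Finset.disjoint_filter]
    exact fun t _ h h' => absurd h.2 h'.2.not_gt

/-- The term of the graph, in terms of the schedule. -/
noncomputable def graphStateTerm (θ b : V → Real.Angle) : Multiset (Kind V × Multiset (Wire V)) :=
  (∑ w, ({(.spider .Z (.on (θ w) ∅), inputWire I w +
    (∑ t with G.Adj w t, {.edge 0 w t}) + if w ∈ M then 0 else {.vertex 2 w})} +
    if w ∈ M then 0 else {(.spider .X (.on (b w) ∅), {.vertex 2 w} + {.vertex 1 w})})) +
    ∑ w, ∑ t with G.Adj w t ∧ S.time w < S.time t,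
      {(.hadamard, {Wire.edge 0 w t} + {Wire.edge 0 t w})}

/-- The two Hadamard vertices between the incoming and the outgoing part of a vertex cancel; so do
the two on an output wire. Incoming part, outgoing part and cells then fuse to the one vertex of the
graph state. -/
theorem expandedTerm_reduces (θ b : V → Real.Angle) :
    Reduces (S.expandedTerm θ b) (S.graphStateTerm θ b) := by
  rw [graphStateTerm, ← Finset.sum_add_distrib]
  refine .sum fun w _ => ?_
  have h1 : Reduces ((if w ∈ M then 0 else {(.hadamard, {.vertex 2 w} + {.vertex 7 w})}) +
      tail M b w) (if w ∈ M then 0 else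
        {(.spider .X (.on (b w) ∅), {.vertex 2 w} + {.vertex 1 w})}) := by
    by_cases hw : w ∈ M
    · simpa [hw, tail] using Reduces.refl _
    · have := reduces_hCancel (.spider .X (.on (b w) (∅ : Set V))) {Wire.vertex 1 w} (.vertex 2 w)
        (.vertex 7 w) (.vertex 8 w)
      rw [tail, if_neg hw, if_neg hw, if_neg hw]
      refine this.congr ?_ ?_
      · rw [add_comm {Wire.vertex 1 w}]
        abel
      · rw [add_comm]
  set Y : Multiset (Wire V) := if w ∈ M then 0 else {.vertex 2 w}
  have h2 := reduces_hCancel (.spider .Z (.on 0 (∅ : Set V)))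
    ((∑ t with G.Adj w t ∧ S.time w < S.time t, {.edge 0 w t}) + Y) (.vertex 5 w) (.vertex 6 w)
    (.vertex 9 w)
  have h3 := reduces_fuse .Z (θ w) 0 (∅ : Set V) (S.entry w (S.time w))
    ((∑ t with G.Adj w t ∧ S.time w < S.time t, {.edge 0 w t}) + Y) (.vertex 5 w)
  rw [add_zero] at h3
  have h4 := ((((h2.add_left _).trans h3).add_left _).trans
    (S.cells_reduces w (S.birth_le w) (θ w) _))
  rw [S.sum_link] at h4
  refine ((h4.add h1).add_right (∑ t with G.Adj w t ∧ S.time w < S.time t,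
        {(.hadamard, {Wire.edge 0 w t} + {Wire.edge 0 t w})})).congr ?_ ?_
  · rw [cells, add_comm {Wire.vertex 9 w} {Wire.vertex 6 w},
      add_assoc {Wire.vertex 9 w}, add_comm {Wire.vertex 9 w} (_ + Y)]
    abel
  · rw [← S.sum_adj w]
    congr 4
    abel

/-- The wires of the circuit that have no counterpart in the graph. -/
noncomputable def innerWires (w : V) : Multiset (Wire V) :=
  ∑ k ∈ Finset.Ico (S.birth w) (S.time w), ({.level 2 w k} + {.level 1 w (k + 1)}) +
    {.vertex 5 w} + {.vertex 6 w} + {.vertex 9 w} +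
    (if w ∈ M then 0 else {.vertex 7 w}) + if w ∈ M then 0 else {.vertex 8 w}

-- The first cell is entered by the input wire, if any, and each later place by the wire of the
-- preceding cell.
omit [Fintype V] in
theorem sum_entry (w : V) :
    ∑ k ∈ Finset.Ico (S.birth w) (S.time w), S.entry w k + S.entry w (S.time w) =
      inputWire I w + ∑ k ∈ Finset.Ico (S.birth w) (S.time w), {.level 1 w (k + 1)} := by
  induction S.time w, S.birth_le w using Nat.le_induction with
  | base => simp [entry_birth]
  | succ m hm ih =>
    rw [Finset.sum_Ico_succ_top hm, Finset.sum_Ico_succ_top hm, ih, S.entry_succ hm, add_assoc]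

/-- The summands are pairwise disjoint because `g` recovers the index from an element. -/
theorem nodup_sum {ι W : Type} {s : Finset ι} {f : ι → Multiset W} (h : ∀ i ∈ s, (f i).Nodup)
    (g : W → ι) (hg : ∀ i ∈ s, ∀ w ∈ f i, g w = i) : (∑ i ∈ s, f i).Nodup := by
  rw [Multiset.nodup_iff_count_le_one]
  intro w
  have h0 : ∀ i ∈ s, i ≠ g w → (f i).count w = 0 := fun i hi hne =>
    Multiset.count_eq_zero.2 fun hw => hne (hg i hi w hw).symm
  rw [Multiset.count_sum']
  by_cases hs : g w ∈ s
  · rw [Finset.sum_eq_single_of_mem _ hs h0]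
    exact Multiset.nodup_iff_count_le_one.1 (h _ hs) w
  · rw [Finset.sum_eq_zero fun i hi => h0 i hi fun hne => hs (hne ▸ hi)]
    exact zero_le_one

/-- Whether a wire is one of the inner wires of a circuit. -/
def _root_.ZX.Wire.IsInner : Wire V → Prop
  | .level _ _ _ => True
  | .vertex k _ => 5 ≤ k
  | .edge _ _ _ => False

omit [Fintype V] in
theorem mem_innerWires {w : V} {x : Wire V} (h : x ∈ S.innerWires w) :
    ((∃ k, x = .level 2 w k) ∨ ∃ k, x = .level 1 w (k + 1)) ∨
      ∃ k, 5 ≤ k ∧ x = .vertex k w := by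
  simp only [innerWires, Multiset.mem_add, Multiset.mem_sum, Multiset.mem_singleton] at h
  rcases h with ((((⟨k, -, h | h⟩ | h) | h) | h) | h) | h
  · exact .inl (.inl ⟨k, h⟩)
  · exact .inl (.inr ⟨k, h⟩)
  · exact .inr ⟨5, by simp, h⟩
  · exact .inr ⟨6, by simp, h⟩
  · exact .inr ⟨9, by simp, h⟩
  · by_cases hw : w ∈ M
    · simp [hw] at h
    · exact .inr ⟨7, by simp, by simpa [hw] using h⟩
  · by_cases hw : w ∈ M
    · simp [hw] at h
    · exact .inr ⟨8, by simp, by simpa [hw] using h⟩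

omit [Fintype V] in
theorem nodup_innerWires (w : V) : (S.innerWires w).Nodup := by
  have h1 : (∑ k ∈ Finset.Ico (S.birth w) (S.time w),
      ({.level 2 w k} + {.level 1 w (k + 1)} : Multiset (Wire V))).Nodup := by
    -- The cell at time `k` ends in the wire numbered `k + 1` at level 1, whence the subtraction.
    refine nodup_sum (fun k _ => ?_) (fun | .level 2 _ k => k | .level _ _ k => k - 1 | _ => 0)
      fun k _ x hx => ?_
    · rw [Multiset.nodup_add]
      simp
    · simp only [Multiset.mem_add, Multiset.mem_singleton] at hx
      rcases hx with rfl | rfl <;> rfl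
  have h2 : ({.vertex 5 w} + {.vertex 6 w} + {.vertex 9 w} + (if w ∈ M then 0 else {.vertex 7 w}) +
      if w ∈ M then 0 else {.vertex 8 w} : Multiset (Wire V)).Nodup := by
    by_cases hw : w ∈ M <;> simp [hw]
  have h3 : S.innerWires w = (∑ k ∈ Finset.Ico (S.birth w) (S.time w),
      ({.level 2 w k} + {.level 1 w (k + 1)} : Multiset (Wire V))) +
      ({.vertex 5 w} + {.vertex 6 w} + {.vertex 9 w} + (if w ∈ M then 0 else {.vertex 7 w}) +
      if w ∈ M then 0 else {.vertex 8 w}) := by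
    rw [innerWires]
    abel
  rw [h3, Multiset.nodup_add]
  refine ⟨h1, h2, Multiset.disjoint_left.2 fun {x} hx hx' => ?_⟩
  obtain ⟨k, -, hk⟩ := Multiset.mem_sum.1 hx
  have : ¬ ∃ k q, x = .vertex k q := by
    rintro ⟨k', q, rfl⟩
    simp at hk
  refine this ?_
  simp only [Multiset.mem_add, Multiset.mem_singleton] at hx'
  rcases hx' with (((h | h) | h) | h) | h
  · exact ⟨_, _, h⟩
  · exact ⟨_, _, h⟩
  · exact ⟨_, _, h⟩
  all_goals
    by_cases hw : w ∈ M
    · simp [hw] at h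
    · exact ⟨_, _, by simpa [hw] using h⟩

theorem wires_expandedTerm (θ b : V → Real.Angle) :
    wires (S.expandedTerm θ b) = wires (S.graphStateTerm θ b) +
      ((∑ w, S.innerWires w) + ∑ w, S.innerWires w) := by
  simp only [expandedTerm, graphStateTerm, wires_add, wires_sum, ← Finset.sum_add_distrib]
  refine Finset.sum_congr rfl fun w _ => ?_
  rw [← S.sum_adj w, ← S.sum_link w]
  simp only [cells, innerWires, wires_sum, wires_add, wires_singleton, Finset.sum_add_distrib]
  have h := S.sum_entry w
  generalize ∑ k ∈ Finset.Ico (S.birth w) (S.time w), S.entry w k = A at h ⊢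
  generalize S.entry w (S.time w) = A' at h ⊢
  ext x
  have h' := congrArg (Multiset.count x) h
  by_cases hw : w ∈ M
  · simp only [tail, hw, if_true, wires_zero, Multiset.count_add, Multiset.count_zero] at h' ⊢
    lia
  · simp only [tail, hw, if_false, wires_add, wires_singleton, Multiset.count_add] at h' ⊢
    lia

theorem card_hadamard_expandedTerm (θ b : V → Real.Angle) :
    ∀ x ∈ S.expandedTerm θ b, x.1 = .hadamard → Multiset.card x.2 = 2 := by
  intro x hx hH
  simp only [expandedTerm, cells, tail, Multiset.mem_sum, Multiset.mem_add,
    Multiset.mem_singleton] at hx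
  obtain ⟨w, -, hx⟩ := hx
  by_cases hw : w ∈ M
  · simp only [hw, if_true, Multiset.notMem_zero, or_false] at hx
    rcases hx with ((⟨k, -, rfl | rfl⟩ | rfl) | rfl) | rfl | rfl | ⟨t, -, rfl⟩ <;>
      first | rfl | cases hH
  · simp only [hw, if_false, Multiset.mem_add, Multiset.mem_singleton] at hx
    rcases hx with (((⟨k, -, rfl | rfl⟩ | rfl) | rfl) | rfl | (rfl | ⟨t, -, rfl⟩) | rfl) | rfl | rfl
      <;> first | rfl | cases hH

theorem not_isInner {θ b : V → Real.Angle} {x : Wire V} (hx : x ∈ wires (S.graphStateTerm θ b)) :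
    ¬ x.IsInner := by
  obtain ⟨y, hy, hx⟩ := mem_wires.1 hx
  simp only [graphStateTerm, Multiset.mem_sum, Multiset.mem_add, Multiset.mem_singleton] at hy
  have h2 : ∀ {w : V} {k}, k < 5 → ¬ (Wire.vertex k w).IsInner := fun h h' => absurd h' (by
    simpa [Wire.IsInner] using h)
  have hE : ∀ {w t : V}, ¬ (Wire.edge 0 w t).IsInner := fun h => h
  rcases hy with ⟨w, -, rfl | hy⟩ | ⟨w, -, t, -, rfl⟩
  · simp only [Multiset.mem_add, Multiset.mem_sum, Multiset.mem_singleton, mem_inputWire] at hx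
    rcases hx with (hx | ⟨t, -, rfl⟩) | hx
    · rw [hx.2]
      exact h2 (by simp)
    · exact hE
    · by_cases hw : w ∈ M
      · simp [hw] at hx
      · rw [if_neg hw, Multiset.mem_singleton] at hx
        rw [hx]
        exact h2 (by simp)
  · by_cases hw : w ∈ M
    · simp [hw] at hy
    · rw [if_neg hw, Multiset.mem_singleton] at hy
      rw [hy] at hx
      simp only [Multiset.mem_add, Multiset.mem_singleton] at hx
      rcases hx with rfl | rfl <;> exact h2 (by simp)
  · simp only [Multiset.mem_add, Multiset.mem_singleton] at hx
    rcases hx with rfl | rfl <;> exact hE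

omit [Fintype V] in
theorem isInner {w : V} {x : Wire V} (hx : x ∈ S.innerWires w) : x.IsInner := by
  rcases S.mem_innerWires hx with (⟨k, rfl⟩ | ⟨k, rfl⟩) | ⟨k, hk, rfl⟩
  · trivial
  · trivial
  · exact hk

/-- The inner wires are distinct, occur twice, and are recognised by name as absent from the graph
state and from the boundary. -/
theorem proper_expandedTerm {Δ : Type} [Finite Δ] {θ b : V → Real.Angle} {bd : Δ → Wire V}
    (h : Proper (S.graphStateTerm θ b) bd) (hbd : ∀ d, ¬ (bd d).IsInner) :
    Proper (S.expandedTerm θ b) bd := by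
  have hG : ∀ x ∈ ∑ w, S.innerWires w, x.IsInner := fun x hx =>
    have ⟨_, _, hx⟩ := Multiset.mem_sum.1 hx
    S.isInner hx
  rw [← zero_add (S.graphStateTerm θ b)] at h
  rw [← zero_add (S.expandedTerm θ b)]
  refine h.replace 0 (∑ w, S.innerWires w) ?_ ?_ ?_ ?_ (S.card_hadamard_expandedTerm θ b)
  · rw [add_zero, add_zero, S.wires_expandedTerm]
  · refine nodup_sum (fun w _ => S.nodup_innerWires w)
      (fun | .vertex _ q => q | .level _ q _ => q | .edge _ q _ => q) fun w _ x hx => ?_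
    rcases S.mem_innerWires hx with (⟨k, rfl⟩ | ⟨k, rfl⟩) | ⟨k, -, rfl⟩ <;> rfl
  · intro x hx
    rw [zero_add]
    exact fun hx' => S.not_isInner hx' (hG x hx)
  · rintro x hx d rfl
    exact hbd d (hG _ hx)

/-- Reductions only remove wires, so graph state and circuit are compared through the expanded term,
which reduces to both. -/
theorem exists_rewrites_circuit {Δ : Type} [Finite Δ] {θ b : V → Real.Angle} {bd : Δ → Wire V}
    {D : Diagram V Δ} (h : D.Described (S.graphStateTerm θ b) bd) (hbd : ∀ d, ¬ (bd d).IsInner) :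
    Proper (S.circuitTerm θ b) bd ∧
      ∀ D', D'.Described (S.circuitTerm θ b) bd → Rewrites D D' := by
  have h1 := S.proper_expandedTerm h.proper hbd
  have h2 := ((S.expandedTerm_reduces θ b).equates h1).symm.trans
    ((S.expandedTerm_reduces_circuitTerm θ b).equates h1)
  exact ⟨h2.right, fun D' hD' => h2.rewrites _ _ h hD'⟩

end Schedule

end Circuit

end ZX

/-! ### A schedule from a flow -/

namespace ZX

section FlowSchedule

open Classical

theorem exists_time {V : Type} [Finite V] (lt : V → V → Prop) [IsStrictOrder V lt] :
    ∃ time : V → ℕ, Function.Injective time ∧ ∀ u v, lt u v → time u < time v := by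
  cases nonempty_fintype V
  let _ : PartialOrder V := partialOrderOfSO lt
  have : Fintype (LinearExtension V) := inferInstanceAs (Fintype V)
  let e := Fintype.orderIsoFinOfCardEq (LinearExtension V) rfl
  have hinj : Function.Injective (toLinearExtension : V →o LinearExtension V) := fun _ _ h => h
  refine ⟨fun v => e.symm (toLinearExtension v), fun u v h => hinj (e.symm.injective (Fin.ext h)),
    fun u v h => ?_⟩
  have h' : u < v := h
  exact e.symm.strictMono ((toLinearExtension.monotone h'.le).lt_of_ne (hinj.ne h'.ne))

/-- If $f(u)=f(v)$ with $u\ne v$, both are neighbours of the common value, so the third flow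
condition gives $u\prec v$ and $v\prec u$. -/
theorem OpenGraph.Flow.injective {V : Type} {G : OpenGraph V} (F : G.Flow) :
    Function.Injective F.f := by
  intro u v h
  by_contra hne
  have := F.lt_strict
  have h1 : F.lt u.1 v.1 := F.lt_of_adj u v.1 (h ▸ F.adj v) (Subtype.coe_ne_coe.2 hne)
  have h2 : F.lt v.1 u.1 := F.lt_of_adj v u.1 (h ▸ F.adj u) (Subtype.coe_ne_coe.2 (Ne.symm hne))
  exact asymm h1 h2

/-- Times are positions in a linear extension of $\prec$. The wire of $f(u)$ starts at the time of
$u$, which is well defined as $f$ is injective. -/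
theorem OpenGraph.Flow.nonempty_schedule {V : Type} [Finite V] {G : OpenGraph V} (F : G.Flow) :
    Nonempty (Schedule G.graph G.inputs G.outputsᶜ) := by
  have := F.lt_strict
  obtain ⟨time, hinj, htime⟩ := exists_time F.lt
  -- Vertices outside the image of `f` start a path of their own and exist from time 0.
  let birth : V → ℕ := fun w => if h : ∃ u, (F.f u).1 = w then time h.choose.1 else 0
  have hbirth : ∀ u, birth (F.f u).1 = time u.1 := fun u => by
    have h : ∃ v, (F.f v).1 = (F.f u).1 := ⟨u, rfl⟩
    rw [show birth (F.f u).1 = time h.choose.1 from dif_pos h,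
      F.injective (Subtype.ext h.choose_spec)]
  have hbirth0 : ∀ w, (∃ u, (F.f u).1 = w) ∨ birth w = 0 := fun w => by
    by_cases h : ∃ u, (F.f u).1 = w
    · exact .inl h
    · exact .inr (dif_neg h)
  exact ⟨{
    time := time
    birth := birth
    next := fun w => if h : w ∈ G.outputsᶜ then (F.f ⟨w, h⟩).1 else w
    time_injective := hinj
    birth_le := fun w => by
      rcases hbirth0 w with ⟨u, rfl⟩ | h
      · rw [hbirth]
        exact (htime _ _ (F.lt_f u)).le
      · rw [h]
        exact Nat.zero_le _
    birth_le_of_adj := fun w t hadj _ => by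
      rcases hbirth0 w with ⟨u, rfl⟩ | h
      · rw [hbirth]
        -- For a neighbour `t` of `f u`, either `t = u` or $u\prec t$: the third flow condition.
        by_cases hut : u.1 = t
        · rw [hut]
        · exact (htime _ _ (F.lt_of_adj u t hadj hut)).le
      · rw [h]
        exact Nat.zero_le _
    next_adj := fun u hu => by
      rw [dif_pos hu]
      exact (F.adj ⟨u, hu⟩).symm
    next_notMem := fun u hu => by
      rw [dif_pos hu]
      exact (F.f ⟨u, hu⟩).2
    time_lt := fun u hu => by
      rw [dif_pos hu]
      exact htime _ _ (F.lt_f ⟨u, hu⟩)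
    birth_next := fun u hu => by
      rw [dif_pos hu]
      exact hbirth ⟨u, hu⟩ }⟩

theorem measuredTerm_eq {V : Type} [Fintype V] {G : SimpleGraph V} {I M : Set V}
    (S : Schedule G I M) {ps : List (V × V)} (hps : ∀ p ∈ ps, p.1 ≠ p.2)
    (hnd : (ps.map fun p => s(p.1, p.2)).Nodup)
    (hadj : ∀ u v, G.Adj u v ↔ s(u, v) ∈ ps.map fun p => s(p.1, p.2)) (θ b : V → Real.Angle) :
    measuredTerm I M ps θ b = S.graphStateTerm θ b := by
  rw [measuredTerm, Schedule.graphStateTerm, edgeHadamards_eq hnd hadj S.time_injective]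
  simp only [edgeWires_eq hps hnd hadj]

theorem Pattern.exists_rewrites_graphStateTerm {V : Type} [Fintype V] (P : Pattern V)
    (F : P.geometry.Flow) (hP : P.HasFlowCorrectors F) :
    ∃ (S : Schedule P.geometry.graph P.inputs P.outputsᶜ) (θ b : V → Real.Angle)
      (D : Diagram V (P.inputs ⊕ P.outputs)), Rewrites P.diagram D ∧
      D.Described (S.graphStateTerm θ b)
        (Sum.elim (fun q => .vertex 0 q) fun q => .vertex 1 q) := by
  obtain ⟨S⟩ : Nonempty (Schedule P.geometry.graph P.inputs P.outputsᶜ) := F.nonempty_schedule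
  obtain ⟨ps, θ, b, hps, hnd, hadj, D, hD, hD'⟩ := P.exists_rewrites_measuredTerm F hP
  refine ⟨S, θ, b, D, hD, ?_⟩
  have hM : {q | P.Measured q} = P.outputsᶜ := Set.ext fun q => not_not.symm
  rw [hM, measuredTerm_eq S hps hnd hadj] at hD'
  exact hD'

end FlowSchedule

end ZX

/-! ### Path decompositions and cycles -/

namespace ZX

section Paths

variable {T : Type} {R : T → T → Prop}

/-- In a chain that cannot be prolonged, the unique successor of a member is the next entry. -/
theorem infix_of_isChain (hfun : ∀ s t t', R s t → R s t' → t = t') {l : List T}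
    (hl : l.IsChain R) (hlast : ∀ e ∈ l.getLast?, ∀ t, ¬ R e t) {u v : T} (hu : u ∈ l)
    (huv : R u v) : [u, v] <:+: l := by
  induction l with
  | nil => cases hu
  | cons a l ih =>
    cases l with
    | nil =>
      rw [List.mem_singleton] at hu
      subst hu
      exact absurd huv (hlast _ (by simp) _)
    | cons b l =>
      rw [List.isChain_cons_cons] at hl
      rcases List.mem_cons.1 hu with rfl | hu
      · rw [hfun _ _ _ huv hl.1]
        exact ⟨[], l, rfl⟩
      · exact List.infix_cons (ih hl.2 (by simpa using hlast) hu)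

theorem eq_of_isChain (hfun : ∀ s t t', R s t → R s t' → t = t') {l l' : List T}
    (hl : l.IsChain R) (hl' : l'.IsChain R) (hlast : ∀ e ∈ l.getLast?, ∀ t, ¬ R e t)
    (hlast' : ∀ e ∈ l'.getLast?, ∀ t, ¬ R e t) (hne : l ≠ []) (hh : l.head? = l'.head?) :
    l = l' := by
  induction l generalizing l' with
  | nil => exact absurd rfl hne
  | cons a l ih =>
    cases l' with
    | nil => simp at hh
    | cons a' l' =>
      obtain rfl : a = a' := by simpa using hh
      cases l with
      | nil =>
        cases l' with
        | nil => rfl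
        | cons b' l' => exact absurd (List.isChain_cons_cons.1 hl').1 (hlast a (by simp) _)
      | cons b l =>
        cases l' with
        | nil => exact absurd (List.isChain_cons_cons.1 hl).1 (hlast' a (by simp) _)
        | cons b' l' =>
          rw [List.isChain_cons_cons] at hl hl'
          obtain rfl := hfun _ _ _ hl.1 hl'.1
          rw [ih hl.2 hl'.2 (by simpa using hlast) (by simpa using hlast') (by simp) (by simp)]

theorem head_or_exists_of_isChain {l : List T} (hl : l.IsChain R) {x : T} (hx : x ∈ l) :
    l.head? = some x ∨ ∃ u ∈ l, R u x := by
  induction l with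
  | nil => cases hx
  | cons a l ih =>
    rcases List.mem_cons.1 hx with rfl | hx
    · exact .inl rfl
    · cases l with
      | nil => cases hx
      | cons b l =>
        rw [List.isChain_cons_cons] at hl
        rcases ih hl.2 hx with h | ⟨u, hu, h⟩
        · obtain rfl : b = x := by simpa using h
          exact .inr ⟨a, by simp, hl.1⟩
        · exact .inr ⟨u, List.mem_cons_of_mem _ hu, h⟩

/-- A partial injective map along which a rank increases decomposes a finite type into paths. -/
theorem exists_paths [Finite T] (hfun : ∀ s t t', R s t → R s t' → t = t')
    (hinj : ∀ s s' t, R s t → R s' t → s = s') (rank : T → ℕ)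
    (hrank : ∀ s t, R s t → rank s < rank t) :
    ∃ Ps : Set (List T), (∀ p ∈ Ps, p.IsChain R) ∧ (∀ p ∈ Ps, p.Nodup) ∧
      (∀ p ∈ Ps, ∃ e, p.getLast? = some e ∧ ∀ t, ¬ R e t) ∧
      (∀ p ∈ Ps, ∀ q ∈ Ps, p ≠ q → p.Disjoint q) ∧ (∀ v, ∃ p ∈ Ps, v ∈ p) ∧
      ∀ u v, R u v → ∃ p ∈ Ps, [u, v] <:+: p := by
  obtain ⟨N, hN⟩ : ∃ N, ∀ t, rank t ≤ N := by
    obtain ⟨N, hN⟩ := (Set.finite_range rank).bddAbove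
    exact ⟨N, fun t => hN ⟨t, rfl⟩⟩
  -- Ranks are bounded by `N`, so following `R` forwards stops; the recursion is on `N - rank s`.
  have hfwd : ∀ n s, N - rank s = n → ∃ l : List T, l.IsChain R ∧ l.head? = some s ∧
      ∃ e, l.getLast? = some e ∧ ∀ t, ¬ R e t := by
    intro n
    induction n using Nat.strong_induction_on with
    | _ n ih =>
    intro s hs
    by_cases h : ∃ t, R s t
    · obtain ⟨t, ht⟩ := h
      have h1 := hrank s t ht
      have h2 := hN t
      obtain ⟨l, hl, hh, e, he, he'⟩ := ih _ (by lia) t rfl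
      cases l with
      | nil => simp at hh
      | cons b l =>
        obtain rfl : b = t := by simpa using hh
        exact ⟨s :: b :: l, List.isChain_cons_cons.2 ⟨ht, hl⟩, rfl, e, by simpa using he, he'⟩
    · exact ⟨[s], by simp, rfl, s, rfl, fun t ht => h ⟨t, ht⟩⟩
  -- The paths are the chains that can be prolonged at neither end.
  let Ps : Set (List T) := {p | p.IsChain R ∧ (∃ e, p.getLast? = some e ∧ ∀ t, ¬ R e t) ∧
    ∃ s, p.head? = some s ∧ ∀ t, ¬ R t s}
  have hlast : ∀ p ∈ Ps, ∀ e ∈ p.getLast?, ∀ t, ¬ R e t := by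
    rintro p ⟨-, ⟨e, he, he'⟩, -⟩ e' h
    rw [he, Option.mem_some_iff] at h
    exact h ▸ he'
  have hcover : ∀ n v, rank v = n → ∃ p ∈ Ps, v ∈ p := by
    intro n
    induction n using Nat.strong_induction_on with
    | _ n ih =>
    intro v hv
    by_cases h : ∃ u, R u v
    · obtain ⟨u, hu⟩ := h
      obtain ⟨p, hp, hup⟩ := ih _ (hv ▸ hrank u v hu) u rfl
      exact ⟨p, hp, (infix_of_isChain hfun hp.1 (hlast p hp) hup hu).subset (by simp)⟩
    · obtain ⟨l, hl, hh, he⟩ := hfwd _ v rfl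
      exact ⟨l, ⟨hl, he, v, hh, fun t ht => h ⟨t, ht⟩⟩, List.mem_of_mem_head? hh⟩
  -- Two chains that meet can be followed backwards together, by injectivity, until one reaches its
  -- head. It is then the head of the other as well, and the forward continuation is determined.
  have hdisj : ∀ p ∈ Ps, ∀ q ∈ Ps, ∀ n x, rank x = n → x ∈ p → x ∈ q → p = q := by
    intro p hp q hq n
    induction n using Nat.strong_induction_on with
    | _ n ih =>
    intro x hn hxp hxq
    rcases head_or_exists_of_isChain hp.1 hxp with h | ⟨u, hu, h⟩ <;>
      rcases head_or_exists_of_isChain hq.1 hxq with h' | ⟨u', hu', h'⟩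
    · refine eq_of_isChain hfun hp.1 hq.1 (hlast p hp) (hlast q hq) ?_ (h.trans h'.symm)
      rintro rfl
      cases hxp
    · obtain ⟨s, hs, hs'⟩ := hp.2.2
      obtain rfl : x = s := by simpa [h] using hs
      exact absurd h' (hs' _)
    · obtain ⟨s, hs, hs'⟩ := hq.2.2
      obtain rfl : x = s := by simpa [h'] using hs
      exact absurd h (hs' _)
    · obtain rfl := hinj _ _ _ h h'
      exact ih _ (hn ▸ hrank _ _ h) u rfl hu hu'
  refine ⟨Ps, fun p hp => hp.1, fun p hp => ?_, fun p hp => hp.2.1, fun p hp q hq hne x hxp hxq =>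
    hne (hdisj p hp q hq _ x rfl hxp hxq), fun v => hcover _ v rfl, fun u v huv => ?_⟩
  · have h1 : p.IsChain fun s t => rank s < rank t := hp.1.imp hrank
    have : IsTrans T fun s t => rank s < rank t := ⟨fun _ _ _ => lt_trans⟩
    rw [List.isChain_iff_pairwise] at h1
    exact h1.imp fun h he => absurd (congrArg rank he) h.ne
  · obtain ⟨p, hp, hup⟩ := hcover _ u rfl
    exact ⟨p, hp, infix_of_isChain hfun hp.1 (hlast p hp) hup huv⟩

/-- There is no cycle on which a level never decreases and whose steps within a level all meet a
centre of that level. -/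
theorem not_isCycle_of_level {G : SimpleGraph T} {v : T} (γ : G.Walk v v) (hγ : γ.IsCycle)
    (level : T → ℕ) (centre : ℕ → T)
    (h : ∀ d ∈ γ.darts, level d.fst ≤ level d.snd ∧ (level d.fst = level d.snd →
      d.fst = centre (level d.fst) ∨ d.snd = centre (level d.fst))) : False := by
  have hlen := hγ.three_le_length
  have hd : ∀ i, i < γ.length → level (γ.getVert i) ≤ level (γ.getVert (i + 1)) ∧
      (level (γ.getVert i) = level (γ.getVert (i + 1)) →
        γ.getVert i = centre (level (γ.getVert i)) ∨
          γ.getVert (i + 1) = centre (level (γ.getVert i))) := fun i hi => by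
    have hi' : i < γ.darts.length := by rwa [γ.length_darts]
    have := h γ.darts[i] (List.getElem_mem hi')
    have h1 : γ.darts[i].fst = γ.getVert i := by
      rw [SimpleGraph.Walk.fst_darts_getElem, List.getElem_dropLast,
        SimpleGraph.Walk.support_getElem_eq_getVert]
    have h2 : γ.darts[i].snd = γ.getVert (i + 1) := by
      rw [SimpleGraph.Walk.snd_darts_getElem, List.getElem_tail,
        SimpleGraph.Walk.support_getElem_eq_getVert]
    rwa [h1, h2] at this
  have hmono : ∀ i j, i ≤ j → j ≤ γ.length → level (γ.getVert i) ≤ level (γ.getVert j) := by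
    intro i j hij
    induction j, hij using Nat.le_induction with
    | base => exact fun _ => le_rfl
    | succ j hj ih => exact fun hl => (ih (by lia)).trans (hd j (by lia)).1
  -- A level that never decreases along a closed walk is constant.
  have hconst : ∀ i, i ≤ γ.length → level (γ.getVert i) = level v := fun i hi =>
    le_antisymm ((hmono i γ.length hi le_rfl).trans_eq (by rw [γ.getVert_length]))
      ((congrArg level γ.getVert_zero).symm.trans_le (hmono 0 i (Nat.zero_le _) hi))
  have hc : ∀ i, i < γ.length → γ.getVert i = centre (level v) ∨
      γ.getVert (i + 1) = centre (level v) := fun i hi => by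
    have := (hd i hi).2 (by rw [hconst i hi.le, hconst (i + 1) hi])
    rwa [hconst i hi.le] at this
  have hinj : ∀ i j, 1 ≤ i → i ≤ γ.length → 1 ≤ j → j ≤ γ.length → γ.getVert i = γ.getVert j →
      i = j := fun i j hi hi' hj hj' hij =>
    hγ.getVert_injOn (by exact ⟨hi, hi'⟩) (by exact ⟨hj, hj'⟩) hij
  have h0 : γ.getVert 0 = γ.getVert γ.length := by rw [γ.getVert_length, γ.getVert_zero]
  -- The steps 1–2 and 2–3 both meet the centre, and the vertices 1 and 3 differ because the length
  -- is at least three; so vertex 2 is the centre. The step 0–1 cannot meet it again.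
  have h2 : γ.getVert 2 = centre (level v) := by
    rcases hc 1 (by lia) with h1 | h1
    · rcases hc 2 (by lia) with h2 | h2
      · exact h2
      · exact absurd (hinj 1 3 (by lia) (by lia) (by lia) (by lia) (h1.trans h2.symm)) (by lia)
    · exact h1
  rcases hc 0 (by lia) with h1 | h1
  · exact absurd (hinj 2 γ.length (by lia) (by lia) (by lia) le_rfl
      ((h2.trans h1.symm).trans h0)) (by lia)
  · exact absurd (hinj 2 1 (by lia) (by lia) (by lia) (by lia) (h2.trans h1.symm)) (by lia)

end Paths

/-! ### Graph properties read off from terms -/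

section Terms

variable {𝒱 Δ N W : Type} [Finite N] [Finite Δ] {k : N → Kind 𝒱} {ws : N → Multiset W}
  {bd : Δ → W} (h : Proper (fam fun n => (k n, ws n)) bd)

/-- The name of the wire at a half-edge. -/
noncomputable def wireAt (ws : N → Multiset W) (bd : Δ → W) :
    (Σ n, Fin (ws n).toList.length) ⊕ Δ → W :=
  Sum.elim (fun p => occ (ws p.1) p.2) bd

/-- The vertex of a half-edge. -/
def siteAt (ws : N → Multiset W) : (Σ n, Fin (ws n).toList.length) ⊕ Δ → N ⊕ Δ :=
  Sum.map Sigma.fst id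

omit [Finite N] [Finite Δ] in
theorem mem_wiresAt {ws : N → Multiset W} {bd : Δ → W} {v : N ⊕ Δ} {w : W} :
    w ∈ Sum.elim ws (fun d => {bd d}) v ↔ ∃ x, siteAt ws x = v ∧ wireAt ws bd x = w := by
  rcases v with n | d
  · change w ∈ ws n ↔ _
    conv_lhs => rw [← fam_occ (ws n), mem_fam]
    constructor
    · rintro ⟨i, rfl⟩
      exact ⟨.inl ⟨n, i⟩, rfl, rfl⟩
    · rintro ⟨⟨n', i⟩ | d, hx, rfl⟩
      · obtain rfl : n' = n := Sum.inl_injective hx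
        exact ⟨i, rfl⟩
      · cases hx
  · change w ∈ {bd d} ↔ _
    rw [Multiset.mem_singleton]
    constructor
    · rintro rfl
      exact ⟨.inr d, rfl, rfl⟩
    · rintro ⟨x | d', hx, rfl⟩
      · cases hx
      · obtain rfl : d' = d := Sum.inr_injective hx
        rfl

omit [Finite N] [Finite Δ] in
theorem eq_of_siteAt_eq {ws : N → Multiset W} {bd : Δ → W} (hnd : ∀ n, (ws n).Nodup)
    {x y : (Σ n, Fin (ws n).toList.length) ⊕ Δ} (hxy : siteAt ws x = siteAt ws y)
    (hw : wireAt ws bd x = wireAt ws bd y) : x = y := by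
  rcases x with ⟨n, i⟩ | d <;> rcases y with ⟨n', j⟩ | d'
  · obtain rfl : n = n' := Sum.inl_injective hxy
    have h1 : (ws n).toList.Nodup := by
      rw [← Multiset.coe_nodup, Multiset.coe_toList]
      exact hnd n
    obtain rfl : i = j := h1.injective_get hw
    rfl
  · cases hxy
  · cases hxy
  · exact congrArg Sum.inr (Sum.inr_injective hxy)

theorem adj_ofTerm_iff {u v : N ⊕ Δ} :
    (Diagram.ofTerm k ws bd h).graph.Adj u v ↔ u ≠ v ∧ ∃ w,
      w ∈ Sum.elim ws (fun d => {bd d}) u ∧ w ∈ Sum.elim ws (fun d => {bd d}) v := by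
  refine and_congr_right fun hne => ?_
  constructor
  · rintro ⟨x, hx, hy⟩
    exact ⟨wireAt ws bd x, mem_wiresAt.2 ⟨x, hx, rfl⟩, mem_wiresAt.2 ⟨_, hy,
      ((Diagram.ofTerm_labelling k ws bd h x _).2 (.inr rfl)).symm⟩⟩
  · rintro ⟨w, hu, hv⟩
    obtain ⟨x, hx, rfl⟩ := mem_wiresAt.1 hu
    obtain ⟨y, hy, hxy⟩ := mem_wiresAt.1 hv
    refine ⟨x, hx, ?_⟩
    rcases (Diagram.ofTerm_labelling k ws bd h x y).1 hxy.symm with rfl | hl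
    · exact absurd (hx.symm.trans hy) hne
    · exact hl ▸ hy

/-- A self-loop would repeat a name at its vertex, and parallel edges would give two vertices two
common names. -/
theorem isSimple_ofTerm (hnd : ∀ n, (ws n).Nodup)
    (hone : ∀ u v : N ⊕ Δ, u ≠ v → ∀ w w', w ∈ Sum.elim ws (fun d => {bd d}) u →
      w ∈ Sum.elim ws (fun d => {bd d}) v → w' ∈ Sum.elim ws (fun d => {bd d}) u →
      w' ∈ Sum.elim ws (fun d => {bd d}) v → w = w') :
    (Diagram.ofTerm k ws bd h).IsSimple := by
  have hl : ∀ x, wireAt ws bd ((Diagram.ofTerm k ws bd h).link x) = wireAt ws bd x := fun x =>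
    ((Diagram.ofTerm_labelling k ws bd h x _).2 (.inr rfl)).symm
  have h1 : ∀ x, siteAt ws ((Diagram.ofTerm k ws bd h).link x) ≠ siteAt ws x := fun x hx =>
    (Diagram.ofTerm k ws bd h).link_ne x (eq_of_siteAt_eq hnd hx (hl x))
  refine ⟨h1, fun x y hxy hxy' => eq_of_siteAt_eq hnd hxy (bd := bd) ?_⟩
  exact hone _ _ (h1 x).symm _ _ (mem_wiresAt.2 ⟨x, rfl, rfl⟩) (mem_wiresAt.2 ⟨_, rfl, hl x⟩)
    (mem_wiresAt.2 ⟨y, hxy.symm, rfl⟩) (mem_wiresAt.2 ⟨_, hxy'.symm, hl y⟩)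

/-- Simplicity excludes that the two ends of an edge lie at the same vertex, a case which `hc` does
not cover. -/
theorem isThreeColoured_ofTerm (hc : ∀ m n w, w ∈ ws m → w ∈ ws n → m ≠ n →
      ¬ (k m).SameColour (k n)) (hs : (Diagram.ofTerm k ws bd h).IsSimple) :
    (Diagram.ofTerm k ws bd h).IsThreeColoured := by
  intro p q hpq
  have h1 := (Diagram.ofTerm_labelling k ws bd h (.inl p) (.inl q)).2 (.inr hpq.symm)
  refine hc p.1 q.1 (occ (ws p.1) p.2) ?_ ?_ fun hne => ?_
  · exact (mem_wiresAt (bd := bd) (v := .inl p.1)).2 ⟨.inl p, rfl, rfl⟩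
  · exact (mem_wiresAt (bd := bd) (v := .inl q.1)).2 ⟨.inl q, rfl, h1.symm⟩
  · refine hs.1 (.inl p) ?_
    rw [hpq]
    exact congrArg Sum.inl hne.symm

end Terms

end ZX

/-! ### The sites of the circuit and the links between them -/

namespace ZX

/-- The vertices of a circuit. -/
inductive Site (V : Type) where
  | input (w : V)
  | cellZ (w : V) (k : ℕ)
  | cellX (w : V) (k : ℕ)
  | main (w : V)
  | conj (w : V)
  | branch (w : V)
  | unconj (w : V)
  | correct (w : V)
  | output (w : V)

theorem Kind.SameColour.symm {𝒱 : Type} : ∀ {k k' : Kind 𝒱}, k.SameColour k' → k'.SameColour k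
  | .spider _ _, .spider _ _, h => Eq.symm h
  | .hadamard, .hadamard, h => h

namespace Schedule

open Classical

variable {V : Type} {G : SimpleGraph V} {I M : Set V} (S : Schedule G I M)

/-- Whether the site occurs in the circuit. -/
def Valid : Site V → Prop
  | .input w => w ∈ I
  | .cellZ w k => S.birth w ≤ k ∧ k < S.time w
  | .cellX w k => S.birth w ≤ k ∧ k < S.time w
  | .main _ => True
  | .conj _ => True
  | .branch _ => True
  | .unconj w => w ∉ M
  | .correct w => w ∉ M
  | .output w => w ∉ M

/-- The site on the wire of `w` at the time `k`. -/
noncomputable def siteAtTime (w : V) (k : ℕ) : Site V := if k < S.time w then .cellZ w k else .main w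

/-- The wires `x` of a circuit, with their two ends in the direction of the flow. -/
inductive Link : Wire V → Site V → Site V → Prop
  | input (w : V) (h : w ∈ I) : Link (.vertex 0 w) (.input w) (S.siteAtTime w (S.birth w))
  | cell (w : V) (k : ℕ) (h : S.birth w ≤ k) (h' : k < S.time w) :
      Link (.level 2 w k) (.cellZ w k) (.cellX w k)
  | step (w : V) (k : ℕ) (h : S.birth w ≤ k) (h' : k < S.time w) :
      Link (.level 1 w (k + 1)) (.cellX w k) (S.siteAtTime w (k + 1))
  | main (w : V) : Link (.vertex 5 w) (.main w) (.conj w)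
  | conj (w : V) : Link (.vertex 6 w) (.conj w) (.branch w)
  | branch (w : V) (h : w ∉ M) : Link (.vertex 7 w) (.branch w) (.unconj w)
  | unconj (w : V) (h : w ∉ M) : Link (.vertex 8 w) (.unconj w) (.correct w)
  | correct (w : V) (h : w ∉ M) : Link (.vertex 1 w) (.correct w) (.output w)
  | edge (w t : V) (h : G.Adj w t) (h' : S.time t < S.time w) :
      Link (.edge 0 w t) (.branch t) (.cellZ w (S.time t))

/-- The wire from one site to another. -/
def wireBetween : Site V → Site V → Wire V
  | .input w, _ => .vertex 0 w
  | .cellZ w k, _ => .level 2 w k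
  | .cellX w k, _ => .level 1 w (k + 1)
  | .main w, _ => .vertex 5 w
  | .conj w, _ => .vertex 6 w
  | .branch t, .cellZ w _ => .edge 0 w t
  | .branch w, _ => .vertex 7 w
  | .unconj w, _ => .vertex 8 w
  | .correct w, _ => .vertex 1 w
  | .output w, _ => .vertex 0 w

/-- The position of a site along the paths. -/
def rank : Site V → ℕ
  | .input _ => 0
  | .cellZ _ k => 5 * k + 5
  | .cellX _ k => 5 * k + 6
  | .main w => 5 * S.time w + 2
  | .conj w => 5 * S.time w + 3
  | .branch w => 5 * S.time w + 4
  | .unconj w => 5 * S.time w + 5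
  | .correct w => 5 * S.time w + 6
  | .output w => 5 * S.time w + 7

/-- The causal level of a site. -/
def level : Site V → ℕ
  | .input _ => 0
  | .cellZ _ k => 4 * k + 4
  | .cellX _ k => 4 * k + 5
  | .main w => 4 * S.time w + 2
  | .conj w => 4 * S.time w + 3
  | .branch w => 4 * S.time w + 4
  | .unconj w => 4 * S.time w + 5
  | .correct w => 4 * S.time w + 6
  | .output w => 4 * S.time w + 7

/-- The next site along the paths. -/
noncomputable def succ : Site V → Option (Site V)
  | .input w => some (S.siteAtTime w (S.birth w))
  | .cellZ w k => some (.cellX w k)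
  | .cellX w k => some (S.siteAtTime w (k + 1))
  | .main w => some (.conj w)
  | .conj w => some (.branch w)
  | .branch w => some (if w ∈ M then .cellZ (S.next w) (S.time w) else .unconj w)
  | .unconj w => some (.correct w)
  | .correct w => some (.output w)
  | .output _ => none

/-- The vertex types of the circuit. -/
noncomputable def siteKind (θ b : V → Real.Angle) : Site V → Kind V
  | .cellZ _ _ => .spider .Z (.on 0 ∅)
  | .cellX _ _ => .spider .X (.on 0 ∅)
  | .main w => .spider .Z (.on (θ w) ∅)
  | .conj _ => .hadamard
  | .branch _ => .spider .X (.on 0 ∅)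
  | .unconj _ => .hadamard
  | .correct w => .spider .X (.on (b w) ∅)
  -- Inputs and outputs are boundary vertices; their types here are dummies.
  | .input _ => .hadamard
  | .output _ => .hadamard

variable {S}

theorem siteAtTime_cases {w : V} {k : ℕ} (hk : k ≤ S.time w) :
    (S.siteAtTime w k = .cellZ w k ∧ k < S.time w) ∨
      (S.siteAtTime w k = .main w ∧ k = S.time w) := by
  by_cases h : k < S.time w
  · exact .inl ⟨if_pos h, h⟩
  · exact .inr ⟨if_neg h, by lia⟩

namespace Link

variable {x x' : Wire V} {s s' t t' : Site V}

theorem unique (h : S.Link x s t) (h' : S.Link x s' t') : s = s' ∧ t = t' := by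
  cases h <;> cases h' <;> exact ⟨rfl, rfl⟩

theorem eq_wireBetween (h : S.Link x s t) : x = wireBetween s t := by
  cases h <;> rfl

/-- A branch at time `k` has rank `5 * k + 4` and precedes the cells of time `k`, with ranks `5 * k
+ 5` and `5 * k + 6`; these precede a main vertex of time `k + 1`, which has rank `5 * k + 7`. -/
theorem rank_lt (h : S.Link x s t) : S.rank s < S.rank t := by
  cases h with
  | input w h => rcases siteAtTime_cases (S.birth_le w) with h | h <;> rw [h.1] <;> simp [rank]
  | step w k h h' =>
    rcases siteAtTime_cases (S := S) (w := w) (k := k + 1) (by lia) with h | h <;> rw [h.1] <;>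
      simp only [rank] <;> lia
  | _ => simp only [rank]; lia

/-- In contrast to the rank, the level puts a branch treated at time `k` on a par with the `Z` cells
of time `k`, so edges of the graph stay within a level. All other links raise it. -/
theorem level_le (h : S.Link x s t) : S.level s ≤ S.level t ∧ (S.level s = S.level t →
    ∃ w, s = .branch w) := by
  cases h with
  | input w h =>
    rcases siteAtTime_cases (S.birth_le w) with h | h <;> rw [h.1] <;> simp [level]
  | step w k h h' =>
    rcases siteAtTime_cases (S := S) (w := w) (k := k + 1) (by lia) with h | h <;> rw [h.1] <;>
      simp only [level] <;> exact ⟨by lia, fun _ => by lia⟩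
  | edge w t => exact ⟨le_rfl, fun _ => ⟨t, rfl⟩⟩
  | branch w => exact ⟨by simp [level], fun _ => ⟨w, rfl⟩⟩
  | _ => simp only [level]; exact ⟨by lia, fun _ => by lia⟩

/-- An `edge` link stays within its level, whether or not it is a path step; all other links are
path steps. Hence a link traversed backwards either opposes a path or does not change the level. -/
theorem succ_or (h : S.Link x s t) : S.succ s = some t ∨ S.level s = S.level t := by
  cases h with
  | branch w h => exact .inl (congrArg some (if_neg h))
  | edge w t => exact .inr rfl
  | _ => exact .inl rfl

theorem right_valid (h : S.Link x s t) : S.Valid t := by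
  cases h with
  | input w h =>
    rcases siteAtTime_cases (S.birth_le w) with h | h <;> rw [h.1]
    · exact ⟨le_rfl, h.2⟩
    · trivial
  | step w k h h' =>
    rcases siteAtTime_cases (S := S) (w := w) (k := k + 1) (by lia) with h1 | h1 <;> rw [h1.1]
    · exact ⟨by lia, h1.2⟩
    · trivial
  | edge w t h h' => exact ⟨S.birth_le_of_adj w t h h', h'⟩
  | _ => first | assumption | trivial

theorem not_sameColour (h : S.Link x s t) (hs : ∀ w, s ≠ .input w) (ht : ∀ w, t ≠ .output w)
    (θ b : V → Real.Angle) : ¬ (siteKind θ b s).SameColour (siteKind θ b t) := by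
  cases h with
  | input w => exact absurd rfl (hs w)
  | correct w => exact absurd rfl (ht w)
  | step w k h h' =>
    rcases siteAtTime_cases (S := S) (w := w) (k := k + 1) (by lia) with h1 | h1 <;> rw [h1.1] <;>
      simp [siteKind, Kind.SameColour]
  | _ => simp [siteKind, Kind.SameColour]

/-- The one step that is not built into the wire of a qubit leads from the branch of a measured `w`
to a cell of `next w`; it is an edge of the graph by `next_adj` and `time_lt`. -/
theorem of_succ (hs : S.Valid s) (h : S.succ s = some t) : ∃ x, S.Link x s t := by
  cases s with
  | output w => cases h
  | branch w =>
    obtain rfl := Option.some_injective _ h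
    by_cases hw : w ∈ M
    · rw [if_pos hw]
      exact ⟨_, .edge _ _ (S.next_adj w hw).symm (S.time_lt w hw)⟩
    · rw [if_neg hw]
      exact ⟨_, .branch w hw⟩
  | _ =>
    obtain rfl := Option.some_injective _ h
    first
    | exact ⟨_, .input _ hs⟩
    | exact ⟨_, .cell _ _ hs.1 hs.2⟩
    | exact ⟨_, .step _ _ hs.1 hs.2⟩
    | exact ⟨_, .main _⟩
    | exact ⟨_, .conj _⟩
    | exact ⟨_, .unconj _ hs⟩
    | exact ⟨_, .correct _ hs⟩

end Link

/-- An explicit predecessor function recovers `s` from `t`. Only the first cell of a vertex needs an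
argument: it is entered from the input or from a branch, not from both by `next_notMem`. -/
theorem succ_injective {s s' t : Site V} (hs : S.Valid s) (hs' : S.Valid s')
    (h : S.succ s = some t) (h' : S.succ s' = some t) : s = s' := by
  have key : ∀ {s t : Site V}, S.Valid s → S.succ s = some t →
      s = (match t with
        | .input w => .input w
        | .cellZ w k => if k = S.birth w then
            if w ∈ I then .input w else if h : ∃ u ∈ M, S.next u = w then .branch h.choose else .input w
            else .cellX w (k - 1)
        | .cellX w k => .cellZ w k
        | .main w => if S.time w = S.birth w then .input w else .cellX w (S.time w - 1)
        | .conj w => .main w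
        | .branch w => .conj w
        | .unconj w => .branch w
        | .correct w => .unconj w
        | .output w => .correct w) := by
    intro s t hs h
    cases s with
    | output w => cases h
    | branch w =>
      obtain rfl := Option.some_injective _ h
      by_cases hw : w ∈ M
      · have h1 : ∃ u ∈ M, S.next u = S.next w := ⟨w, hw, rfl⟩
        simp only [if_pos hw, S.birth_next w hw, if_true, if_neg (S.next_notMem w hw), dif_pos h1]
        congr 1
        -- `next` is injective on measured vertices, because the birth of `next u` is the time of
        -- `u`.
        apply S.time_injective
        rw [← S.birth_next w hw, ← S.birth_next _ h1.choose_spec.1, h1.choose_spec.2]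
      · simp only [if_neg hw]
    | input w =>
      obtain rfl := Option.some_injective _ h
      rcases siteAtTime_cases (S.birth_le w) with h | h <;> rw [h.1]
      · have hw : w ∈ I := hs
        simp [hw]
      · simp [h.2]
    | cellX w k =>
      obtain rfl := Option.some_injective _ h
      have h1 := hs.1
      have h2 := hs.2
      rcases siteAtTime_cases (S := S) (w := w) (k := k + 1) (by lia) with h | h <;> rw [h.1]
      · simp only
        rw [if_neg (by lia), Nat.add_sub_cancel]
      · simp only
        rw [if_neg (by lia), ← h.2, Nat.add_sub_cancel]
    | _ =>
      obtain rfl := Option.some_injective _ h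
      rfl
  exact (key hs h).trans (key hs' h').symm

theorem succ_eq_none {s : Site V} (h : S.succ s = none) : ∃ w, s = .output w := by
  cases s <;> first | exact ⟨_, rfl⟩ | cases h

end Schedule

end ZX

/-! ### Wires at the sites, and the circuit term as a family indexed by sites -/

namespace ZX

namespace Schedule

open Classical

section Wires

variable {V : Type} [Fintype V] {G : SimpleGraph V} {I M : Set V} (S : Schedule G I M)

/-- The wires that end at a site. -/
noncomputable def siteWires : Site V → Multiset (Wire V)
  | .input w => {.vertex 0 w}
  | .cellZ w k => S.entry w k + {.level 2 w k} + S.link w k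
  | .cellX w k => {.level 2 w k} + {.level 1 w (k + 1)}
  | .main w => S.entry w (S.time w) + {.vertex 5 w}
  | .conj w => {.vertex 5 w} + {.vertex 6 w}
  | .branch w => {.vertex 6 w} + S.fan w + if w ∈ M then 0 else {.vertex 7 w}
  | .unconj w => {.vertex 7 w} + {.vertex 8 w}
  | .correct w => {.vertex 8 w} + {.vertex 1 w}
  | .output w => {.vertex 1 w}

variable {S}

omit [Fintype V] in
theorem mem_entry {w : V} {k : ℕ} {x : Wire V} :
    x ∈ S.entry w k ↔ k = S.birth w ∧ w ∈ I ∧ x = .vertex 0 w ∨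
      k ≠ S.birth w ∧ x = .level 1 w k := by
  by_cases h : k = S.birth w <;> simp [entry, h, mem_inputWire]

theorem mem_link {w : V} {k : ℕ} {x : Wire V} :
    x ∈ S.link w k ↔ ∃ t, (G.Adj w t ∧ S.time t = k) ∧ x = .edge 0 w t := by
  simp [link, Multiset.mem_sum]

theorem mem_fan {w : V} {x : Wire V} :
    x ∈ S.fan w ↔ ∃ t, (G.Adj w t ∧ S.time w < S.time t) ∧ x = .edge 0 t w := by
  simp [fan, Multiset.mem_sum]

/-- With `Link.mem` this shows that the lists of wires at the sites and the list of links describe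
the same graph. -/
theorem link_of_mem {s : Site V} (hs : S.Valid s) {x : Wire V} (hx : x ∈ S.siteWires s) :
    ∃ t, S.Link x s t ∨ S.Link x t s := by
  have hstep : ∀ {w k}, S.birth w ≤ k → k ≠ S.birth w → k ≤ S.time w →
      S.Link (.level 1 w k) (.cellX w (k - 1)) (S.siteAtTime w k) := fun {w k} h h' h'' => by
    obtain ⟨m, rfl⟩ : ∃ m, k = m + 1 := ⟨k - 1, by lia⟩
    exact .step w m (by lia) (by lia)
  cases s with
  | input w =>
    obtain rfl := Multiset.mem_singleton.1 hx
    exact ⟨_, .inl (.input w hs)⟩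
  | cellZ w k =>
    have hk : S.siteAtTime w k = .cellZ w k := if_pos hs.2
    simp only [siteWires, Multiset.mem_add, Multiset.mem_singleton, mem_entry, mem_link] at hx
    rcases hx with ((⟨rfl, hw, rfl⟩ | ⟨h, rfl⟩) | rfl) | ⟨t, ⟨h, rfl⟩, rfl⟩
    · exact ⟨_, .inr (by rw [← hk]; exact .input w hw)⟩
    · exact ⟨_, .inr (by rw [← hk]; exact hstep hs.1 h hs.2.le)⟩
    · exact ⟨_, .inl (.cell w k hs.1 hs.2)⟩
    · exact ⟨_, .inr (.edge w t h hs.2)⟩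
  | cellX w k =>
    simp only [siteWires, Multiset.mem_add, Multiset.mem_singleton] at hx
    rcases hx with rfl | rfl
    · exact ⟨_, .inr (.cell w k hs.1 hs.2)⟩
    · exact ⟨_, .inl (.step w k hs.1 hs.2)⟩
  | main w =>
    have hk : S.siteAtTime w (S.time w) = .main w := if_neg (lt_irrefl _)
    simp only [siteWires, Multiset.mem_add, Multiset.mem_singleton, mem_entry] at hx
    rcases hx with (⟨h, hw, rfl⟩ | ⟨h, rfl⟩) | rfl
    · exact ⟨_, .inr (by rw [← hk, h]; exact .input w hw)⟩
    · exact ⟨_, .inr (by rw [← hk]; exact hstep (S.birth_le w) h le_rfl)⟩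
    · exact ⟨_, .inl (.main w)⟩
  | conj w =>
    simp only [siteWires, Multiset.mem_add, Multiset.mem_singleton] at hx
    rcases hx with rfl | rfl
    · exact ⟨_, .inr (.main w)⟩
    · exact ⟨_, .inl (.conj w)⟩
  | branch w =>
    simp only [siteWires, Multiset.mem_add, Multiset.mem_singleton, mem_fan] at hx
    rcases hx with (rfl | ⟨t, ⟨h, h'⟩, rfl⟩) | hx
    · exact ⟨_, .inr (.conj w)⟩
    · exact ⟨_, .inl (.edge t w h.symm h')⟩
    · by_cases hw : w ∈ M
      · simp [hw] at hx
      · rw [if_neg hw, Multiset.mem_singleton] at hx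
        exact hx ▸ ⟨_, .inl (.branch w hw)⟩
  | unconj w =>
    simp only [siteWires, Multiset.mem_add, Multiset.mem_singleton] at hx
    rcases hx with rfl | rfl
    · exact ⟨_, .inr (.branch w hs)⟩
    · exact ⟨_, .inl (.unconj w hs)⟩
  | correct w =>
    simp only [siteWires, Multiset.mem_add, Multiset.mem_singleton] at hx
    rcases hx with rfl | rfl
    · exact ⟨_, .inr (.unconj w hs)⟩
    · exact ⟨_, .inl (.correct w hs)⟩
  | output w =>
    obtain rfl := Multiset.mem_singleton.1 hx
    exact ⟨_, .inr (.correct w hs)⟩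

theorem Link.mem {x : Wire V} {s t : Site V} (h : S.Link x s t) :
    x ∈ S.siteWires s ∧ x ∈ S.siteWires t := by
  cases h with
  | input w h =>
    rcases siteAtTime_cases (S.birth_le w) with h1 | h1 <;> rw [h1.1]
    · simp [siteWires, mem_entry, h]
    · simp [siteWires, mem_entry, h, h1.2]
  | step w k h h' =>
    rcases siteAtTime_cases (S := S) (w := w) (k := k + 1) (by lia) with h1 | h1 <;> rw [h1.1]
    · have : k + 1 ≠ S.birth w := by lia
      simp [siteWires, mem_entry, this]
    · have : S.time w ≠ S.birth w := by lia
      simp [siteWires, mem_entry, this, h1.2]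
  | edge w t h h' => simp [siteWires, mem_fan, mem_link, h, h.symm, h']
  | _ => simp_all [siteWires]

/-- Each site is one end of the wire `x`, and a wire name determines both ends of its link. -/
theorem link_of_mem_of_mem {s t : Site V} (hs : S.Valid s) (ht : S.Valid t) (hne : s ≠ t)
    {x : Wire V} (hx : x ∈ S.siteWires s) (hx' : x ∈ S.siteWires t) :
    S.Link x s t ∨ S.Link x t s := by
  obtain ⟨s', h | h⟩ := link_of_mem hs hx <;> obtain ⟨t', h' | h'⟩ := link_of_mem ht hx'
  · exact absurd (h.unique h').1 hne
  · exact .inl ((h.unique h').2 ▸ h)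
  · exact .inr ((h.unique h').1 ▸ h)
  · exact absurd (h.unique h').2 hne

/-- The ends of a link determine its name through `wireBetween`, and the rank rules out two links in
opposite directions. Hence there are no parallel edges. -/
theorem eq_of_mem_of_mem {s t : Site V} (hs : S.Valid s) (ht : S.Valid t) (hne : s ≠ t)
    {x y : Wire V} (hx : x ∈ S.siteWires s) (hx' : x ∈ S.siteWires t) (hy : y ∈ S.siteWires s)
    (hy' : y ∈ S.siteWires t) : x = y := by
  rcases link_of_mem_of_mem hs ht hne hx hx' with h | h <;>
    rcases link_of_mem_of_mem hs ht hne hy hy' with h' | h'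
  · exact h.eq_wireBetween.trans h'.eq_wireBetween.symm
  · exact absurd h.rank_lt h'.rank_lt.not_gt
  · exact absurd h.rank_lt h'.rank_lt.not_gt
  · exact h.eq_wireBetween.trans h'.eq_wireBetween.symm

theorem nodup_siteWires (s : Site V) : (S.siteWires s).Nodup := by
  have hentry : ∀ w k, (S.entry w k).Nodup := fun w k => by
    by_cases h : k = S.birth w
    · by_cases hw : w ∈ I <;> simp [entry, h, inputWire, hw]
    · simp [entry, h]
  have hlink : ∀ w k, (S.link w k).Nodup := fun w k =>
    nodup_sum (fun _ _ => Multiset.nodup_singleton _) (fun | .edge _ _ t => t | _ => w)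
      fun t _ x hx => by rw [Multiset.mem_singleton.1 hx]
  have hfan : ∀ w, (S.fan w).Nodup := fun w =>
    nodup_sum (fun _ _ => Multiset.nodup_singleton _) (fun | .edge _ t _ => t | _ => w)
      fun t _ x hx => by rw [Multiset.mem_singleton.1 hx]
  cases s with
  | cellZ w k =>
    refine Multiset.nodup_add.2 ⟨Multiset.nodup_add.2 ⟨hentry w k, by simp, ?_⟩, hlink w k, ?_⟩
    · rw [Multiset.disjoint_singleton, mem_entry]
      simp
    · rw [Multiset.disjoint_left]
      simp only [Multiset.mem_add, Multiset.mem_singleton, mem_entry, mem_link]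
      rintro x hx ⟨t, -, rfl⟩
      simp at hx
  | main w =>
    refine Multiset.nodup_add.2 ⟨hentry _ _, by simp, ?_⟩
    rw [Multiset.disjoint_singleton, mem_entry]
    simp
  | branch w =>
    refine Multiset.nodup_add.2 ⟨Multiset.nodup_add.2 ⟨by simp, hfan w, ?_⟩, ?_, ?_⟩
    · rw [Multiset.singleton_disjoint, mem_fan]
      simp
    · by_cases hw : w ∈ M <;> simp [hw]
    · by_cases hw : w ∈ M
      · rw [if_pos hw]
        exact Multiset.disjoint_left.2 fun {_} _ h => absurd h (Multiset.notMem_zero _)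
      · rw [if_neg hw, Multiset.disjoint_singleton, Multiset.mem_add, mem_fan]
        simp
  | _ => simp [siteWires]

end Wires

section Places

variable {V : Type} [Fintype V] {G : SimpleGraph V} {I M : Set V} (S : Schedule G I M)

/-- The sites of the interior vertices of the circuit. -/
abbrev Place : Type :=
  Σ w : V, ({k // k ∈ Finset.Ico (S.birth w) (S.time w)} × Bool) ⊕
    ((Unit ⊕ Unit ⊕ Unit) ⊕ ({_u : Unit // w ∉ M} × Bool))

/-- The site of an interior vertex. -/
def site : S.Place → Site V
  | ⟨w, .inl (k, true)⟩ => .cellZ w k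
  | ⟨w, .inl (k, false)⟩ => .cellX w k
  | ⟨w, .inr (.inl (.inl _))⟩ => .main w
  | ⟨w, .inr (.inl (.inr (.inl _)))⟩ => .conj w
  | ⟨w, .inr (.inl (.inr (.inr _)))⟩ => .branch w
  | ⟨w, .inr (.inr (_, true))⟩ => .unconj w
  | ⟨w, .inr (.inr (_, false))⟩ => .correct w

theorem fam_finset {ι α : Type} (s : Finset ι) (g : ι → α) :
    (fam fun k : {k // k ∈ s} => g k) = ∑ k ∈ s, {g k} :=
  (fam_eq_sum _).trans (Finset.sum_coe_sort s fun k => ({g k} : Multiset α))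

theorem fam_site {α : Type} (f : Site V → α) :
    (fam fun n : S.Place => f (S.site n)) =
      ∑ w, (∑ k ∈ Finset.Ico (S.birth w) (S.time w), ({f (.cellZ w k)} + {f (.cellX w k)}) +
        {f (.main w)} + {f (.conj w)} + {f (.branch w)} +
        if w ∈ M then 0 else {f (.unconj w)} + {f (.correct w)}) := by
  rw [fam_sigma, fam_eq_map]
  refine Finset.sum_congr rfl fun w _ => ?_
  have h1 : ∀ g : V → α, (fam fun _ : {_u : Unit // w ∉ M} => g w) =
      if w ∈ M then 0 else {g w} := fun g => by
    rw [fam_subtype (fun _ : Unit => w ∉ M) fun _ => g w]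
    by_cases hw : w ∈ M <;> simp [hw]
  rw [fam_sum, fam_sum, fam_prod_bool, fam_prod_bool, fam_sum, fam_sum, fam_unit, fam_unit,
    fam_unit]
  simp only [site]
  rw [fam_finset _ fun k => f (.cellZ w k), fam_finset _ fun k => f (.cellX w k),
    h1 fun w => f (.unconj w), h1 fun w => f (.correct w), Finset.sum_add_distrib]
  by_cases hw : w ∈ M
  · simp only [hw, if_true]
    abel
  · simp only [hw, if_false]
    abel

theorem fam_site_eq_circuitTerm (θ b : V → Real.Angle) :
    (fam fun n : S.Place => (siteKind θ b (S.site n), S.siteWires (S.site n))) =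
      S.circuitTerm θ b :=
  S.fam_site fun s => (siteKind θ b s, S.siteWires s)

variable {S}

omit [Fintype V] in
theorem site_injective : Function.Injective S.site := by
  rintro ⟨w, (⟨k, _ | _⟩ | ((_ | _ | _) | ⟨⟨_, _⟩, _ | _⟩))⟩
    ⟨w', (⟨k', _ | _⟩ | ((_ | _ | _) | ⟨⟨_, _⟩, _ | _⟩))⟩ h <;>
    simp only [site, reduceCtorEq, Site.cellZ.injEq, Site.cellX.injEq, Site.main.injEq,
      Site.conj.injEq, Site.branch.injEq, Site.unconj.injEq, Site.correct.injEq] at h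
  · obtain ⟨rfl, h⟩ := h
    rw [Subtype.ext h]
  · obtain ⟨rfl, h⟩ := h
    rw [Subtype.ext h]
  all_goals
    obtain rfl := h
    rfl

omit [Fintype V] in
theorem valid_site (n : S.Place) : S.Valid (S.site n) := by
  rcases n with ⟨w, (⟨k, _ | _⟩ | ((_ | _ | _) | ⟨h, _ | _⟩))⟩
  · exact Finset.mem_Ico.1 k.2
  · exact Finset.mem_Ico.1 k.2
  · trivial
  · trivial
  · trivial
  · exact h.2
  · exact h.2

omit [Fintype V] in
theorem exists_site_eq {s : Site V} (hs : S.Valid s) :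
    (∃ n, S.site n = s) ∨ (∃ w ∈ I, s = .input w) ∨ ∃ w ∉ M, s = .output w := by
  cases s with
  | input w => exact .inr (.inl ⟨w, hs, rfl⟩)
  | output w => exact .inr (.inr ⟨w, hs, rfl⟩)
  | cellZ w k => exact .inl ⟨⟨w, .inl (⟨k, Finset.mem_Ico.2 hs⟩, true)⟩, rfl⟩
  | cellX w k => exact .inl ⟨⟨w, .inl (⟨k, Finset.mem_Ico.2 hs⟩, false)⟩, rfl⟩
  | main w => exact .inl ⟨⟨w, .inr (.inl (.inl ()))⟩, rfl⟩
  | conj w => exact .inl ⟨⟨w, .inr (.inl (.inr (.inl ())))⟩, rfl⟩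
  | branch w => exact .inl ⟨⟨w, .inr (.inl (.inr (.inr ())))⟩, rfl⟩
  | unconj w => exact .inl ⟨⟨w, .inr (.inr (⟨(), hs⟩, true))⟩, rfl⟩
  | correct w => exact .inl ⟨⟨w, .inr (.inr (⟨(), hs⟩, false))⟩, rfl⟩

end Places

end Schedule

end ZX

/-! ### The circuit is circuit-like -/

namespace ZX

namespace Schedule

section Diagram

variable {V : Type} [Fintype V] {G : SimpleGraph V} {I O : Set V} (S : Schedule G I Oᶜ)

/-- The wires at the boundary. -/
def boundaryWire {V : Type} (I O : Set V) : I ⊕ O → Wire V :=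
  Sum.elim (fun q => .vertex 0 q) fun q => .vertex 1 q

/-- The site of a vertex. -/
def vertexSite : S.Place ⊕ (I ⊕ O) → Site V :=
  Sum.elim S.site (Sum.elim (fun q => .input q) fun q => .output q)

variable {S}

omit [Fintype V] in
theorem valid_vertexSite (v : S.Place ⊕ (I ⊕ O)) : S.Valid (S.vertexSite v) := by
  rcases v with n | q | q
  · exact valid_site n
  · exact q.2
  · exact not_not.2 q.2

omit [Fintype V] in
theorem vertexSite_injective : Function.Injective S.vertexSite := by
  have h1 : ∀ (n : S.Place) w, S.site n ≠ .input w := by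
    rintro ⟨w, (⟨k, _ | _⟩ | ((_ | _ | _) | ⟨h, _ | _⟩))⟩ w' h <;> cases h
  have h2 : ∀ (n : S.Place) w, S.site n ≠ .output w := by
    rintro ⟨w, (⟨k, _ | _⟩ | ((_ | _ | _) | ⟨h, _ | _⟩))⟩ w' h <;> cases h
  rintro (n | q | q) (n' | q' | q') h
  · rw [site_injective h]
  · exact absurd h (h1 _ _)
  · exact absurd h (h2 _ _)
  · exact absurd h.symm (h1 _ _)
  · rw [Subtype.ext (Site.input.inj h)]
  · cases h
  · exact absurd h.symm (h2 _ _)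
  · cases h
  · rw [Subtype.ext (Site.output.inj h)]

omit [Fintype V] in
theorem exists_vertexSite_eq {s : Site V} (hs : S.Valid s) : ∃ v, S.vertexSite v = s := by
  rcases exists_site_eq hs with ⟨n, rfl⟩ | ⟨w, hw, rfl⟩ | ⟨w, hw, rfl⟩
  · exact ⟨.inl n, rfl⟩
  · exact ⟨.inr (.inl ⟨w, hw⟩), rfl⟩
  · exact ⟨.inr (.inr ⟨w, not_not.1 hw⟩), rfl⟩

theorem wires_vertexSite (v : S.Place ⊕ (I ⊕ O)) :
    Sum.elim (fun n => S.siteWires (S.site n)) (fun d => {boundaryWire I O d}) v =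
      S.siteWires (S.vertexSite v) := by
  rcases v with n | q | q <;> rfl

variable (S)

-- The level of a branch determines its time, and times are injective, so a level has at most one
-- branch. For levels without one the dummy `v₀` is taken.
omit [Fintype V] in
theorem exists_centre (v₀ : S.Place ⊕ (I ⊕ O)) : ∃ centre : ℕ → S.Place ⊕ (I ⊕ O),
    ∀ v w, S.vertexSite v = .branch w → v = centre (S.level (S.vertexSite v)) := by
  classical
  refine ⟨fun n => if h : ∃ v w, S.vertexSite v = .branch w ∧ S.level (.branch w) = n then h.choose
    else v₀, fun v w hv => ?_⟩
  have h : ∃ v' w', S.vertexSite v' = .branch w' ∧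
    S.level (.branch w') = S.level (S.vertexSite v) := ⟨v, w, hv, by rw [hv]⟩
  beta_reduce
  rw [dif_pos h]
  obtain ⟨w', hw', hl⟩ := h.choose_spec
  rw [hv] at hl
  have : w' = w := S.time_injective (by simp only [level] at hl; lia)
  exact vertexSite_injective (hv.trans (this ▸ hw'.symm))

/-- The diagram has the sites as its vertices. The covering paths are the orbits of `succ`, with the
rank as the increasing quantity; causality follows from the level. -/
theorem exists_circuitLike {θ b : V → Real.Angle}
    (h : Proper (S.circuitTerm θ b) (boundaryWire I O)) :
    ∃ D : Diagram V (I ⊕ O), D.Described (S.circuitTerm θ b) (boundaryWire I O) ∧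
      D.Unconditional ∧ D.CircuitLike := by
  have hT := S.fam_site_eq_circuitTerm θ b
  rw [← hT] at h
  let D := Diagram.ofTerm _ _ _ h
  have hlink : ∀ {u v : S.Place ⊕ (I ⊕ O)} {x}, u ≠ v →
      x ∈ Sum.elim (fun n => S.siteWires (S.site n)) (fun d => {boundaryWire I O d}) u →
      x ∈ Sum.elim (fun n => S.siteWires (S.site n)) (fun d => {boundaryWire I O d}) v →
      S.Link x (S.vertexSite u) (S.vertexSite v) ∨ S.Link x (S.vertexSite v) (S.vertexSite u) := by
    intro u v x hne hu hv
    rw [wires_vertexSite] at hu hv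
    exact link_of_mem_of_mem (valid_vertexSite u) (valid_vertexSite v)
      (vertexSite_injective.ne hne) hu hv
  have hsimple : D.IsSimple := by
    refine isSimple_ofTerm h (fun n => nodup_siteWires _) fun u v hne w w' h1 h2 h3 h4 => ?_
    rw [wires_vertexSite] at h1 h2 h3 h4
    exact eq_of_mem_of_mem (valid_vertexSite u) (valid_vertexSite v)
      (vertexSite_injective.ne hne) h1 h2 h3 h4
  have hadj : ∀ {u v : S.Place ⊕ (I ⊕ O)} {x}, S.Link x (S.vertexSite u) (S.vertexSite v) →
      D.graph.Adj u v := by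
    intro u v x hx
    refine (adj_ofTerm_iff h).2 ⟨?_, x, ?_, ?_⟩
    · rintro rfl
      exact hx.rank_lt.false
    · rw [wires_vertexSite]
      exact hx.mem.1
    · rw [wires_vertexSite]
      exact hx.mem.2
  refine ⟨D, hT ▸ Diagram.ofTerm_described _ _ _ h, ?_, ⟨?_, hsimple, ?_⟩⟩
  · rintro n c φ (hn : siteKind θ b (S.site n) = _)
    rcases n with ⟨w, (⟨k, _ | _⟩ | ((_ | _ | _) | ⟨h, _ | _⟩))⟩ <;>
      first
      | (obtain ⟨-, rfl⟩ := Kind.spider.inj hn; simp [Phase.on])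
      | cases hn
  · let R : S.Place ⊕ (I ⊕ O) → S.Place ⊕ (I ⊕ O) → Prop := fun u v =>
      S.succ (S.vertexSite u) = some (S.vertexSite v)
    obtain ⟨Ps, h1, h2, h3, h4, h5, h6⟩ := exists_paths (R := R)
      (fun s t t' h h' => vertexSite_injective (Option.some_injective _ (h.symm.trans h')))
      (fun s s' t h h' => vertexSite_injective
        (succ_injective (valid_vertexSite s) (valid_vertexSite s') h h'))
      (fun v => S.rank (S.vertexSite v))
      (fun s t h => (Link.of_succ (valid_vertexSite s) h).choose_spec.rank_lt)
    refine ⟨Ps, ⟨fun p hp => (h1 p hp).imp fun u v huv => ?_, h2, fun p hp => ?_, h4, h5⟩, ?_⟩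
    · exact hadj (Link.of_succ (valid_vertexSite u) huv).choose_spec
    · obtain ⟨e, he, he'⟩ := h3 p hp
      -- The successor of a valid site is valid, hence a vertex; so a path can only stop where
      -- `succ` is undefined, at an output.
      have hnone : S.succ (S.vertexSite e) = none := by
        rw [Option.eq_none_iff_forall_ne_some]
        intro s hs
        obtain ⟨x, hx⟩ := Link.of_succ (valid_vertexSite e) hs
        obtain ⟨v, rfl⟩ := exists_vertexSite_eq hx.right_valid
        exact he' v hs
      obtain ⟨w, hw⟩ := succ_eq_none hnone
      have hO : w ∈ O := not_not.1 (hw ▸ valid_vertexSite e :)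
      refine ⟨⟨w, hO⟩, he.trans (congrArg some ?_)⟩
      exact vertexSite_injective hw
    · intro v γ hγ _
      by_contra hback
      push Not at hback
      obtain ⟨centre, hcentre⟩ := S.exists_centre v
      -- If no path edge is opposed, no step lowers the level, and every step within a level has the
      -- branch of that level as one of its ends.
      refine not_isCycle_of_level γ hγ (fun v => S.level (S.vertexSite v)) centre fun d hd => ?_
      obtain ⟨hne, x, hx, hx'⟩ := (adj_ofTerm_iff h).1 d.adj
      rcases hlink hne hx hx' with hl | hl
      · refine ⟨hl.level_le.1, fun he => .inl ?_⟩
        obtain ⟨w, hw⟩ := hl.level_le.2 he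
        exact hcentre _ w hw
      · rcases hl.succ_or with hs | hs
        · obtain ⟨p, hp, hpd⟩ := h6 _ _ hs
          exact absurd hpd (hback p hp d hd)
        · refine ⟨hs.symm.le, fun he => .inr ?_⟩
          obtain ⟨w, hw⟩ := hl.level_le.2 hs
          exact (hcentre _ w hw).trans (congrArg centre hs)
  · refine isThreeColoured_ofTerm h (fun m n w hm hn hne => ?_) hsimple
    have hi : ∀ (n : S.Place) w, S.site n ≠ .input w := fun n w hw => by
      have := vertexSite_injective (S := S) (a₁ := .inl n) (a₂ := .inr (.inl ⟨w, by
        exact (hw ▸ valid_site n :)⟩)) hw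
      cases this
    have ho : ∀ (n : S.Place) w, S.site n ≠ .output w := fun n w hw => by
      have := vertexSite_injective (S := S) (a₁ := .inl n) (a₂ := .inr (.inr ⟨w, by
        exact not_not.1 (hw ▸ valid_site n :)⟩)) hw
      cases this
    rcases hlink (u := .inl m) (v := .inl n) (Sum.inl_injective.ne hne) hm hn with hl | hl
    · exact hl.not_sameColour (hi m) (ho n) θ b
    · exact fun hsame => hl.not_sameColour (hi n) (ho m) θ b hsame.symm

end Diagram

end Schedule

end ZX

theorem mainTheorem2 {V : Type} [Finite V] (P : ZX.Pattern V) (F : P.geometry.Flow)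
    (hP : P.HasFlowCorrectors F) :
    ∃ D : ZX.Diagram V (P.inputs ⊕ P.outputs),
      ZX.Rewrites P.diagram D ∧ D.Unconditional ∧ D.CircuitLike := by
  cases nonempty_fintype V
  obtain ⟨S, θ, b, D, hD, hD'⟩ := P.exists_rewrites_graphStateTerm F hP
  -- The boundary wires are numbered 0 and 1, while the inner wires of vertex type have numbers from
  -- 5 on.
  obtain ⟨hS, hrw⟩ := S.exists_rewrites_circuit hD' fun d => by
    rcases d with q | q
    · exact fun h : 5 ≤ 0 => absurd h (by simp)
    · exact fun h : 5 ≤ 1 => absurd h (by simp)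
  obtain ⟨D', hT, hU, hC⟩ := S.exists_circuitLike hS
  exact ⟨D', hD.trans (hrw D' hT), hU, hC⟩
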